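/- Let $m,n\ge 0$ be integers with $n$ even, $N=m+n>2$, $s=\lfloor N/2\rfloor$, $i'=N+1-i$, and $\mathbb K=\mathbb C(q^{1/2})$ with $q^{1/2}$ an indeterminate. Let $V$ be the superspace over $\mathbb K$ of dimension $m|n$ with homogeneous basis $v_1,\dots,v_N$, parities $\bar i=|v_i|=|v_{i'}|$, and choose signs $\vartheta_i=\pm1$ with $\vartheta_i=1$ if $\bar i=\bar 0$ and $\vartheta_i=-\vartheta_{i'}$ if $\bar i=\bar 1$. Let $E_{ij}$ be the matrix units and $X_{ij}=E_{ij}-(-1)^{\bar i(\bar i+\bar j)}\vartheta_i\vartheta_jE_{j'i'}$. Let $P=\bigoplus_{i=1}^s\mathbb Z\varepsilon_i$ with $(\varepsilon_i,\varepsilon_j)=\delta_{ij}(-1)^{\bar i}$ for $i,j\le s$, $\varepsilon_{i'}=-\varepsilon_i$, and $\varepsilon_{s+1}=0$ for odd $N$; extend parity additively to $P$ by $\varepsilon_i\mapsto\bar i$. Put $\alpha_i=\varepsilon_i-\varepsilon_{i+1}$, $\mathsf e_i=X_{i,i+1}$, $\mathsf f_i=(-1)^{\bar i}X_{i+1,i}$,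 $\mathsf h_i=(-1)^{\bar i}X_{ii}-(-1)^{\overline{i+1}}X_{i+1,i+1}$ and $\kappa_i=1$ for $1\le i\le s$, except that for even $m$ and $i=s$: if $\bar s=\bar 0$ then $\alpha_s=\varepsilon_{s-1}+\varepsilon_s$, $\mathsf e_s=X_{s-1,s+1}$, $\mathsf f_s=(-1)^{\overline{s-1}}X_{s+1,s-1}$, $\mathsf h_s=(-1)^{\overline{s-1}}X_{s-1,s-1}-(-1)^{\overline{s+1}}X_{s+1,s+1}$, $\kappa_s=1$; if $\bar s=\bar 1$ then $\alpha_s=2\varepsilon_s$, $\mathsf e_s=E_{s,s+1}$, $\mathsf f_s=-2E_{s+1,s}$, $\mathsf h_s=-2X_{ss}$, $\kappa_s=\frac{q+q^{-1}}2$. Let $\theta=\varepsilon_1+\varepsilon_2$ if $|v_1|=\bar 0$ and $\theta=2\varepsilon_1$ if $|v_1|=\bar 1$, write $\theta=\sum_{i=1}^s\mathsf k_i\alpha_i$, and let $\alpha_0=\delta-\theta$, where $\delta$ is even and orthogonal to everything. Put $a_{ij}=(\alpha_i,\alpha_j)$. Let $U'_q(\widehat{\mathfrak{osp}}(V))$ be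 the $\mathbb K$-superalgebra generated by $e_i,f_i$ (of the parity of $\alpha_i$) and the even elements $q^{\pm h_i/2}$ ($0\le i\le s$), $\gamma^{\pm1}$, with relations $$\gamma^{\pm1}\gamma^{\mp1}=1,\quad \gamma=q^{h_0/2}\prod_{i=1}^s(q^{h_i/2})^{\mathsf k_i},\quad \gamma\ \text{central},\quad [q^{h_i/2},q^{h_j/2}]=0,\quad q^{\pm h_i/2}q^{\mp h_i/2}=1,$$ $$q^{h_i/2}e_jq^{-h_i/2}=q^{a_{ij}/2}e_j,\quad q^{h_i/2}f_jq^{-h_i/2}=q^{-a_{ij}/2}f_j,\quad [e_i,f_j]=\delta_{ij}\frac{q^{h_i}-q^{-h_i}}{q-q^{-1}}$$ (supercommutators), and all standard and higher order $q$-Serre relations among the $e_i$ and among the $f_i$. The latter mean the following: on the free superalgebra with generators $x_0,\dots,x_s$ take the bilinear form with $(1,1)=1$, $(1,x_iy)=0$, $(x_iy,z)=(y,r_i(z))$, where $r_i(1)=0$ and $r_i(x_jz)=\delta_{ij}z+(-1)^{|\alpha_i||\alpha_j|}q^{a_{ij}}x_jr_i(z)$; every element of its radical is set to $0$ after substituting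 $x_i=e_i$, and after substituting $x_i=f_i$. Let $U_q(\mathfrak{osp}(V))$ be the superalgebra defined in the same way with the indices $1,\dots,s$ only and without $\gamma^{\pm1}$. **Proposition.** Let $u,a,b\in\mathbb K^\times$, with $ab=-(q+q^{-1})$ if $|v_1|=\bar 1$ and $ab=(-1)^{\bar 2}$ if $|v_1|=\bar 0$. The assignment $\varrho(e_i)=\mathsf e_i$, $\varrho(f_i)=\kappa_i\mathsf f_i$, $\varrho(q^{\pm h_i/2})=q^{\pm\mathsf h_i/2}$ ($1\le i\le s$) defines a superalgebra homomorphism $\varrho:U_q(\mathfrak{osp}(V))\to\mathrm{End}(V)$, and it extends to a superalgebra homomorphism $\varrho^{a,b}_u:U'_q(\widehat{\mathfrak{osp}}(V))\to\mathrm{End}(V)$, that is, to a module $V(u)=V$, which agrees with $\varrho$ on $e_i,f_i,q^{\pm h_i/2}$ for $1\le i\le s$, satisfies $\varrho^{a,b}_u(\gamma^{\pm1})=\mathrm I$, and is given on the remaining generators as follows. * If $|v_1|=\bar 1$: $e_0\mapsto au\,E_{1'1}$, $f_0\mapsto bu^{-1}E_{11'}$, $q^{\pm h_0/2}\mapsto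 q^{\pm X_{11}}$. * If $|v_1|=\bar 0$: $e_0\mapsto au\,X_{2'1}$, $f_0\mapsto bu^{-1}X_{12'}$, $q^{\pm h_0/2}\mapsto q^{\mp((-1)^{\bar 1}X_{11}+(-1)^{\bar 2}X_{22})/2}$. In particular, write $[\![x,y]\!]=xy-(-1)^{|x||y|}q^{(\deg x,\deg y)}yx$ and $[k]_q=\frac{q^k-q^{-k}}{q-q^{-1}}$. Then the operators by which $e_0,\dots,e_s$ act, and likewise those by which $f_0,\dots,f_s$ act (of degrees $\alpha_i$, respectively $-\alpha_i$), written $x_0,\dots,x_s$, satisfy: 1. $[\![x_i,x_j]\!]=0$ whenever $a_{ij}=0$; 2. $[\![x_i,[\![x_i,\dots,[\![x_i,x_j]\!]\dots]\!]]\!]=0$ ($x_i$ occurring $1-2a_{ij}/a_{ii}$ times) for $i\ne j$, $a_{ii}\ne0$ with $-2a_{ij}/a_{ii}$ a nonnegative integer; 3. $(-1)^{|\alpha_i||\alpha_k|}[a_{ik}]_q[\![[\![x_i,x_j]\!],x_k]\!]=(-1)^{|\alpha_i||\alpha_j|}[a_{ij}]_q[\![[\![x_i,x_k]\!],x_j]\!]$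 for distinct $i,j,k$ with $a_{ij},a_{ik},a_{jk}\neq0$, $a_{ij}+a_{ik}+a_{jk}=0$ and $|\alpha_i||\alpha_j|+|\alpha_i||\alpha_k|+|\alpha_j||\alpha_k|=\bar 1$; 4. for $(m,n)=(4,2)$, with $(\bar 1,\bar 2,\bar 3)=(1,0,0)$ and $(i,j,k,l)=(0,1,2,3)$, or with $(\bar 1,\bar 2,\bar 3)=(0,0,1)$ and $(i,j,k,l)=(3,2,0,1)$: $[\![[\![[\![x_j,x_i]\!],[\![x_j,x_k]\!]]\!],[\![x_j,x_l]\!]]\!]=[\![[\![[\![x_j,x_i]\!],[\![x_j,x_l]\!]]\!],[\![x_j,x_k]\!]]\!]$; 5. for $(m,n)=(3,2)$, $(\bar 1,\bar 2)=(1,0)$ and $(i,j,k)=(0,1,2)$: $[\![[\![x_k,x_j]\!],[\![[\![x_k,x_j]\!],[\![[\![x_k,x_j]\!],x_i]\!]]\!]]\!]=(1-[2]_q)[\![[\![[\![x_k,x_j]\!],[\![x_k,[\![x_k,[\![x_j,x_i]\!]]\!]]\!]]\!],x_j]\!]$. -/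

import Mathlib

namespace QOsp

noncomputable section

/-! ### The ground field and signs -/

/-- The ground field `ℂ(q^{1/2})`: rational functions over `ℂ` in the indeterminate `q^{1/2}`. -/
abbrev GroundField : Type := RatFunc ℂ

/-- The element `q^{1/2}` of the ground field. -/
def qHalf : GroundField := RatFunc.X

/-- The element `q` of the ground field. -/
def qElt : GroundField := qHalf ^ 2

/-- The `q`-integer `[k]_q = (q^k - q^{-k}) / (q - q^{-1})`. -/
def qInt (k : ℤ) : GroundField := (qElt ^ k - qElt ^ (-k)) / (qElt - qElt⁻¹)

/-- The sign `(-1)^p` of a parity `p ∈ ℤ/2`. -/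
def paritySign (p : ZMod 2) : ℤ := if p = 0 then 1 else -1

/-! ### Quantum supergroups attached to a symmetrized Cartan matrix

The `q`-Serre relations are imposed in the uniform way: on the free superalgebra with generators
indexed by `I` there is a bilinear form, determined by `(1, 1) = 1` and
`(i · x, y) = (x, r_i(y))`, where `r_i` is the `i`-th skew derivation.  The ideal of all (standard
and higher order) `q`-Serre relations is the radical of this form, so that the positive and
the negative part of the quantum supergroup are in nondegenerate duality. -/

/-- A symmetrized Cartan matrix together with the parities of the simple roots. -/
structure CartanDatum (I : Type) where
  /-- the integers `a_{ij} = (α_i, α_j)` -/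
  pairing : I → I → ℤ
  /-- the parities `|e_i| = |f_i|` -/
  parity : I → ZMod 2

section Radical

variable {I : Type} [DecidableEq I]

/-- The skew derivation `r_i` of the free superalgebra, on the basis of words (elements of the
free algebra are finitely supported functions on words):
`r_i(1) = 0`, `r_i(j · w) = δ_{ij} w + (-1)^{|i||j|} q^{(α_i, α_j)} j · r_i(w)`. -/
def skewDeriv (C : CartanDatum I) (i : I) : List I → (List I →₀ GroundField)
  | [] => 0
  | j :: w =>
      (if i = j then Finsupp.single w 1 else 0) +
        ((paritySign (C.parity i * C.parity j) : GroundField) * qElt ^ C.pairing i j) •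
          (skewDeriv C i w).mapDomain (fun x => j :: x)

/-- The bilinear form on words: `(1, w) = δ_{w,1}` and `(i · x, w) = (x, r_i(w))`. -/
def wordForm (C : CartanDatum I) : List I → List I → GroundField
  | [], w => if w = [] then 1 else 0
  | i :: x, w => (skewDeriv C i w).sum fun y b => b * wordForm C x y

/-- The element `c = ∑ c_w w` of the free superalgebra lies in the radical of the form. -/
def InSerreRadical (C : CartanDatum I) (c : List I →₀ GroundField) : Prop :=
  ∀ x : List I, (c.sum fun w b => b * wordForm C x w) = 0

end Radical

/-- The image of `c = ∑ c_w w` under the homomorphism from the free algebra to `A` that sends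
the generator `i` to `x i`. -/
def evalWords {I A : Type} [Ring A] [Algebra GroundField A] (x : I → A)
    (c : List I →₀ GroundField) : A :=
  c.sum fun w b => b • (w.map x).prod

/-- The Chevalley relations and the `q`-Serre relations, for families of elements
`e i`, `f i`, `t i = q^{h_i/2}`, `t' i = q^{-h_i/2}` of an algebra. -/
inductive ChevalleySerreRel {I A : Type} [DecidableEq I] [Ring A] [Algebra GroundField A]
    (C : CartanDatum I) (e f t t' : I → A) : A → A → Prop
  | t_comm (i j : I) : ChevalleySerreRel C e f t t' (t i * t j) (t j * t i)
  | t_mul_inv (i : I) : ChevalleySerreRel C e f t t' (t i * t' i) 1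
  | inv_mul_t (i : I) : ChevalleySerreRel C e f t t' (t' i * t i) 1
  | t_e (i j : I) :
      ChevalleySerreRel C e f t t' (t i * e j * t' i) (qHalf ^ C.pairing i j • e j)
  | t_f (i j : I) :
      ChevalleySerreRel C e f t t' (t i * f j * t' i) (qHalf ^ (-C.pairing i j) • f j)
  | e_f (i j : I) :
      ChevalleySerreRel C e f t t'
        (e i * f j - paritySign (C.parity i * C.parity j) • (f j * e i))
        (if i = j then (qElt - qElt⁻¹)⁻¹ • (t i ^ 2 - t' i ^ 2) else 0)
  | serre_e (c : List I →₀ GroundField) (hc : InSerreRadical C c) :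
      ChevalleySerreRel C e f t t' (evalWords e c) 0
  | serre_f (c : List I →₀ GroundField) (hc : InSerreRadical C c) :
      ChevalleySerreRel C e f t t' (evalWords f c) 0

/-- Chevalley generators `e_i`, `f_i`, `q^{h_i/2}`, `q^{-h_i/2}`. -/
inductive ChevGen (I : Type) : Type
  | e (i : I)
  | f (i : I)
  | t (i : I)
  | tInv (i : I)

/-- Generators of the affine algebra without degree generators: the Chevalley generators
and `γ`, `γ⁻¹`. -/
inductive AffGen (I : Type) : Type
  | chev (g : ChevGen I)
  | gam
  | gamInv

/-- The parity of a Chevalley generator. -/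
def ChevGen.parity {I : Type} (C : CartanDatum I) : ChevGen I → ZMod 2
  | .e i => C.parity i
  | .f i => C.parity i
  | .t _ => 0
  | .tInv _ => 0

/-- The parity of a generator of the affine algebra. -/
def AffGen.parity {I : Type} (C : CartanDatum I) : AffGen I → ZMod 2
  | .chev g => g.parity C
  | .gam => 0
  | .gamInv => 0

/-- For an algebra with a family of generators `x g` of parities `p g`: the component of
parity `r`, spanned by the monomials in the generators of total parity `r`. -/
def gradedPart {G A : Type} [Ring A] [Algebra GroundField A] (p : G → ZMod 2) (x : G → A)
    (r : ZMod 2) : Submodule GroundField A :=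
  Submodule.span GroundField {y | ∃ l : List G, (l.map p).sum = r ∧ y = (l.map x).prod}

/-! ### Iterated `q`-superbrackets -/

/-- Formal iterated brackets of generators indexed by `I`. -/
inductive BracketTree (I : Type) : Type
  | gen (i : I)
  | br (l r : BracketTree I)

/-- The list of generators that occur in an iterated bracket; the degree of the bracket is
the sum of the corresponding simple roots. -/
def BracketTree.leaves {I : Type} : BracketTree I → List I
  | .gen i => [i]
  | .br l r => l.leaves ++ r.leaves

/-- The parity of an iterated bracket. -/
def BracketTree.parity {I : Type} (C : CartanDatum I) (b : BracketTree I) : ZMod 2 :=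
  (b.leaves.map C.parity).sum

/-- The pairing `(deg b, deg b')` of the degrees of two iterated brackets. -/
def BracketTree.degPairing {I : Type} (C : CartanDatum I) (b b' : BracketTree I) : ℤ :=
  (b.leaves.map fun i => (b'.leaves.map fun j => C.pairing i j).sum).sum

/-- The value of an iterated bracket at elements `x i` of an algebra (where `x i` has parity
`|α_i|` and degree `α_i`, or `-α_i` for all `i`), with the `q`-superbracket
`⟦a, b⟧ = a b - (-1)^{|a||b|} q^{(deg a, deg b)} b a`. -/
def BracketTree.eval {I A : Type} [Ring A] [Algebra GroundField A] (C : CartanDatum I)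
    (x : I → A) : BracketTree I → A
  | .gen i => x i
  | .br l r =>
      l.eval C x * r.eval C x -
        ((paritySign (l.parity C * r.parity C) : GroundField) * qElt ^ l.degPairing C r) •
          (r.eval C x * l.eval C x)

/-! ### The orthosymplectic setup -/

/-- The standing data: `n` even, `N = m + n > 2`, parities `par i` of the basis vectors
`v_1, …, v_N` of `V = ℂ^{m|n}` with `par i' = par i` for `i' = N + 1 - i`, and signs `ϑ_i`.
Indices are numbered from `1` to `N`; values of the functions at other arguments play no role. -/
structure Setup (m n : ℕ) where
  even_n : Even n
  two_lt : 2 < m + n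
  /-- the parity `|v_i|` -/
  par : ℕ → ZMod 2
  par_prime : ∀ i ∈ Finset.Icc 1 (m + n), par (m + n + 1 - i) = par i
  card_even : ((Finset.Icc 1 (m + n)).filter fun i => par i = 0).card = m
  card_odd : ((Finset.Icc 1 (m + n)).filter fun i => par i = 1).card = n
  /-- the sign `ϑ_i` -/
  sgn : ℕ → ℤ
  sgn_unit : ∀ i ∈ Finset.Icc 1 (m + n), sgn i = 1 ∨ sgn i = -1
  sgn_even : ∀ i ∈ Finset.Icc 1 (m + n), par i = 0 → sgn i = 1
  sgn_odd : ∀ i ∈ Finset.Icc 1 (m + n), par i = 1 → sgn i = -sgn (m + n + 1 - i)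

/-- The rank `s = ⌊N/2⌋`. -/
abbrev rk (m n : ℕ) : ℕ := (m + n) / 2

/-- Matrices of size `N`, identified with `End(V)` through the basis `v_1, …, v_N`; the basis
vector `v_i` corresponds to the element `i - 1` of `Fin N`. -/
abbrev Mat (m n : ℕ) (R : Type) : Type := Matrix (Fin (m + n)) (Fin (m + n)) R

/-- The elementary matrix `E_{ij}`, for `1 ≤ i, j ≤ N`. -/
def E (m n : ℕ) (R : Type) [CommRing R] (i j : ℕ) : Mat m n R :=
  Matrix.of fun a b => if (a : ℕ) + 1 = i ∧ (b : ℕ) + 1 = j then 1 else 0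

/-- For a diagonal integer matrix `D`, the matrix `q^{D/2}`. -/
def qHalfPow {m n : ℕ} (D : Mat m n ℤ) : Mat m n GroundField :=
  Matrix.diagonal fun a => qHalf ^ D a a

namespace Setup

variable {m n : ℕ} (S : Setup m n)

/-- The involution `i ↦ i' = N + 1 - i` on `{1, …, N}`. -/
def prime (_ : Setup m n) (i : ℕ) : ℕ := m + n + 1 - i

/-- `X_{ij} = E_{ij} - (-1)^{|i|(|i|+|j|)} ϑ_i ϑ_j E_{j'i'}`. -/
def X (R : Type) [CommRing R] (i j : ℕ) : Mat m n R :=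
  E m n R i j -
    ((paritySign (S.par i * (S.par i + S.par j)) * S.sgn i * S.sgn j : ℤ) : R) •
      E m n R (S.prime j) (S.prime i)

/-- The sign `(-1)^{|v_i|}`. -/
def psign (i : ℕ) : ℤ := paritySign (S.par i)

/-- The operators of parity `r` on the superspace `V`. -/
def HasParity (r : ZMod 2) (M : Mat m n GroundField) : Prop :=
  ∀ a b : Fin (m + n), M a b ≠ 0 → S.par (a + 1) + S.par (b + 1) = r

/-! #### Weights and simple roots -/

/-- The weight `ε_i ∈ P = ℤ^s`, `1 ≤ i ≤ N`: the `i`-th basis vector for `i ≤ s`, with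
`ε_{i'} = -ε_i`, and `ε_{s+1} = 0` for `N` odd. -/
def eps (_ : Setup m n) (i : ℕ) : Fin (rk m n) → ℤ := fun k =>
  (if i = (k : ℕ) + 1 then 1 else 0) - (if m + n + 1 - i = (k : ℕ) + 1 then 1 else 0)

/-- The pairing on `P` with `(ε_i, ε_j) = δ_{ij} (-1)^{|v_i|}` for `1 ≤ i, j ≤ s`. -/
def pairP (x y : Fin (rk m n) → ℤ) : ℤ := ∑ k : Fin (rk m n), S.psign (k + 1) * x k * y k

/-- The parity of weights: additive, with `ε_i ↦ |v_i|`. A root `ε_a - ε_b` has a root vector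
`X_{ab}` of parity `|v_a| + |v_b|`, so this restricts to the parity of roots. -/
def parityP (x : Fin (rk m n) → ℤ) : ZMod 2 := ∑ k : Fin (rk m n), (x k : ZMod 2) * S.par (k + 1)

/-- The simple root `α_i`, `1 ≤ i ≤ s`. -/
def alpha (i : ℕ) : Fin (rk m n) → ℤ :=
  if Odd m ∨ i < rk m n then S.eps i - S.eps (i + 1)
  else if S.par (rk m n) = 0 then S.eps (rk m n - 1) - S.eps (rk m n + 1)
  else 2 • S.eps (rk m n)

/-- The highest root: `θ = ε_1 + ε_2` if `|v_1| = 0`, and `θ = 2 ε_1` if `|v_1| = 1`. -/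
def theta : Fin (rk m n) → ℤ :=
  if S.par 1 = 0 then S.eps 1 + S.eps 2 else 2 • S.eps 1

/-- The affine simple roots in `ℤ δ ⊕ P`: `α_0 = δ - θ`, and `α_i` for `1 ≤ i ≤ s`. -/
def alphaHat (i : Fin (rk m n + 1)) : ℤ × (Fin (rk m n) → ℤ) :=
  if (i : ℕ) = 0 then (1, -S.theta) else (0, S.alpha i)

/-- The Cartan datum of `osp(V)`; the element `i` of the index set stands for `α_{i+1}`. -/
def finDatum : CartanDatum (Fin (rk m n)) where
  pairing i j := S.pairP (S.alpha (i + 1)) (S.alpha (j + 1))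
  parity i := S.parityP (S.alpha (i + 1))

/-- The affine Cartan datum, with index set `{0, …, s}`; the element `δ` is even and
orthogonal to everything. -/
def affDatum : CartanDatum (Fin (rk m n + 1)) where
  pairing i j := S.pairP (S.alphaHat i).2 (S.alphaHat j).2
  parity i := S.parityP (S.alphaHat i).2

/-! #### The algebras `U_q(osp(V))` and `U'_q` of the affinization -/

/-- The defining relations of `U_q(osp(V))`. -/
def FinRel : FreeAlgebra GroundField (ChevGen (Fin (rk m n))) →
    FreeAlgebra GroundField (ChevGen (Fin (rk m n))) → Prop :=
  ChevalleySerreRel S.finDatum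
    (fun i => FreeAlgebra.ι GroundField (ChevGen.e i))
    (fun i => FreeAlgebra.ι GroundField (ChevGen.f i))
    (fun i => FreeAlgebra.ι GroundField (ChevGen.t i))
    (fun i => FreeAlgebra.ι GroundField (ChevGen.tInv i))

/-- The orthosymplectic quantum supergroup `U_q(osp(V))`. -/
abbrev Uq : Type := RingQuot S.FinRel

/-- The generators of `U_q(osp(V))`. -/
def finGen (g : ChevGen (Fin (rk m n))) : S.Uq :=
  RingQuot.mkAlgHom GroundField S.FinRel (FreeAlgebra.ι GroundField g)

/-- The defining relations of the affine algebra `U'_q` (without degree generators). In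
`gam_eq`, `k` is the (unique) family of coefficients in `θ = ∑ k_i α_i`. -/
inductive AffRel : FreeAlgebra GroundField (AffGen (Fin (rk m n + 1))) →
    FreeAlgebra GroundField (AffGen (Fin (rk m n + 1))) → Prop
  | chev_serre (x y : FreeAlgebra GroundField (AffGen (Fin (rk m n + 1))))
      (h : ChevalleySerreRel S.affDatum
        (fun i => FreeAlgebra.ι GroundField (AffGen.chev (ChevGen.e i)))
        (fun i => FreeAlgebra.ι GroundField (AffGen.chev (ChevGen.f i)))
        (fun i => FreeAlgebra.ι GroundField (AffGen.chev (ChevGen.t i)))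
        (fun i => FreeAlgebra.ι GroundField (AffGen.chev (ChevGen.tInv i))) x y) :
      AffRel x y
  | gam_mul_inv :
      AffRel (FreeAlgebra.ι GroundField AffGen.gam * FreeAlgebra.ι GroundField AffGen.gamInv) 1
  | inv_mul_gam :
      AffRel (FreeAlgebra.ι GroundField AffGen.gamInv * FreeAlgebra.ι GroundField AffGen.gam) 1
  | gam_eq (k : Fin (rk m n) → ℕ) (hk : S.theta = ∑ i, k i • S.alpha (i + 1)) :
      AffRel (FreeAlgebra.ι GroundField AffGen.gam)
        (FreeAlgebra.ι GroundField (AffGen.chev (ChevGen.t 0)) *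
          (List.ofFn fun i : Fin (rk m n) =>
            FreeAlgebra.ι GroundField (AffGen.chev (ChevGen.t i.succ)) ^ k i).prod)
  | gam_central (x : FreeAlgebra GroundField (AffGen (Fin (rk m n + 1)))) :
      AffRel (FreeAlgebra.ι GroundField AffGen.gam * x) (x * FreeAlgebra.ι GroundField AffGen.gam)

/-- The orthosymplectic quantum affine supergroup `U'_q` without degree generators. -/
abbrev UqAff : Type := RingQuot S.AffRel

/-- The generators of `U'_q`. -/
def affGen (g : AffGen (Fin (rk m n + 1))) : S.UqAff :=
  RingQuot.mkAlgHom GroundField S.AffRel (FreeAlgebra.ι GroundField g)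

/-- The Chevalley generators of `U'_q`. -/
def chevGen (g : ChevGen (Fin (rk m n + 1))) : S.UqAff := S.affGen (AffGen.chev g)

/-! #### The Chevalley-type generators of `osp(V)`, for `1 ≤ i ≤ s` -/

/-- `𝖾_i`. -/
def matE (i : ℕ) : Mat m n GroundField :=
  if Odd m ∨ i < rk m n then S.X GroundField i (i + 1)
  else if S.par (rk m n) = 0 then S.X GroundField (rk m n - 1) (rk m n + 1)
  else E m n GroundField (rk m n) (rk m n + 1)

/-- `𝖿_i`. -/
def matF (i : ℕ) : Mat m n GroundField :=
  if Odd m ∨ i < rk m n then S.psign i • S.X GroundField (i + 1) i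
  else if S.par (rk m n) = 0 then
    S.psign (rk m n - 1) • S.X GroundField (rk m n + 1) (rk m n - 1)
  else (-2 : ℤ) • E m n GroundField (rk m n + 1) (rk m n)

/-- `𝗁_i`, a diagonal matrix with integer entries. -/
def matH (i : ℕ) : Mat m n ℤ :=
  if Odd m ∨ i < rk m n then
    S.psign i • S.X ℤ i i - S.psign (i + 1) • S.X ℤ (i + 1) (i + 1)
  else if S.par (rk m n) = 0 then
    S.psign (rk m n - 1) • S.X ℤ (rk m n - 1) (rk m n - 1) -
      S.psign (rk m n + 1) • S.X ℤ (rk m n + 1) (rk m n + 1)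
  else (-2 : ℤ) • S.X ℤ (rk m n) (rk m n)

/-- The scalar `κ_i`. -/
def kappa (i : ℕ) : GroundField :=
  if Even m ∧ S.par (rk m n) = 1 ∧ i = rk m n then (qElt + qElt⁻¹) / 2 else 1

/-! #### Explicit `q`-Serre relations -/

open BracketTree in
/-- The standard `q`-Serre relations and those higher order `q`-Serre relations that do not hold
on `V` for degree reasons alone (one for triangles in the Dynkin diagram, one exceptional
for `osp(4|2)`, one exceptional for `osp(3|2)`), for elements `x_0, …, x_s` of an algebra. -/
structure ExplicitSerre {A : Type} [Ring A] [Algebra GroundField A]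
    (x : Fin (rk m n + 1) → A) : Prop where
  quadratic : ∀ i j, S.affDatum.pairing i j = 0 → (br (gen i) (gen j)).eval S.affDatum x = 0
  standard : ∀ (i j : Fin (rk m n + 1)) (r : ℕ), i ≠ j → S.affDatum.pairing i i ≠ 0 →
    (r : ℤ) * S.affDatum.pairing i i = -2 * S.affDatum.pairing i j →
    ((br (gen i))^[r + 1] (gen j)).eval S.affDatum x = 0
  triangle : ∀ i j k : Fin (rk m n + 1), i ≠ j → i ≠ k → j ≠ k →
    S.affDatum.pairing i j ≠ 0 → S.affDatum.pairing i k ≠ 0 → S.affDatum.pairing j k ≠ 0 →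
    S.affDatum.pairing i j + S.affDatum.pairing i k + S.affDatum.pairing j k = 0 →
    S.affDatum.parity i * S.affDatum.parity j + S.affDatum.parity i * S.affDatum.parity k +
      S.affDatum.parity j * S.affDatum.parity k = 1 →
    ((paritySign (S.affDatum.parity i * S.affDatum.parity k) : GroundField) *
        qInt (S.affDatum.pairing i k)) •
        (br (br (gen i) (gen j)) (gen k)).eval S.affDatum x =
      ((paritySign (S.affDatum.parity i * S.affDatum.parity j) : GroundField) *
        qInt (S.affDatum.pairing i j)) •
        (br (br (gen i) (gen k)) (gen j)).eval S.affDatum x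
  /-- The exceptional relation for `osp(4|2)`, with parity sequence `(1,0,0)` and
  `(i,j,k,l) = (0,1,2,3)`, or parity sequence `(0,0,1)` and `(i,j,k,l) = (3,2,0,1)`. -/
  osp42 : m = 4 → n = 2 → ∀ i j k l : Fin (rk m n + 1),
    (S.par 1 = 1 ∧ S.par 2 = 0 ∧ S.par 3 = 0 ∧
        (i : ℕ) = 0 ∧ (j : ℕ) = 1 ∧ (k : ℕ) = 2 ∧ (l : ℕ) = 3) ∨
      (S.par 1 = 0 ∧ S.par 2 = 0 ∧ S.par 3 = 1 ∧
        (i : ℕ) = 3 ∧ (j : ℕ) = 2 ∧ (k : ℕ) = 0 ∧ (l : ℕ) = 1) →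
    (br (br (br (gen j) (gen i)) (br (gen j) (gen k))) (br (gen j) (gen l))).eval
        S.affDatum x =
      (br (br (br (gen j) (gen i)) (br (gen j) (gen l))) (br (gen j) (gen k))).eval
        S.affDatum x
  /-- The exceptional relation for `osp(3|2)`, with parity sequence `(1,0)` and
  `(i,j,k) = (0,1,2)`. -/
  osp32 : m = 3 → n = 2 → S.par 1 = 1 → S.par 2 = 0 → ∀ i j k : Fin (rk m n + 1),
    (i : ℕ) = 0 → (j : ℕ) = 1 → (k : ℕ) = 2 →
    (br (br (gen k) (gen j))
        (br (br (gen k) (gen j)) (br (br (gen k) (gen j)) (gen i)))).eval S.affDatum x =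
      (1 - qInt 2) •
        (br (br (br (gen k) (gen j)) (br (gen k) (br (gen k) (br (gen j) (gen i)))))
          (gen j)).eval S.affDatum x

end Setup

end

end QOsp

/-! The Chevalley relations on $V$ are computations with matrix units. The substance is that every
element of the radical of the form acts by zero, although no generating set of the radical is at
hand. This is proved by a rigidity argument instead of a check of relations.

The argument is an induction on word length (`WeightRep.evalWords_eq_zero`). Let $c$ be a
homogeneous element of the radical, acting by $M$, and let all shorter elements of the radical act
by zero. The left and right skew derivatives of $c$ are shorter and lie in the radical again. The
supercommutator of a word with $f_j$ is expressed through these derivatives (`word_commutator`), so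
$M$ supercommutes with every $f_j$ (`WeightRep.commute_f`). The weights of the $v_a$ are distinct
and the $f_j$ connect the basis vectors, so $M$ is zero or a scalar of weight zero
(`rootSum_eq_zero_of_natural`, `WeightRep.scalar_of_rootSum_eq_zero`).

Weights alone cannot exclude a nonzero scalar, because $\delta$ becomes $0$ in $P$. The antipode
does. The radical is a coideal for the braided coproduct (`wordLift_split_mul_eq_zero`), so by
induction the antipode identity for $c$ keeps only its two extreme terms, $M+S(c)=0$
(`WeightRep.Crossing.word_add_braidAntipode`). On the other hand the dual of $V$ is $V$ with $e_0$
rescaled by a power of $q$ (`naturalCrossing`), which gives $S(c)^{T}G=q^kGM$ with $G$ invertible.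
For $M=r$ this reads $-r=q^kr$, and $r=0$ since $q$ is not a root of unity.

The relations among the $f_i$ follow from those among the $e_i$, because $f_i$ is up to a scalar the
conjugate of $e_i$ by $v_a\mapsto\vartheta_av_{a'}$. The finite algebra needs nothing new, since the
radical of a sub-datum embeds in the radical of the full datum (`InSerreRadical.map`). Of the
explicit relations, the quadratic, standard and triangle ones are shown to lie in the radical by
computing their skew derivatives. The two exceptional ones are verified by multiplying matrices. -/

namespace QOsp

noncomputable section
set_option linter.unusedSectionVars false
open Finsupp

/-! ### The braided coproduct and the radical of the form -/

section Words

variable {I : Type} [DecidableEq I]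

/-- The braiding factor of two letters. -/
def letterBraid (C : CartanDatum I) (i j : I) : GroundField :=
  (paritySign (C.parity i * C.parity j) : GroundField) * qElt ^ C.pairing i j

/-- The braiding factor of a letter and a word. -/
def wordBraid (C : CartanDatum I) (i : I) (w : List I) : GroundField :=
  (w.map (letterBraid C i)).prod

/-- Extension of a function on words to a linear map on the free algebra. -/
abbrev wordLift {V : Type*} [AddCommGroup V] [Module GroundField V] (f : List I → V) :
    (List I →₀ GroundField) →ₗ[GroundField] V :=
  Finsupp.linearCombination GroundField f

theorem inSerreRadical_iff {C : CartanDatum I} {c : List I →₀ GroundField} :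
    InSerreRadical C c ↔ ∀ x, wordLift (wordForm C x) c = 0 := Iff.rfl

theorem evalWords_eq_wordLift {A : Type} [Ring A] [Algebra GroundField A] (x : I → A)
    (c : List I →₀ GroundField) : evalWords x c = wordLift (fun w => (w.map x).prod) c := rfl

theorem wordForm_cons (C : CartanDatum I) (i : I) (x w : List I) :
    wordForm C (i :: x) w = wordLift (wordForm C x) (skewDeriv C i w) := rfl

theorem skewDeriv_cons (C : CartanDatum I) (i j : I) (w : List I) :
    skewDeriv C i (j :: w) = (if i = j then Finsupp.single w 1 else 0) +
      letterBraid C i j • (skewDeriv C i w).mapDomain (fun x => j :: x) := rfl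

theorem wordLift_skewDeriv_cons {V : Type*} [AddCommGroup V] [Module GroundField V]
    (C : CartanDatum I) (f : List I → V) (i j : I) (w : List I) :
    wordLift f (skewDeriv C i (j :: w)) = (if i = j then f w else 0) +
      letterBraid C i j • wordLift (fun x => f (j :: x)) (skewDeriv C i w) := by
  rw [skewDeriv_cons, map_add, map_smul, Finsupp.linearCombination_mapDomain]
  split_ifs <;> simp [Function.comp_def]

theorem wordLift_wordLift {V : Type*} [AddCommGroup V] [Module GroundField V]
    (f : List I → V) (g : List I → List I →₀ GroundField) (c : List I →₀ GroundField) :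
    wordLift f (wordLift g c) = wordLift (fun w => wordLift f (g w)) c := by
  simp only [wordLift, Finsupp.linearCombination_apply, Finsupp.sum, map_sum, map_smul]

theorem map_wordLift {V W : Type*} [AddCommGroup V] [Module GroundField V] [AddCommGroup W]
    [Module GroundField W] (L : V →ₗ[GroundField] W) (f : List I → V)
    (c : List I →₀ GroundField) : L (wordLift f c) = wordLift (fun w => L (f w)) c := by
  simp [wordLift, Finsupp.linearCombination_apply, Finsupp.sum]

theorem wordLift_smul {V : Type*} [AddCommGroup V] [Module GroundField V] (a : GroundField)
    (f : List I → V) (c : List I →₀ GroundField) :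
    wordLift (fun w => a • f w) c = a • wordLift f c := by
  simp only [wordLift, Finsupp.linearCombination_apply, Finsupp.sum, Finset.smul_sum]
  exact Finset.sum_congr rfl fun w _ => smul_comm _ _ _

theorem wordLift_congr {V : Type*} [AddCommGroup V] [Module GroundField V] {f g : List I → V}
    {c : List I →₀ GroundField} (h : ∀ w ∈ c.support, f w = g w) : wordLift f c = wordLift g c := by
  simp only [wordLift, Finsupp.linearCombination_apply, Finsupp.sum]
  exact Finset.sum_congr rfl fun w hw => by rw [h w hw]

/-- The value of a bilinear expression `B` on the braided coproduct of a word. -/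
def split {V : Type*} [AddCommGroup V] [Module GroundField V] (C : CartanDatum I) :
    List I → (List I → List I → V) → V
  | [], B => B [] []
  | j :: w, B => split C w (fun x y => B (j :: x) y) +
      split C w (fun x y => wordBraid C j x • B x (j :: y))

section split

variable {V W : Type*} [AddCommGroup V] [Module GroundField V] [AddCommGroup W]
  [Module GroundField W] (C : CartanDatum I)

theorem split_add (w : List I) (B B' : List I → List I → V) :
    split C w (fun x y => B x y + B' x y) = split C w B + split C w B' := by
  induction w generalizing B B' with
  | nil => rfl
  | cons j w ih =>
    simp only [split, smul_add]
    rw [ih, ih]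
    abel

theorem map_split (L : V →ₗ[GroundField] W) (w : List I) (B : List I → List I → V) :
    L (split C w B) = split C w (fun x y => L (B x y)) := by
  induction w generalizing B with
  | nil => rfl
  | cons j w ih => simp only [split, map_add, ih, map_smul]

theorem split_smul (w : List I) (a : GroundField) (B : List I → List I → V) :
    split C w (fun x y => a • B x y) = a • split C w B :=
  (map_split C (a • LinearMap.id) w B).symm

theorem split_sum {ι : Type*} (s : Finset ι) (w : List I) (B : ι → List I → List I → V) :
    split C w (fun x y => ∑ k ∈ s, B k x y) = ∑ k ∈ s, split C w (B k) := by
  induction w generalizing B with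
  | nil => rfl
  | cons j w ih => simp only [split, ih, Finset.smul_sum, Finset.sum_add_distrib]

/-- The coproduct of a word distributes its letters over the two factors without losing any, so only
pairs with the content of the word matter. -/
theorem split_congr {w : List I} {B B' : List I → List I → V}
    (h : ∀ x y, (x ++ y).Perm w → B x y = B' x y) : split C w B = split C w B' := by
  induction w generalizing B B' with
  | nil => exact h [] [] (List.Perm.refl _)
  | cons j w ih =>
    simp only [split]
    congr 1
    · exact ih fun x y hxy => h _ _ (by simpa using hxy)
    · exact ih fun x y hxy => by
        rw [h x (j :: y) (List.perm_middle.trans (hxy.cons j))]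

/-- One half of the counit property: the second factor is empty only if every letter goes left, and
then no braiding factor is picked up. -/
theorem split_right_nil (w : List I) (f : List I → V) :
    split C w (fun x y => if y = [] then f x else 0) = f w := by
  induction w generalizing f with
  | nil => simp [split]
  | cons j w ih =>
    have h0 : split C w (fun _ _ => (0 : V)) = 0 := by
      simpa using split_smul C w (0 : GroundField) (fun _ _ => (0 : V))
    simp [split, ih, h0]

/-- The other half of the counit property: every letter goes right past an empty first factor, so
each braiding factor is an empty product. -/
theorem split_left_nil (w : List I) (f : List I → V) :
    split C w (fun x y => if x = [] then f y else 0) = f w := by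
  induction w generalizing f with
  | nil => simp [split]
  | cons j w ih =>
    have h0 : split C w (fun _ _ => (0 : V)) = 0 := by
      simpa using split_smul C w (0 : GroundField) (fun _ _ => (0 : V))
    have h1 : split C w (fun x y => wordBraid C j x • if x = [] then f (j :: y) else 0) =
        split C w (fun x y => if x = [] then f (j :: y) else 0) :=
      split_congr C fun x y _ => by split_ifs with h <;> simp [h, wordBraid]
    rw [split, h1, ih (fun y => f (j :: y))]
    simp [h0]

end split

theorem letterBraid_comm {C : CartanDatum I} (hC : ∀ i j, C.pairing i j = C.pairing j i)
    (i j : I) : letterBraid C i j = letterBraid C j i := by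
  rw [letterBraid, letterBraid, hC, mul_comm (C.parity i)]

theorem qElt_ne_zero : qElt ≠ 0 := pow_ne_zero _ RatFunc.X_ne_zero

/-- Every word in the derivative of `w` has the content of `w` with one letter `i` removed, so its
braiding with `j` differs from that of `w` by exactly the factor of the pair. -/
theorem wordLift_skewDeriv_wordBraid {V : Type*} [AddCommGroup V] [Module GroundField V]
    (C : CartanDatum I) (f : List I → V) (i j : I) (w : List I) :
    letterBraid C j i • wordLift (fun x => wordBraid C j x • f x) (skewDeriv C i w) =
      wordBraid C j w • wordLift f (skewDeriv C i w) := by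
  induction w generalizing f with
  | nil => simp [skewDeriv]
  | cons k w ih =>
    have e3 : ∀ w, wordBraid C j (k :: w) = letterBraid C j k * wordBraid C j w :=
      fun _ => List.prod_cons
    have e : (fun x => wordBraid C j (k :: x) • f (k :: x)) =
        fun x => wordBraid C j x • (letterBraid C j k • f (k :: x)) := by
      funext x
      rw [e3, smul_smul, mul_comm]
    have e2 : wordLift (fun x => letterBraid C j k • f (k :: x)) (skewDeriv C i w) =
        letterBraid C j k • wordLift (fun x => f (k :: x)) (skewDeriv C i w) :=
      wordLift_smul _ _ _
    have ih' := ih (fun x => letterBraid C j k • f (k :: x))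
    rw [e2] at ih'
    rw [wordLift_skewDeriv_cons, wordLift_skewDeriv_cons, e, e3]
    generalize wordLift (fun x => wordBraid C j x • (letterBraid C j k • f (k :: x)))
      (skewDeriv C i w) = X at ih' ⊢
    generalize wordLift (fun x => f (k :: x)) (skewDeriv C i w) = Y at ih' ⊢
    rw [smul_add, smul_add, smul_smul, mul_comm, ← smul_smul, ih', smul_smul, smul_smul,
      smul_smul]
    congr 1
    · split_ifs with h
      · rw [h, smul_smul]
      · simp only [smul_zero]
    · congr 1
      ring

/-- The skew derivation acts on the first tensor factor of the coproduct. -/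
theorem wordLift_split_skewDeriv {V : Type*} [AddCommGroup V] [Module GroundField V]
    {C : CartanDatum I} (hC : ∀ i j, C.pairing i j = C.pairing j i)
    (i : I) (w : List I) (B : List I → List I → V) :
    wordLift (fun u => split C u B) (skewDeriv C i w) =
      split C w (fun u v => wordLift (fun u' => B u' v) (skewDeriv C i u)) := by
  induction w generalizing B with
  | nil => simp [skewDeriv, split]
  | cons j w ih =>
    rw [wordLift_skewDeriv_cons]
    simp only [split]
    have key : ∀ g h : List I → V, ∀ d, wordLift (fun u => g u + h u) d = wordLift g d + wordLift h d := by
      intro g h d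
      simp [wordLift, Finsupp.linearCombination_apply, Finsupp.sum, Finset.sum_add_distrib]
    rw [key, ih, ih]
    have e1 : split C w (fun x y => wordLift (fun u' => B u' y) (skewDeriv C i (j :: x))) =
        (if i = j then split C w B else 0) + letterBraid C i j •
          split C w (fun u v => wordLift (fun u' => B (j :: u') v) (skewDeriv C i u)) := by
      have : (fun x y => wordLift (fun u' => B u' y) (skewDeriv C i (j :: x))) = fun x y =>
          (if i = j then B x y else 0) +
          letterBraid C i j • wordLift (fun u' => B (j :: u') y) (skewDeriv C i x) := by
        funext x y
        rw [wordLift_skewDeriv_cons]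
      rw [this, split_add, split_smul]
      congr 1
      split_ifs
      · rfl
      · simpa using split_smul C w (0 : GroundField) (fun _ _ => (0 : V))
    rw [e1, smul_add, ← add_assoc]
    congr 1
    rw [← split_smul]
    refine split_congr C fun u v _ => ?_
    -- The symmetry of the pairing enters here: the derivation passes `j` with the factor of `(i,
    -- j)`, whereas the factor attached to moving `j` to the right is that of `(j, i)`.
    rw [letterBraid_comm hC]
    exact wordLift_skewDeriv_wordBraid C (fun u' => B u' (j :: v)) i j u

/-- The form of a product is the product of forms on the coproduct. -/
theorem wordForm_append {C : CartanDatum I} (hC : ∀ i j, C.pairing i j = C.pairing j i)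
    (x y w : List I) :
    wordForm C (x ++ y) w = split C w (fun u v => wordForm C x u * wordForm C y v) := by
  induction x generalizing w with
  | nil =>
    have := split_left_nil C w (wordForm C y)
    simpa [wordForm] using this.symm
  | cons i x ih =>
    rw [List.cons_append, wordForm_cons]
    simp only [funext ih]
    rw [wordLift_split_skewDeriv hC]
    refine split_congr C fun u v _ => ?_
    rw [wordForm_cons]
    have := map_wordLift (LinearMap.mulRight GroundField (wordForm C y v)) (wordForm C x)
      (skewDeriv C i u)
    simpa using this.symm

/-! ### Right derivations and stability of the radical -/

/-- The right skew derivation on words. -/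
def rightDeriv (C : CartanDatum I) (i : I) : List I → (List I →₀ GroundField)
  | [] => 0
  | j :: w => (rightDeriv C i w).mapDomain (fun x => j :: x) +
      (if i = j then Finsupp.single w (wordBraid C i w) else 0)

theorem wordLift_rightDeriv_cons {V : Type*} [AddCommGroup V] [Module GroundField V]
    (C : CartanDatum I) (f : List I → V) (i j : I) (w : List I) :
    wordLift f (rightDeriv C i (j :: w)) = wordLift (fun x => f (j :: x)) (rightDeriv C i w) +
      (if i = j then wordBraid C i w • f w else 0) := by
  rw [rightDeriv, map_add, Finsupp.linearCombination_mapDomain]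
  split_ifs <;> simp [Function.comp_def]

theorem wordForm_singleton (C : CartanDatum I) (i : I) (w : List I) :
    wordForm C [i] w = if w = [i] then 1 else 0 := by
  rw [wordForm_cons]
  cases w with
  | nil => simp [skewDeriv]
  | cons j w =>
    rw [wordLift_skewDeriv_cons]
    have : wordLift (fun x => wordForm C [] (j :: x)) (skewDeriv C i w) = 0 := by
      simp [wordLift, Finsupp.linearCombination_apply, wordForm, Finsupp.sum]
    rw [this]
    by_cases h : i = j
    · simp [h, wordForm]
    · simp [h, Ne.symm h]

/-- The right derivation is the component of the coproduct with the single letter `i` in the second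
factor; its braiding factor comes from moving that letter past the letters that stay left. -/
theorem split_right_singleton {V : Type*} [AddCommGroup V] [Module GroundField V]
    (C : CartanDatum I) (i : I) (w : List I) (f : List I → V) :
    split C w (fun u v => if v = [i] then f u else 0) = wordLift f (rightDeriv C i w) := by
  induction w generalizing f with
  | nil => simp [split, rightDeriv]
  | cons j w ih =>
    simp only [split]
    rw [ih, wordLift_rightDeriv_cons]
    congr 1
    by_cases h : i = j
    · subst h
      simp only [List.cons.injEq, true_and, if_true]
      rw [← split_right_nil C w (fun u => wordBraid C i u • f u)]
      exact split_congr C fun u v _ => by split_ifs <;> simp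
    · have h0 : split C w (fun _ _ => (0 : V)) = 0 := by
        simpa using split_smul C w (0 : GroundField) (fun _ _ => (0 : V))
      simp [h, Ne.symm h, h0]

/-- The form is defined through left multiplication only. Multiplicativity on the coproduct turns
right multiplication by a letter into the right derivation. -/
theorem wordForm_append_singleton {C : CartanDatum I}
    (hC : ∀ i j, C.pairing i j = C.pairing j i) (x : List I) (i : I) (w : List I) :
    wordForm C (x ++ [i]) w = wordLift (wordForm C x) (rightDeriv C i w) := by
  rw [wordForm_append hC, ← split_right_singleton]
  refine split_congr C fun u v _ => ?_
  rw [wordForm_singleton]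
  split_ifs <;> simp

theorem InSerreRadical.skewDeriv {C : CartanDatum I} {c : List I →₀ GroundField}
    (hc : InSerreRadical C c) (i : I) : InSerreRadical C (wordLift (skewDeriv C i) c) := by
  intro x
  have := wordLift_wordLift (wordForm C x) (QOsp.skewDeriv C i) c
  exact this.trans (hc (i :: x))

/-- Pairing the derivative with `x` is pairing the original element with `x ++ [i]`. -/
theorem InSerreRadical.rightDeriv {C : CartanDatum I}
    (hC : ∀ i j, C.pairing i j = C.pairing j i) {c : List I →₀ GroundField}
    (hc : InSerreRadical C c) (i : I) : InSerreRadical C (wordLift (rightDeriv C i) c) := by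
  intro x
  have h := wordLift_wordLift (wordForm C x) (QOsp.rightDeriv C i) c
  simp only [← wordForm_append_singleton hC] at h
  exact h.trans (hc (x ++ [i]))

/-! #### Homogeneity -/

theorem perm_of_mem_support_skewDeriv {C : CartanDatum I} {i : I} {w u : List I}
    (h : u ∈ (skewDeriv C i w).support) : (i :: u).Perm w := by
  classical
  induction w generalizing u with
  | nil => simp [skewDeriv] at h
  | cons j w ih =>
    rw [skewDeriv_cons] at h
    rcases Finset.mem_union.1 (Finsupp.support_add h) with h | h
    · split_ifs at h with hij
      · have := Finsupp.support_single_subset h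
        simp only [Finset.mem_singleton] at this
        rw [this, hij]
      · simp at h
    · have h2 := Finsupp.mapDomain_support (Finsupp.support_smul h)
      obtain ⟨v, hv, rfl⟩ := Finset.mem_image.1 h2
      exact (List.Perm.swap j i v).trans ((ih hv).cons j)

theorem perm_of_mem_support_rightDeriv {C : CartanDatum I} {i : I} {w u : List I}
    (h : u ∈ (rightDeriv C i w).support) : (i :: u).Perm w := by
  classical
  induction w generalizing u with
  | nil => simp [rightDeriv] at h
  | cons j w ih =>
    rw [rightDeriv] at h
    rcases Finset.mem_union.1 (Finsupp.support_add h) with h | h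
    · have h2 := Finsupp.mapDomain_support h
      obtain ⟨v, hv, rfl⟩ := Finset.mem_image.1 h2
      exact (List.Perm.swap j i v).trans ((ih hv).cons j)
    · split_ifs at h with hij
      · have := Finsupp.support_single_subset h
        simp only [Finset.mem_singleton] at this
        rw [this, hij]
      · simp at h

theorem mem_support_wordLift {g : List I → List I →₀ GroundField} {c : List I →₀ GroundField}
    {u : List I} (h : u ∈ (wordLift g c).support) : ∃ w ∈ c.support, u ∈ (g w).support := by
  by_contra! hcon
  rw [Finsupp.mem_support_iff] at h
  apply h
  simp only [wordLift, Finsupp.linearCombination_apply, Finsupp.sum, Finsupp.finsetSum_apply]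
  exact Finset.sum_eq_zero fun w hw => by
    simp [Finsupp.notMem_support_iff.1 (hcon w hw)]

/-- Each skew derivation removes one letter, so the form is graded by content. This is what makes
the radical graded. -/
theorem perm_of_wordForm_ne_zero {C : CartanDatum I} {x w : List I}
    (h : wordForm C x w ≠ 0) : x.Perm w := by
  induction x generalizing w with
  | nil =>
    simp only [wordForm, ne_eq, ite_eq_right_iff, one_ne_zero, imp_false, not_not] at h
    rw [h]
  | cons i x ih =>
    rw [wordForm_cons] at h
    obtain ⟨u, hu, hne⟩ : ∃ u ∈ (skewDeriv C i w).support, wordForm C x u ≠ 0 := by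
      by_contra! hcon
      exact h (by
        rw [wordLift_congr (g := fun _ => 0) hcon]
        simp [wordLift, Finsupp.linearCombination_apply, Finsupp.sum])
    exact ((ih hne).cons i).trans (perm_of_mem_support_skewDeriv hu)

theorem wordLift_filter {V : Type*} [AddCommGroup V] [Module GroundField V] (P : List I → Prop)
    [DecidablePred P] (f : List I → V) (c : List I →₀ GroundField) :
    wordLift f (c.filter P) = wordLift (fun w => if P w then f w else 0) c := by
  simp only [wordLift, Finsupp.linearCombination_apply]
  rw [Finsupp.sum_filter_index, Finsupp.sum, Finsupp.support_filter, Finset.sum_filter]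
  exact Finset.sum_congr rfl fun w _ => by split_ifs <;> simp

/-- The radical is graded by the content of words. -/
theorem InSerreRadical.filter {C : CartanDatum I} {c : List I →₀ GroundField}
    (hc : InSerreRadical C c) (P : List I → Prop) [DecidablePred P]
    (hP : ∀ x w : List I, x.Perm w → (P x ↔ P w)) : InSerreRadical C (c.filter P) := by
  intro x
  change wordLift (wordForm C x) (c.filter P) = 0
  rw [wordLift_filter]
  by_cases hx : P x
  · rw [wordLift_congr (g := wordForm C x)]
    · exact hc x
    · intro w _
      by_cases h : wordForm C x w = 0
      · simp [h]
      · rw [if_pos ((hP x w (perm_of_wordForm_ne_zero h)).1 hx)]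
  · rw [wordLift_congr (g := fun _ => 0)]
    · simp [wordLift, Finsupp.linearCombination_apply, Finsupp.sum]
    · intro w _
      by_cases h : wordForm C x w = 0
      · simp [h]
      · rw [if_neg fun hw => hx ((hP x w (perm_of_wordForm_ne_zero h)).2 hw)]

/-- A map that vanishes on homogeneous elements of the radical of bounded length vanishes on
all elements of the radical of bounded length. -/
theorem wordLift_eq_zero_of_homogeneous {V : Type*} [AddCommGroup V] [Module GroundField V]
    {C : CartanDatum I} (f : List I → V) {c : List I →₀ GroundField}
    (hc : InSerreRadical C c)
    (h : ∀ w ∈ c.support, ∀ d, InSerreRadical C d →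
      (∀ u ∈ d.support, (u : Multiset I) = w) → wordLift f d = 0) : wordLift f c = 0 := by
  classical
  have h1 : wordLift f c = ∑ m ∈ c.support.image (fun w : List I => (w : Multiset I)),
      wordLift f (c.filter fun w => (w : Multiset I) = m) := by
    simp only [wordLift_filter]
    simp only [wordLift, Finsupp.linearCombination_apply, Finsupp.sum]
    rw [Finset.sum_comm]
    refine Finset.sum_congr rfl fun w hw => ?_
    rw [Finset.sum_eq_single (w : Multiset I)]
    · simp
    · intro m _ hm
      simp [Ne.symm hm]
    · intro hm
      exact absurd (Finset.mem_image_of_mem _ hw) hm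
  rw [h1]
  refine Finset.sum_eq_zero fun m hm => ?_
  obtain ⟨w, hw, rfl⟩ := Finset.mem_image.1 hm
  refine h w hw _ (hc.filter _ fun x y hxy => ?_) fun u hu => ?_
  · rw [Multiset.coe_eq_coe.2 hxy]
  · rw [Finsupp.support_filter] at hu
    exact (Finset.mem_filter.1 hu).2

/-- Functionals on the radical kill the tensor product on the coproduct of the radical. -/
theorem wordLift_split_mul_eq_zero {C : CartanDatum I}
    (hC : ∀ i j, C.pairing i j = C.pairing j i) {c : List I →₀ GroundField}
    (hc : InSerreRadical C c) (φ ψ : List I → GroundField)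
    (hφ : ∀ d, InSerreRadical C d → wordLift φ d = 0) (hψ : ∀ d, InSerreRadical C d → wordLift ψ d = 0) :
    wordLift (fun w => split C w fun u v => φ u * ψ v) c = 0 := by
  -- First `ψ` is replaced by the form against a fixed word `y`. Contracting the second tensor
  -- factor of the coproduct of `c` with `y` leaves an element of the radical, since its pairing
  -- with `x` is that of `c` with `x ++ y`.
  have step1 : ∀ y, wordLift (fun w => split C w fun u v => φ u * wordForm C y v) c = 0 := by
    intro y
    have hrad : InSerreRadical C
        (wordLift (fun w => split C w fun u v => wordForm C y v • Finsupp.single u 1) c) := by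
      rw [inSerreRadical_iff]
      intro x
      rw [wordLift_wordLift]
      have := hc (x ++ y)
      change wordLift (wordForm C (x ++ y)) c = 0 at this
      simpa only [funext (wordForm_append hC x y), map_split, map_smul, wordLift,
        Finsupp.linearCombination_single, one_smul, smul_eq_mul, mul_comm, mul_one, one_mul] using this
    have := hφ _ hrad
    rw [wordLift_wordLift] at this
    simpa only [map_split, map_smul, wordLift,
        Finsupp.linearCombination_single, one_smul, smul_eq_mul, mul_comm, mul_one, one_mul] using this
  -- Now the first factor is contracted with `φ`. By `step1` what is left is orthogonal to every
  -- `y`, so `ψ` kills it.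
  have hrad : InSerreRadical C
      (wordLift (fun w => split C w fun u v => φ u • Finsupp.single v 1) c) := by
    rw [inSerreRadical_iff]
    intro y
    rw [wordLift_wordLift]
    simpa only [map_split, map_smul, wordLift,
        Finsupp.linearCombination_single, one_smul, smul_eq_mul, mul_comm, mul_one, one_mul] using step1 y
  have := hψ _ hrad
  rw [wordLift_wordLift] at this
  simpa only [map_split, map_smul, wordLift,
        Finsupp.linearCombination_single, one_smul, smul_eq_mul, mul_comm, mul_one, one_mul] using this

/-! ### Commutators of words with the negative generators -/

/-- The sign of moving a letter through a word. -/
def wordSign (C : CartanDatum I) (i : I) (w : List I) : GroundField :=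
  (w.map fun j => (paritySign (C.parity i * C.parity j) : GroundField)).prod

/-- The `q`-power of moving a letter through a word. -/
def wordPow (C : CartanDatum I) (i : I) (w : List I) : GroundField :=
  (w.map fun j => qElt ^ C.pairing i j).prod

theorem paritySign_mul_self (p : ZMod 2) :
    (paritySign p : GroundField) * (paritySign p : GroundField) = 1 := by
  unfold paritySign; split_ifs <;> simp

theorem wordBraid_eq (C : CartanDatum I) (i : I) (w : List I) :
    wordBraid C i w = wordSign C i w * wordPow C i w := by
  simp only [wordBraid, wordSign, wordPow, ← List.prod_map_mul]
  rfl

/-- Collects coefficients in the induction for `word_commutator` when the new letter is `j`. Here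
`p` is a sign and `P`, `Q` are the powers of `q` met on moving the toral elements through words. -/
theorem commutator_aux₁ {F V : Type*} [Field F] [AddCommGroup V] [Module F V] {p : F}
    (hp : p = 1 ∨ p = -1) (κ s P Q : F) (X Y Z U W : V) :
    κ • X - (κ * (p * (s * Q))) • Y +
        ((s * p) • Z + ((s * (κ * P)) • U - (s * κ) • W)) - (p * s) • Z =
      κ • X + (κ * (s * P)) • U -
        ((κ * (p * (p * s))) • W + (κ * (p * (p * (s * (p * Q))))) • Y) := by
  rcases hp with rfl | rfl <;> module

theorem commutator_aux₂ {F V : Type*} [Field F] [AddCommGroup V] [Module F V] {p : F}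
    (hp : p = 1 ∨ p = -1) (κ t s Q : F) (X Y Z : V) :
    κ • X - (κ * (t * (s * Q))) • Y + (s * p) • Z - (p * s) • Z =
      κ • X - (κ * (t * (p * (s * (p * Q))))) • Y := by
  rcases hp with rfl | rfl <;> module

/-- The commutator of a word in the `e_i` with `f_j`, in terms of skew derivations. -/
theorem word_commutator {A : Type} [Ring A] [Algebra GroundField A] (C : CartanDatum I)
    (e : I → A) (fj T T' : A) (κ : GroundField) (j : I)
    (hT : ∀ i, T * e i = qElt ^ C.pairing j i • (e i * T))
    (hT' : ∀ i, e i * T' = qElt ^ C.pairing j i • (T' * e i))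
    (hef : ∀ i, e i * fj - (paritySign (C.parity j * C.parity i) : GroundField) • (fj * e i) =
      if j = i then κ • (T - T') else 0) (w : List I) :
    (w.map e).prod * fj - wordSign C j w • (fj * (w.map e).prod) =
      κ • (wordLift (fun w => (w.map e).prod) (rightDeriv C j w) * T -
        ((paritySign (C.parity j * C.parity j) : GroundField) * wordSign C j w) •
          (T' * wordLift (fun w => (w.map e).prod) (skewDeriv C j w))) := by
  have hTw : ∀ w : List I, T * (w.map e).prod = wordPow C j w • ((w.map e).prod * T) := by
    intro w
    induction w with
    | nil => simp [wordPow]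
    | cons i w ih =>
      simp only [List.map_cons, List.prod_cons, wordPow] at ih ⊢
      rw [← mul_assoc, hT, smul_mul_assoc, mul_assoc, ih, mul_smul_comm, smul_smul, mul_assoc]
  have hcomp : ∀ (a : I) (d : List I →₀ GroundField),
      wordLift (fun x => ((a :: x).map e).prod) d = e a * wordLift (fun w => (w.map e).prod) d := by
    intro a d
    have := map_wordLift (LinearMap.mulLeft GroundField (e a)) (fun w : List I => (w.map e).prod) d
    simpa using this.symm
  induction w with
  | nil => simp [rightDeriv, skewDeriv, wordSign]
  | cons a w ih =>
    rw [wordLift_rightDeriv_cons, wordLift_skewDeriv_cons, hcomp, hcomp]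
    have hs : wordSign C j (a :: w) =
        (paritySign (C.parity j * C.parity a) : GroundField) * wordSign C j w := by
      simp [wordSign]
    rw [hs, List.map_cons, List.prod_cons]
    set p : GroundField := (paritySign (C.parity j * C.parity a) : GroundField) with hp
    have hp1 : p = 1 ∨ p = -1 := by
      rw [hp, paritySign]; split_ifs <;> simp
    set M := (w.map e).prod
    set s := wordSign C j w
    set R := wordLift (fun w : List I => (w.map e).prod) (rightDeriv C j w)
    set L := wordLift (fun w : List I => (w.map e).prod) (skewDeriv C j w)
    -- `f_j` is moved through the tail first, which is the induction hypothesis, and then through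
    -- the head letter.
    have e1 : e a * M * fj = e a * (M * fj - s • (fj * M)) + s • ((e a * fj) * M) := by
      rw [mul_sub, mul_smul_comm, mul_assoc, mul_assoc]; abel
    have e2 : e a * fj = p • (fj * e a) + if j = a then κ • (T - T') else 0 := by
      rw [← hef a]; abel
    rw [e1, ih, e2]
    -- Only a head letter equal to `j` creates new toral terms. They match the terms that the
    -- recursions of the two derivations add at this letter.
    by_cases h : j = a
    · subst h
      simp only [if_true, wordBraid_eq, letterBraid]
      rw [← hp]
      have e3 := hTw w
      change T * M = _ • (M * T) at e3
      have e4 := hT' j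
      simp only [add_mul, sub_mul, mul_sub, mul_add, smul_mul_assoc, mul_smul_comm, smul_add,
        smul_sub, smul_smul, e3, mul_assoc]
      rw [← mul_assoc (e j) T' L, e4]
      simp only [smul_mul_assoc, smul_smul, mul_assoc]
      rw [show wordSign C j w = s from rfl]
      exact commutator_aux₁ hp1 κ s _ _ _ _ _ _ _
    · simp only [h, if_false, zero_add, add_zero, letterBraid]
      rw [← hp]
      have e4 := hT' a
      simp only [mul_sub, smul_mul_assoc, mul_smul_comm, smul_sub, smul_smul, mul_assoc]
      rw [← mul_assoc (e a) T' L, e4]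
      simp only [smul_mul_assoc, smul_smul, mul_assoc]
      exact commutator_aux₂ hp1 κ _ s _ _ _ _
end Words
end

noncomputable section
set_option linter.unusedSectionVars false
open Finsupp

/-! ### Weight representations of the radical -/

/-- Families of matrices `e i`, `f i` that are homogeneous for weights `wt` and parities `par` of
the basis vectors and satisfy the Chevalley commutation relations. -/
structure WeightRep {I : Type} [DecidableEq I] (C : CartanDatum I) (ι : Type) [Fintype ι]
    [DecidableEq ι] (W : Type) [AddCommGroup W] where
  e : I → Matrix ι ι GroundField
  f : I → Matrix ι ι GroundField
  wt : ι → W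
  root : I → W
  form : W →+ W →+ ℤ
  parW : W →+ ZMod 2
  par : ι → ZMod 2
  pairing_eq : ∀ i j, C.pairing i j = form (root i) (root j)
  pairing_comm : ∀ i j, C.pairing i j = C.pairing j i
  parity_eq : ∀ i, C.parity i = parW (root i)
  e_wt : ∀ i a b, e i a b ≠ 0 → wt a - wt b = root i
  f_wt : ∀ i a b, f i a b ≠ 0 → wt a - wt b = -root i
  e_par : ∀ i a b, e i a b ≠ 0 → par a + par b = C.parity i
  e_f : ∀ i j, e i * f j - (paritySign (C.parity i * C.parity j) : GroundField) • (f j * e i) =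
    if i = j then (qElt - qElt⁻¹)⁻¹ •
      (Matrix.diagonal (fun a => qElt ^ form (root i) (wt a)) -
        Matrix.diagonal (fun a => qElt ^ (-form (root i) (wt a)))) else 0

theorem paritySign_add (p r : ZMod 2) :
    (paritySign (p + r) : GroundField) = paritySign p * paritySign r := by
  have : ∀ p r : ZMod 2, paritySign (p + r) = paritySign p * paritySign r := by decide
  exact_mod_cast this p r

theorem paritySign_ne_zero (p : ZMod 2) : (paritySign p : GroundField) ≠ 0 := by
  unfold paritySign; split_ifs <;> simp

theorem zpow_list_sum {I : Type} (x : GroundField) (hx : x ≠ 0) (g : I → ℤ) (w : List I) :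
    (w.map fun i => x ^ g i).prod = x ^ (w.map g).sum := by
  induction w with
  | nil => simp
  | cons i w ih => simp [ih, zpow_add₀ hx]

theorem paritySign_list_sum {I : Type} (g : I → ZMod 2) (w : List I) :
    (w.map fun i => (paritySign (g i) : GroundField)).prod = paritySign (w.map g).sum := by
  induction w with
  | nil => simp [paritySign]
  | cons i w ih => simp [ih, paritySign_add]

namespace WeightRep

variable {I : Type} [DecidableEq I] {C : CartanDatum I} {ι : Type} [Fintype ι]
    [DecidableEq ι] {W : Type} [AddCommGroup W] (D : WeightRep C ι W)

/-- The operator of a word in the `e i`. -/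
def word (w : List I) : Matrix ι ι GroundField := (w.map D.e).prod

/-- The weight of a word. -/
def rootSum (w : List I) : W := (w.map D.root).sum

theorem word_wt (w : List I) (a b : ι) (h : D.word w a b ≠ 0) :
    D.wt a - D.wt b = D.rootSum w := by
  induction w generalizing a with
  | nil =>
    have : a = b := by
      by_contra hab
      exact h (by simp [word, hab])
    simp [this, rootSum]
  | cons i w ih =>
    simp only [word, List.map_cons, List.prod_cons, Matrix.mul_apply] at h
    obtain ⟨k, -, hk⟩ := Finset.exists_ne_zero_of_sum_ne_zero h
    have h1 := D.e_wt i a k (left_ne_zero_of_mul hk)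
    have h2 := ih k (right_ne_zero_of_mul hk)
    simp only [rootSum, List.map_cons, List.sum_cons] at h2 ⊢
    rw [← h1, ← h2]
    abel

theorem sum_form (w : List I) (x : W) :
    (w.map fun j => D.form (D.root j) x).sum = D.form (D.rootSum w) x := by
  induction w with
  | nil => simp [rootSum]
  | cons i w ih => simp_all [rootSum]

theorem sum_parity (w : List I) (p : ZMod 2) :
    (w.map fun j => C.parity j * p).sum = D.parW (D.rootSum w) * p := by
  induction w with
  | nil => simp [rootSum]
  | cons i w ih => simp_all [rootSum, D.parity_eq, add_mul]

theorem rootSum_eq_of_perm {u w : List I} (h : (u : Multiset I) = w) :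
    D.rootSum u = D.rootSum w := by
  unfold rootSum
  exact ((Multiset.coe_eq_coe.1 h).map _).sum_eq

theorem entry_wordLift (g : List I → Matrix ι ι GroundField) (c : List I →₀ GroundField)
    (a b : ι) : wordLift g c a b = wordLift (fun w => g w a b) c :=
  map_wordLift (Matrix.entryLinearMap GroundField GroundField a b) g c

theorem wordLift_eq_zero {V : Type*} [AddCommGroup V] [Module GroundField V] {g : List I → V}
    {c : List I →₀ GroundField} (h : ∀ w ∈ c.support, g w = 0) : wordLift g c = 0 := by
  rw [wordLift_congr h]
  simp [wordLift, Finsupp.linearCombination_apply, Finsupp.sum]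

theorem wordLift_wt {c : List I →₀ GroundField} {w₀ : List I}
    (hc : ∀ u ∈ c.support, (u : Multiset I) = w₀) (a b : ι) (h : wordLift D.word c a b ≠ 0) :
    D.wt a - D.wt b = D.rootSum w₀ := by
  by_contra hne
  apply h
  rw [entry_wordLift]
  refine wordLift_eq_zero fun u hu => ?_
  by_contra h0
  exact hne ((D.word_wt u a b h0).trans (D.rootSum_eq_of_perm (hc u hu)))

/-- Linearity of a twisted commutator. It applies to homogeneous elements, on whose words the sign
`s` is constant. -/
theorem wordLift_mul_sub (g₁ g₂ : List I → Matrix ι ι GroundField)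
    (A B : Matrix ι ι GroundField) (s : GroundField) (c : List I →₀ GroundField) :
    wordLift (fun w => g₁ w * A - s • (B * g₂ w)) c =
      wordLift g₁ c * A - s • (B * wordLift g₂ c) := by
  simp only [wordLift, Finsupp.linearCombination_apply, Finsupp.sum, Finset.sum_mul,
    Finset.mul_sum, Finset.smul_sum, smul_sub, Finset.sum_sub_distrib]
  congr 1
  · exact Finset.sum_congr rfl fun w _ => (smul_mul_assoc _ _ _).symm
  · exact Finset.sum_congr rfl fun w _ => by rw [mul_smul_comm, smul_comm]

/-- The diagonal entries of `q^{h_j}`. -/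
def toral (j : I) (a : ι) : GroundField := qElt ^ D.form (D.root j) (D.wt a)

theorem toral_mul_e (j i : I) :
    Matrix.diagonal (D.toral j) * D.e i =
      qElt ^ C.pairing j i • (D.e i * Matrix.diagonal (D.toral j)) := by
  ext a b
  rw [Matrix.diagonal_mul, Matrix.smul_apply, Matrix.mul_diagonal, smul_eq_mul]
  by_cases h : D.e i a b = 0
  · simp [h]
  · have := D.e_wt i a b h
    rw [toral, toral, D.pairing_eq, ← this, map_sub, zpow_sub₀ qElt_ne_zero]
    have := zpow_ne_zero (D.form (D.root j) (D.wt b)) qElt_ne_zero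
    field_simp

theorem e_mul_toral_inv (j i : I) :
    D.e i * Matrix.diagonal (fun a => (D.toral j a)⁻¹) =
      qElt ^ C.pairing j i • (Matrix.diagonal (fun a => (D.toral j a)⁻¹) * D.e i) := by
  ext a b
  rw [Matrix.mul_diagonal, Matrix.smul_apply, Matrix.diagonal_mul, smul_eq_mul]
  by_cases h : D.e i a b = 0
  · simp [h]
  · have := D.e_wt i a b h
    rw [toral, toral, D.pairing_eq, ← this, map_sub, zpow_sub₀ qElt_ne_zero]
    have h1 := zpow_ne_zero (D.form (D.root j) (D.wt b)) qElt_ne_zero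
    have h2 := zpow_ne_zero (D.form (D.root j) (D.wt a)) qElt_ne_zero
    field_simp

theorem wordSign_eq_of_perm {u w : List I} (h : (u : Multiset I) = w) (j : I) :
    wordSign C j u = wordSign C j w := by
  unfold wordSign
  exact ((Multiset.coe_eq_coe.1 h).map _).prod_eq

/-- If the radical vanishes in smaller degrees, then its homogeneous elements supercommute
with the `f j`. -/
theorem commute_f {w₀ : List I}
    (hlow : ∀ d, InSerreRadical C d → (∀ u ∈ d.support, u.length < w₀.length) →
      wordLift D.word d = 0)
    {c : List I →₀ GroundField} (hrad : InSerreRadical C c)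
    (hc : ∀ u ∈ c.support, (u : Multiset I) = w₀) (j : I) :
    wordLift D.word c * D.f j = wordSign C j w₀ • (D.f j * wordLift D.word c) := by
  have hlen : ∀ u ∈ c.support, u.length = w₀.length := fun u hu => by
    simpa using congrArg Multiset.card (hc u hu)
  -- Both derivatives of `c` stay in the radical and are one letter shorter, so `hlow` applies and
  -- the right side of the commutator formula vanishes.
  have hR : wordLift D.word (wordLift (rightDeriv C j) c) = 0 := by
    refine hlow _ (hrad.rightDeriv D.pairing_comm j) fun u hu => ?_
    obtain ⟨w, hw, huw⟩ := mem_support_wordLift hu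
    have := (perm_of_mem_support_rightDeriv huw).length_eq
    rw [hlen w hw, List.length_cons] at this
    lia
  have hL : wordLift D.word (wordLift (skewDeriv C j) c) = 0 := by
    refine hlow _ (hrad.skewDeriv j) fun u hu => ?_
    obtain ⟨w, hw, huw⟩ := mem_support_wordLift hu
    have := (perm_of_mem_support_skewDeriv huw).length_eq
    rw [hlen w hw, List.length_cons] at this
    lia
  rw [wordLift_wordLift] at hR hL
  have key : ∀ w : List I, D.word w * D.f j - wordSign C j w • (D.f j * D.word w) =
      (qElt - qElt⁻¹)⁻¹ • (wordLift D.word (rightDeriv C j w) * Matrix.diagonal (D.toral j) -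
        ((paritySign (C.parity j * C.parity j) : GroundField) * wordSign C j w) •
          (Matrix.diagonal (fun a => (D.toral j a)⁻¹) * wordLift D.word (skewDeriv C j w))) := by
    intro w
    refine word_commutator C D.e (D.f j) _ _ _ j (D.toral_mul_e j) (D.e_mul_toral_inv j) ?_ w
    intro i
    rw [mul_comm (C.parity j), D.e_f]
    by_cases h : i = j
    · subst h
      simp only [if_true, zpow_neg]
      rfl
    · rw [if_neg h, if_neg (Ne.symm h)]
  have h1 := wordLift_mul_sub D.word D.word (D.f j) (D.f j) (wordSign C j w₀) c
  have h2 : wordLift (fun w => D.word w * D.f j - wordSign C j w₀ • (D.f j * D.word w)) c =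
      (qElt - qElt⁻¹)⁻¹ • (wordLift (fun w => wordLift D.word (rightDeriv C j w)) c *
          Matrix.diagonal (D.toral j) -
        ((paritySign (C.parity j * C.parity j) : GroundField) * wordSign C j w₀) •
          (Matrix.diagonal (fun a => (D.toral j a)⁻¹) *
            wordLift (fun w => wordLift D.word (skewDeriv C j w)) c)) := by
    rw [wordLift_congr (g := fun w => (qElt - qElt⁻¹)⁻¹ •
      (wordLift D.word (rightDeriv C j w) * Matrix.diagonal (D.toral j) -
        ((paritySign (C.parity j * C.parity j) : GroundField) * wordSign C j w₀) •
          (Matrix.diagonal (fun a => (D.toral j a)⁻¹) * wordLift D.word (skewDeriv C j w))))]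
    · rw [wordLift_smul, wordLift_mul_sub]
    · intro w hw
      rw [← wordSign_eq_of_perm (hc w hw)]
      exact key w
  rw [hR, hL, zero_mul, mul_zero, smul_zero, sub_zero, smul_zero] at h2
  rw [← sub_eq_zero, ← h1, h2]

/-! #### The adjoint action and the antipode -/

/-- The diagonal entries of `q^{h_j}` times the parity operator. -/
def braidDiag (j : I) (a : ι) : GroundField :=
  D.toral j a * paritySign (C.parity j * D.par a)

theorem braidDiag_ne_zero (j : I) (a : ι) : D.braidDiag j a ≠ 0 :=
  mul_ne_zero (zpow_ne_zero _ qElt_ne_zero) (paritySign_ne_zero _)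

theorem braidDiag_mul_e (j i : I) :
    Matrix.diagonal (D.braidDiag j) * D.e i =
      letterBraid C j i • (D.e i * Matrix.diagonal (D.braidDiag j)) := by
  ext a b
  have h := congrFun (congrFun (D.toral_mul_e j i) a) b
  rw [Matrix.diagonal_mul, Matrix.smul_apply, Matrix.mul_diagonal, smul_eq_mul] at h ⊢
  by_cases h0 : D.e i a b = 0
  · simp [h0]
  · have hp := D.e_par i a b h0
    have hp2 : D.par a = C.parity i + D.par b := by
      rw [← hp, add_assoc, CharTwo.add_self_eq_zero, add_zero]
    rw [braidDiag, braidDiag, letterBraid, hp2, mul_add, paritySign_add]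
    linear_combination (paritySign (C.parity j * C.parity i) : GroundField) *
      (paritySign (C.parity j * D.par b) : GroundField) * h

theorem braidDiag_mul_word (j : I) (w : List I) :
    Matrix.diagonal (D.braidDiag j) * D.word w =
      wordBraid C j w • (D.word w * Matrix.diagonal (D.braidDiag j)) := by
  induction w with
  | nil => simp [word, wordBraid]
  | cons i w ih =>
    simp only [word, List.map_cons, List.prod_cons, wordBraid] at ih ⊢
    rw [← mul_assoc, braidDiag_mul_e, smul_mul_assoc, mul_assoc, ih, mul_smul_comm, smul_smul,
      mul_assoc]

/-- The inverse of the matrix with diagonal `braidDiag j`. -/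
def braidInv (j : I) : Matrix ι ι GroundField := Matrix.diagonal fun a => (D.braidDiag j a)⁻¹

theorem braidDiag_mul_inv (j : I) : Matrix.diagonal (D.braidDiag j) * D.braidInv j = 1 := by
  rw [braidInv, Matrix.diagonal_mul_diagonal, ← Matrix.diagonal_one]
  congr 1
  funext a
  exact mul_inv_cancel₀ (D.braidDiag_ne_zero j a)

/-- The value of the braided antipode on a word. -/
def braidAntipode : List I → Matrix ι ι GroundField
  | [] => 1
  | j :: w => -(Matrix.diagonal (D.braidDiag j) * braidAntipode w * D.braidInv j * D.e j)

/-- The value of the antipode on a word. -/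
def antipode : List I → Matrix ι ι GroundField
  | [] => 1
  | j :: w => antipode w * -(D.braidInv j * D.e j)

/-- The defining identity of an antipode. Let $T$ be the sum for the tail. A head letter going left
contributes $e_jT$, and one going right contributes $-KTK^{-1}e_j$, where conjugation by $K$ absorbs
the braiding factor. If the tail is nonempty then $T=0$ by induction; otherwise $T=1$ and the two
terms cancel. -/
theorem split_word_braidAntipode {w : List I} (hw : w ≠ []) :
    split C w (fun u v => D.word u * D.braidAntipode v) = 0 := by
  induction w with
  | nil => exact absurd rfl hw
  | cons j w ih =>
    have h1 : split C w (fun u v => D.word (j :: u) * D.braidAntipode v) =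
        D.e j * split C w (fun u v => D.word u * D.braidAntipode v) := by
      have := map_split C (LinearMap.mulLeft GroundField (D.e j)) w
        (fun u v => D.word u * D.braidAntipode v)
      rw [LinearMap.mulLeft_apply] at this
      rw [this]
      refine split_congr C fun u v _ => ?_
      simp [word, mul_assoc]
    have h2 : split C w (fun u v => wordBraid C j u • (D.word u * D.braidAntipode (j :: v))) =
        -(Matrix.diagonal (D.braidDiag j) *
          split C w (fun u v => D.word u * D.braidAntipode v) * D.braidInv j * D.e j) := by
      have := map_split C (LinearMap.mulLeft GroundField (-Matrix.diagonal (D.braidDiag j)) ∘ₗ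
        LinearMap.mulRight GroundField (D.braidInv j * D.e j)) w
        (fun u v => D.word u * D.braidAntipode v)
      simp only [LinearMap.comp_apply, LinearMap.mulLeft_apply, LinearMap.mulRight_apply] at this
      rw [mul_assoc, mul_assoc, ← neg_mul, this]
      refine split_congr C fun u v _ => ?_
      rw [braidAntipode, mul_neg, smul_neg, neg_mul, mul_assoc (D.word u), 
        ← mul_assoc _ (D.word u), D.braidDiag_mul_word]
      simp only [smul_mul_assoc, mul_assoc]
    change split C w (fun u v => D.word (j :: u) * D.braidAntipode v) +
      split C w (fun u v => wordBraid C j u • (D.word u * D.braidAntipode (j :: v))) = 0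
    rw [h1, h2]
    by_cases hw' : w = []
    · subst hw'
      simp [split, word, braidAntipode, D.braidDiag_mul_inv]
    · rw [ih hw']
      simp

/-- The braided antipode satisfies the identity on the coproduct, while the unbraided one reverses
products and so can be compared with transposes. They differ by a toral factor depending on the
content of the word only. -/
theorem braidAntipode_eq (w : List I) : D.braidAntipode w =
    Matrix.diagonal (fun a => (w.map fun j => D.braidDiag j a).prod) * D.antipode w := by
  induction w with
  | nil => simp [braidAntipode, antipode]
  | cons j w ih =>
    rw [braidAntipode, ih, antipode]
    simp only [List.map_cons, List.prod_cons]
    rw [← Matrix.diagonal_mul_diagonal]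
    simp only [mul_neg, mul_assoc]

/-! ### Crossing symmetry and vanishing of the radical -/

/-- A crossing symmetry: an isomorphism of the dual representation with a rescaled one. -/
structure Crossing where
  G : Matrix ι ι GroundField
  Ginv : Matrix ι ι GroundField
  mul_inv : G * Ginv = 1
  scale : I → GroundField
  transpose_mul : ∀ j, (-(D.braidInv j * D.e j)).transpose * G = scale j • (G * D.e j)
  one_add_ne_zero : ∀ w : List I, 1 + (w.map scale).prod ≠ 0

variable {D}

/-- Antipode and transpose both reverse products, so the relation on letters propagates to words. -/
theorem Crossing.antipode_transpose (X : D.Crossing) (w : List I) :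
    (D.antipode w).transpose * X.G = (w.map X.scale).prod • (X.G * D.word w) := by
  induction w with
  | nil => simp [antipode, word]
  | cons j w ih =>
    rw [antipode, Matrix.transpose_mul, mul_assoc, ih, mul_smul_comm, ← mul_assoc,
      X.transpose_mul, smul_mul_assoc, smul_smul, mul_assoc]
    simp [word, mul_comm]

theorem Crossing.antipode_homogeneous (X : D.Crossing) {c : List I →₀ GroundField}
    {w₀ : List I} (hc : ∀ u ∈ c.support, (u : Multiset I) = w₀) :
    (wordLift D.antipode c).transpose * X.G =
      (w₀.map X.scale).prod • (X.G * wordLift D.word c) := by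
  have h1 : (wordLift D.antipode c).transpose * X.G =
      wordLift (fun w => (D.antipode w).transpose * X.G) c :=
    map_wordLift (LinearMap.mulRight GroundField X.G ∘ₗ
      (Matrix.transposeLinearEquiv ι ι GroundField GroundField).toLinearMap) D.antipode c
  have h2 := map_wordLift ((w₀.map X.scale).prod • LinearMap.mulLeft GroundField X.G) D.word c
  simp only [LinearMap.smul_apply, LinearMap.mulLeft_apply] at h2
  rw [h1, h2]
  refine wordLift_congr fun u hu => ?_
  rw [X.antipode_transpose, ((Multiset.coe_eq_coe.1 (hc u hu)).map X.scale).prod_eq]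

theorem braidAntipode_homogeneous {c : List I →₀ GroundField}
    {w₀ : List I} (hc : ∀ u ∈ c.support, (u : Multiset I) = w₀) :
    wordLift D.braidAntipode c =
      Matrix.diagonal (fun a => (w₀.map fun j => D.braidDiag j a).prod) *
        wordLift D.antipode c := by
  have h1 := map_wordLift (LinearMap.mulLeft GroundField
    (Matrix.diagonal (fun a => (w₀.map fun j => D.braidDiag j a).prod))) D.antipode c
  simp only [LinearMap.mulLeft_apply] at h1
  rw [h1]
  refine wordLift_congr fun u hu => ?_
  rw [braidAntipode_eq]
  congr 2
  funext a
  exact ((Multiset.coe_eq_coe.1 (hc u hu)).map _).prod_eq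

/-- On homogeneous elements the crossing symmetry with its invertible `G` makes the antipode vanish
where the representation does. The inductive hypothesis thus holds for both tensor factors in the
antipode identity. -/
theorem Crossing.braidAntipode_eq_zero (X : D.Crossing) {c : List I →₀ GroundField} {h : ℕ}
    (hlow : ∀ d, InSerreRadical C d → (∀ u ∈ d.support, u.length < h) →
      wordLift D.word d = 0) (hrad : InSerreRadical C c)
    (hc : ∀ u ∈ c.support, u.length < h) : wordLift D.braidAntipode c = 0 := by
  refine wordLift_eq_zero_of_homogeneous _ hrad fun w hw d hd hdw => ?_
  have h0 : wordLift D.word d = 0 := hlow d hd fun u hu => by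
    have : u.length = w.length := by simpa using congrArg Multiset.card (hdw u hu)
    rw [this]
    exact hc w hw
  have h1 := X.antipode_homogeneous hdw
  rw [h0, mul_zero, smul_zero] at h1
  have h2 : (wordLift D.antipode d).transpose = 0 := by
    rw [← mul_one (wordLift D.antipode d).transpose, ← X.mul_inv, ← mul_assoc, h1, zero_mul]
  rw [braidAntipode_homogeneous hdw, Matrix.transpose_eq_zero.1 h2, mul_zero]

/-- On the radical in the lowest degree where it acts nontrivially the antipode is `-1`. -/
theorem Crossing.word_add_braidAntipode (X : D.Crossing) {c : List I →₀ GroundField} {h : ℕ}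
    (hh : 0 < h) (hlow : ∀ d, InSerreRadical C d → (∀ u ∈ d.support, u.length < h) →
      wordLift D.word d = 0) (hrad : InSerreRadical C c)
    (hc : ∀ u ∈ c.support, u.length = h) :
    wordLift D.word c + wordLift D.braidAntipode c = 0 := by
  -- Truncation to lengths strictly between `0` and `h`. The radical is graded, so a functional
  -- vanishing on its short elements becomes, after truncation, one vanishing on all of it, as the
  -- coideal property requires.
  have hkill : ∀ g : List I → Matrix ι ι GroundField,
      (∀ d, InSerreRadical C d → (∀ u ∈ d.support, u.length < h) → wordLift g d = 0) →
      ∀ a b d, InSerreRadical C d →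
        wordLift (fun u => if 0 < u.length ∧ u.length < h then g u a b else 0) d = 0 := by
    intro g hg a b d hd
    have := hg (d.filter fun u => 0 < u.length ∧ u.length < h)
      (hd.filter _ fun x w hxw => by rw [hxw.length_eq]) fun u hu => by
        rw [Finsupp.support_filter] at hu
        exact (Finset.mem_filter.1 hu).2.2
    rw [← wordLift_filter, ← entry_wordLift, this]
    rfl
  -- Terms of the coproduct with both factors nonempty have both lengths below `h`. They vanish by
  -- the coideal property, applied to each summand of each matrix entry.
  have hmid : wordLift (fun w => split C w fun u v =>
      if 0 < u.length ∧ 0 < v.length then D.word u * D.braidAntipode v else 0) c = 0 := by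
    ext a b
    rw [entry_wordLift]
    have h1 : ∀ w ∈ c.support, (split C w fun u v =>
        if 0 < u.length ∧ 0 < v.length then D.word u * D.braidAntipode v else 0) a b =
        ∑ k, split C w fun u v =>
          (if 0 < u.length ∧ u.length < h then D.word u a k else 0) *
          (if 0 < v.length ∧ v.length < h then D.braidAntipode v k b else 0) := by
      intro w hw
      rw [← split_sum]
      have := map_split C (Matrix.entryLinearMap GroundField GroundField a b) w (fun u v =>
        if 0 < u.length ∧ 0 < v.length then D.word u * D.braidAntipode v else 0)
      refine this.trans (split_congr C fun u v huv => ?_)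
      have hl := huv.length_eq
      rw [List.length_append, hc w hw] at hl
      by_cases h1 : 0 < u.length ∧ 0 < v.length
      · rw [if_pos h1]
        have h2 : 0 < u.length ∧ u.length < h := by lia
        have h3 : 0 < v.length ∧ v.length < h := by lia
        simp only [if_pos h2, if_pos h3]
        exact Matrix.mul_apply
      · rw [if_neg h1]
        refine (Finset.sum_eq_zero fun k _ => ?_).symm
        by_cases h2 : 0 < u.length
        · rw [if_neg (c := 0 < v.length ∧ v.length < h) fun h3 => h1 ⟨h2, h3.1⟩, mul_zero]
        · rw [if_neg (c := 0 < u.length ∧ u.length < h) fun h3 => h2 h3.1, zero_mul]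
    rw [wordLift_congr h1]
    have h2 : ∀ F : ι → List I → GroundField,
        wordLift (fun w => ∑ k, F k w) c = ∑ k, wordLift (F k) c := by
      intro F
      simp only [wordLift, Finsupp.linearCombination_apply, Finsupp.sum, Finset.smul_sum]
      exact Finset.sum_comm
    rw [h2]
    refine Finset.sum_eq_zero fun k _ => ?_
    exact wordLift_split_mul_eq_zero D.pairing_comm hrad _ _ (hkill D.word hlow a k)
      (hkill D.braidAntipode (fun d hd hd2 => X.braidAntipode_eq_zero hlow hd hd2) k b)
  -- The antipode identity, with the terms having an empty factor written separately. Positive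
  -- length of `w` excludes a term with both factors empty.
  have h0 : ∀ w ∈ c.support, D.word w + D.braidAntipode w + (split C w fun u v =>
      if 0 < u.length ∧ 0 < v.length then D.word u * D.braidAntipode v else 0) = 0 := by
    intro w hw
    have hw0 : w ≠ [] := by
      rintro rfl
      have := hc [] hw
      simp at this
      lia
    refine Eq.trans ?_ (D.split_word_braidAntipode hw0)
    rw [← split_right_nil C w D.word,
      ← split_left_nil C w D.braidAntipode, ← split_add, ← split_add]
    refine split_congr C fun u v huv => ?_
    have hl := huv.length_eq
    rw [List.length_append, hc w hw] at hl
    rcases u with _ | ⟨i, u⟩ <;> rcases v with _ | ⟨j, v⟩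
    · simp at hl; lia
    · simp [word]
    · simp [braidAntipode]
    · simp
  have h1 := wordLift_eq_zero h0
  have h2 : ∀ g₁ g₂ : List I → Matrix ι ι GroundField,
      wordLift (fun w => g₁ w + g₂ w) c = wordLift g₁ c + wordLift g₂ c := by
    intro g₁ g₂
    simp only [wordLift, Finsupp.linearCombination_apply, Finsupp.sum, smul_add,
      Finset.sum_add_distrib]
  rw [h2, h2, hmid, add_zero] at h1
  exact h1

/-- The radical acts by zero on a weight representation in which the only weight operators that
supercommute with all `f j` are the scalars, and that has a crossing symmetry. -/
theorem evalWords_eq_zero (X : D.Crossing)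
    (hscal : ∀ (w : List I) (M : Matrix ι ι GroundField),
      (∀ a b, M a b ≠ 0 → D.wt a - D.wt b = D.rootSum w) →
      (∀ j, M * D.f j = wordSign C j w • (D.f j * M)) →
      M = 0 ∨ D.rootSum w = 0 ∧ ∃ r : GroundField, M = r • 1)
    {c : List I →₀ GroundField} (hrad : InSerreRadical C c) : evalWords D.e c = 0 := by
  have main : ∀ (h : ℕ) (d : List I →₀ GroundField), InSerreRadical C d →
      (∀ u ∈ d.support, u.length < h) → wordLift D.word d = 0 := by
    intro h
    induction h with
    | zero =>
      intro d _ hd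
      exact wordLift_eq_zero fun u hu => absurd (hd u hu) (Nat.not_lt_zero _)
    | succ h ih =>
      intro c hc hlen
      refine wordLift_eq_zero_of_homogeneous _ hc fun w hw d hd hdw => ?_
      have hdl : ∀ u ∈ d.support, u.length = w.length := fun u hu => by
        simpa using congrArg Multiset.card (hdw u hu)
      rcases Nat.lt_succ_iff_lt_or_eq.1 (hlen w hw) with hlt | rfl
      · exact ih d hd fun u hu => (hdl u hu).trans_lt hlt
      · rcases eq_or_ne w [] with rfl | hw0
        · refine wordLift_eq_zero fun u hu => ?_
          exfalso
          have hu0 : ∀ v ∈ d.support, v = [] := fun v hv => List.length_eq_zero_iff.1 (hdl v hv)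
          -- Pairing with the empty word reads off the constant term, so the radical contains no
          -- nonzero constant.
          have h1 := hd []
          change wordLift (wordForm C []) d = 0 at h1
          have h2 : d = Finsupp.single [] (d []) := by
            ext v
            by_cases hv : v = []
            · simp [hv]
            · rw [Finsupp.single_eq_of_ne hv]
              by_contra h3
              exact hv (hu0 v (Finsupp.mem_support_iff.2 h3))
          rw [h2] at h1
          simp [wordForm] at h1
          rw [h2, h1] at hu
          simp at hu
        · rcases hscal w _ (D.wordLift_wt hdw) (D.commute_f ih hd hdw) with h0 | ⟨h0, r, hr⟩
          · exact h0
          · have hpos : 0 < w.length := List.length_pos_iff.2 hw0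
            have h1 := X.word_add_braidAntipode hpos ih hd hdl
            -- In weight zero the toral factor and its parity sign are trivial, so the braided and
            -- the unbraided antipode agree.
            have hdiag : (fun a => (w.map fun j => D.braidDiag j a).prod) = fun _ => 1 := by
              funext a
              simp only [braidDiag, toral, List.prod_map_mul]
              rw [zpow_list_sum _ qElt_ne_zero, paritySign_list_sum, D.sum_form, D.sum_parity, h0]
              simp [paritySign]
            rw [braidAntipode_homogeneous hdw, hdiag, Matrix.diagonal_one, one_mul] at h1
            have h2 := X.antipode_homogeneous hdw
            have h3 : wordLift D.antipode d = -(r • 1) := by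
              rw [← hr]
              exact (neg_eq_of_add_eq_zero_right h1).symm
            rw [h3, hr] at h2
            simp only [Matrix.transpose_neg, Matrix.transpose_smul, Matrix.transpose_one,
              neg_mul, smul_mul_assoc, one_mul, mul_smul_comm, mul_one] at h2
            -- The element acts by `r` and its antipode by `-r`, while crossing multiplies by the
            -- product of the scales. Hence `r` vanishes unless that product is `-1`.
            have h4 : ((1 + (w.map X.scale).prod) * r) • X.G = 0 := by
              rw [add_mul, add_smul, one_mul, mul_smul, ← h2]
              simp
            have h5 : ((1 + (w.map X.scale).prod) * r) • (1 : Matrix ι ι GroundField) = 0 := by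
              rw [← X.mul_inv, ← smul_mul_assoc, h4, zero_mul]
            rw [mul_smul] at h5
            rw [hr]
            exact (smul_eq_zero.1 h5).resolve_left (X.one_add_ne_zero w)
  exact main (c.support.sup List.length + 1) c hrad fun u hu =>
    Nat.lt_succ_of_le (Finset.le_sup (f := List.length) hu)

end WeightRep
end

noncomputable section
set_option linter.unusedSectionVars false
open Finsupp

/-! ### Explicit elements of the radical -/

section SerreElements

variable {I : Type} [DecidableEq I]

/-- The form against a nonempty word factors through the skew derivation of its first letter;
against the empty word it is the constant term. Membership in the radical thus becomes a finite
computation. -/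
theorem inSerreRadical_of_skewDeriv {C : CartanDatum I} {c : List I →₀ GroundField}
    (h0 : c [] = 0) (h : ∀ l, wordLift (skewDeriv C l) c = 0) : InSerreRadical C c := by
  rw [inSerreRadical_iff]
  rintro (_ | ⟨l, x⟩)
  · refine WeightRep.wordLift_eq_zero fun w hw => ?_
    have : w ≠ [] := by
      rintro rfl
      exact Finsupp.mem_support_iff.1 hw h0
    simp [wordForm, this]
  · have := wordLift_wordLift (wordForm C x) (skewDeriv C l) c
    rw [h l, map_zero] at this
    exact this.symm

theorem skewDeriv_nil (C : CartanDatum I) (l : I) : skewDeriv C l [] = 0 := rfl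

/-- Left multiplication by a letter. -/
def consMap (i : I) : (List I →₀ GroundField) →ₗ[GroundField] (List I →₀ GroundField) :=
  Finsupp.lmapDomain GroundField GroundField (fun w => i :: w)

/-- Right multiplication by a letter. -/
def snocMap (i : I) : (List I →₀ GroundField) →ₗ[GroundField] (List I →₀ GroundField) :=
  Finsupp.lmapDomain GroundField GroundField (fun w => w ++ [i])

@[simp] theorem consMap_single (i : I) (w : List I) (a : GroundField) :
    consMap i (Finsupp.single w a) = Finsupp.single (i :: w) a := by
  simp [consMap]

@[simp] theorem snocMap_single (i : I) (w : List I) (a : GroundField) :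
    snocMap i (Finsupp.single w a) = Finsupp.single (w ++ [i]) a := by
  simp [snocMap]

theorem wordLift_consMap {V : Type*} [AddCommGroup V] [Module GroundField V] (f : List I → V)
    (i : I) (c : List I →₀ GroundField) :
    wordLift f (consMap i c) = wordLift (fun w => f (i :: w)) c := by
  simp only [consMap, Finsupp.lmapDomain_apply, wordLift, Finsupp.linearCombination_mapDomain]
  rfl

theorem wordLift_snocMap {V : Type*} [AddCommGroup V] [Module GroundField V] (f : List I → V)
    (i : I) (c : List I →₀ GroundField) :
    wordLift f (snocMap i c) = wordLift (fun w => f (w ++ [i])) c := by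
  simp only [snocMap, Finsupp.lmapDomain_apply, wordLift, Finsupp.linearCombination_mapDomain]
  rfl

theorem skewDeriv_cons' (C : CartanDatum I) (l i : I) (w : List I) :
    skewDeriv C l (i :: w) = (if l = i then Finsupp.single w 1 else 0) +
      letterBraid C l i • consMap i (skewDeriv C l w) := rfl

theorem skewDeriv_snoc (C : CartanDatum I) (l i : I) (w : List I) :
    skewDeriv C l (w ++ [i]) = snocMap i (skewDeriv C l w) +
      if l = i then Finsupp.single w (wordBraid C l w) else 0 := by
  induction w with
  | nil =>
    rw [List.nil_append, skewDeriv_cons']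
    simp [skewDeriv, wordBraid]
  | cons j w ih =>
    have hcomm : ∀ c, consMap j (snocMap i c) = snocMap i (consMap j c) := by
      intro c
      simp only [consMap, snocMap, Finsupp.lmapDomain_apply, ← Finsupp.mapDomain_comp]
      rfl
    rw [List.cons_append, skewDeriv_cons', skewDeriv_cons', ih, map_add, map_add, map_smul,
      smul_add, hcomm, add_assoc]
    have h1 : letterBraid C l j • consMap j (if l = i then Finsupp.single w (wordBraid C l w)
        else 0) = if l = i then Finsupp.single (j :: w) (wordBraid C l (j :: w)) else 0 := by
      split_ifs
      · rw [consMap_single, Finsupp.smul_single, smul_eq_mul]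
        rfl
      · rw [map_zero, smul_zero]
    rw [h1]
    split_ifs <;> simp

/-- The `q`-superbracket with a letter, for an element with braiding factor `t`. -/
def letterBracket (i : I) (t : GroundField) (c : List I →₀ GroundField) : List I →₀ GroundField :=
  consMap i c - t • snocMap i c

theorem wordLift_id (c : List I →₀ GroundField) :
    wordLift (fun w => Finsupp.single w (1 : GroundField)) c = c := by
  simp [wordLift, Finsupp.linearCombination_apply]

theorem wordLift_add_fun {V : Type*} [AddCommGroup V] [Module GroundField V] (f g : List I → V)
    (c : List I →₀ GroundField) :
    wordLift (fun w => f w + g w) c = wordLift f c + wordLift g c := by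
  simp only [wordLift, Finsupp.linearCombination_apply, Finsupp.sum, smul_add,
    Finset.sum_add_distrib]

/-- A twisted Leibniz rule. The hypothesis `hs` is homogeneity in the only form needed: all words of
`c` braid with `l` by the same factor. -/
theorem skewDeriv_letterBracket (C : CartanDatum I) (l i : I) (t s : GroundField)
    (c : List I →₀ GroundField) (hs : ∀ w ∈ c.support, wordBraid C l w = s) :
    wordLift (skewDeriv C l) (letterBracket i t c) =
      letterBraid C l i • consMap i (wordLift (skewDeriv C l) c) -
        t • snocMap i (wordLift (skewDeriv C l) c) +
        if l = i then (1 - t * s) • c else 0 := by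
  rw [letterBracket, map_sub, map_smul, wordLift_consMap, wordLift_snocMap]
  have e1 : wordLift (fun w => skewDeriv C l (i :: w)) c = (if l = i then c else 0) +
      letterBraid C l i • consMap i (wordLift (skewDeriv C l) c) := by
    simp only [skewDeriv_cons']
    rw [wordLift_add_fun, wordLift_smul, map_wordLift]
    congr 1
    split_ifs
    · exact wordLift_id c
    · exact WeightRep.wordLift_eq_zero fun _ _ => rfl
  have e2 : wordLift (fun w => skewDeriv C l (w ++ [i])) c =
      snocMap i (wordLift (skewDeriv C l) c) + if l = i then s • c else 0 := by
    simp only [skewDeriv_snoc]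
    rw [wordLift_add_fun, map_wordLift]
    congr 1
    split_ifs
    · rw [wordLift_congr (g := fun w => s • Finsupp.single w (1 : GroundField)), wordLift_smul,
        wordLift_id]
      intro w hw
      rw [hs w hw, Finsupp.smul_single, smul_eq_mul, mul_one]
    · exact WeightRep.wordLift_eq_zero fun _ _ => rfl
  rw [e1, e2]
  split_ifs
  · rw [smul_add, sub_smul, one_smul, mul_smul]
    abel
  · simp

/-- The iterated bracket `⟦x_i, ⟦x_i, …, x_j⟧⟧` with `k` letters `i`. -/
def serreElt (C : CartanDatum I) (i j : I) : ℕ → (List I →₀ GroundField)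
  | 0 => Finsupp.single [j] 1
  | k + 1 => letterBracket i (letterBraid C i i ^ k * letterBraid C i j) (serreElt C i j k)

theorem serreElt_succ (C : CartanDatum I) (i j : I) (k : ℕ) : serreElt C i j (k + 1) =
    letterBracket i (letterBraid C i i ^ k * letterBraid C i j) (serreElt C i j k) := rfl

theorem perm_of_mem_support_serreElt {C : CartanDatum I} {i j : I} {k : ℕ} {w : List I}
    (h : w ∈ (serreElt C i j k).support) : w.Perm (List.replicate k i ++ [j]) := by
  classical
  induction k generalizing w with
  | zero =>
    have := Finsupp.support_single_subset h
    rw [Finset.mem_singleton] at this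
    simp [this]
  | succ k ih =>
    have h1 := Finsupp.support_sub h
    rcases Finset.mem_union.1 h1 with h1 | h1
    · obtain ⟨v, hv, rfl⟩ := Finset.mem_image.1 (Finsupp.mapDomain_support h1)
      exact (ih hv).cons i
    · obtain ⟨v, hv, rfl⟩ := Finset.mem_image.1
        (Finsupp.mapDomain_support (Finsupp.support_smul h1))
      exact (List.perm_append_singleton i v).trans ((ih hv).cons i)

theorem wordBraid_of_mem_support_serreElt {C : CartanDatum I} {i j : I} {k : ℕ} {w : List I}
    (l : I) (h : w ∈ (serreElt C i j k).support) :
    wordBraid C l w = letterBraid C l i ^ k * letterBraid C l j := by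
  rw [wordBraid, ((perm_of_mem_support_serreElt h).map _).prod_eq]
  simp

/-- With $a$, $b$ the braiding factors of $(i,i)$ and $(i,j)$, each bracketing adds $1-a^{2k}b^2$ to
$a$ times the previous coefficient. The result is a quantum integer times $1-a^kb^2$, and the last
factor is the one that vanishes under the Serre condition. -/
theorem skewDeriv_serreElt_self {C : CartanDatum I} {i j : I} (hij : i ≠ j) (k : ℕ) :
    wordLift (skewDeriv C i) (serreElt C i j (k + 1)) =
      ((∑ l ∈ Finset.range (k + 1), letterBraid C i i ^ l) *
        (1 - letterBraid C i i ^ k * letterBraid C i j ^ 2)) • serreElt C i j k := by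
  induction k with
  | zero =>
    have h0 : wordLift (skewDeriv C i) (serreElt C i j 0) = 0 := by
      simp [serreElt, skewDeriv, hij]
    rw [serreElt_succ, skewDeriv_letterBracket C i i _ _ _
      fun w hw => wordBraid_of_mem_support_serreElt i hw, h0, map_zero, map_zero, smul_zero,
      smul_zero, if_pos rfl, sub_zero, zero_add]
    congr 1
    simp
    ring
  | succ k ih =>
    rw [serreElt_succ, skewDeriv_letterBracket C i i _ _ _
      fun w hw => wordBraid_of_mem_support_serreElt i hw, ih, if_pos rfl]
    set a := letterBraid C i i
    set b := letterBraid C i j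
    have h1 : a • consMap i (((∑ l ∈ Finset.range (k + 1), a ^ l) * (1 - a ^ k * b ^ 2)) •
        serreElt C i j k) - (a ^ (k + 1) * b) • snocMap i (((∑ l ∈ Finset.range (k + 1), a ^ l) *
          (1 - a ^ k * b ^ 2)) • serreElt C i j k) =
        (a * ((∑ l ∈ Finset.range (k + 1), a ^ l) * (1 - a ^ k * b ^ 2))) •
          serreElt C i j (k + 1) := by
      conv_rhs => rw [serreElt_succ, letterBracket]
      rw [map_smul, map_smul, smul_sub, smul_smul, smul_smul, smul_smul]
      congr 2
      ring
    rw [h1, ← add_smul]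
    congr 1
    rw [Finset.sum_range_succ' _ (k + 1)]
    have : ∑ l ∈ Finset.range (k + 1), a ^ (l + 1) = a * ∑ l ∈ Finset.range (k + 1), a ^ l := by
      rw [Finset.mul_sum]
      exact Finset.sum_congr rfl fun l _ => pow_succ' a l
    rw [this]
    -- The telescoping geometric sum is what restores the factored form of the coefficient.
    have h2 : a ^ (k + 1) - 1 = (a - 1) * ∑ l ∈ Finset.range (k + 1), a ^ l :=
      (mul_geom_sum a (k + 1)).symm
    linear_combination (- a ^ (k + 1) * b ^ 2) * h2

/-- Already the first bracket is killed, because removing `j` leaves the letter `i` with the factor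
of `(j, i)` minus that of `(i, j)`. Further brackets with `i` preserve this. -/
theorem skewDeriv_serreElt_right {C : CartanDatum I} {i j : I}
    (hC : ∀ i j, C.pairing i j = C.pairing j i) (hij : i ≠ j) (k : ℕ) :
    wordLift (skewDeriv C j) (serreElt C i j (k + 1)) = 0 := by
  induction k with
  | zero =>
    have h0 : wordLift (skewDeriv C j) (serreElt C i j 0) = Finsupp.single [] 1 := by
      simp [serreElt, skewDeriv]
    rw [serreElt_succ, skewDeriv_letterBracket C j i _ _ _
      fun w hw => wordBraid_of_mem_support_serreElt j hw, h0, if_neg hij.symm,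
      letterBraid_comm hC j i]
    simp
  | succ k ih =>
    rw [serreElt_succ, skewDeriv_letterBracket C j i _ _ _
      fun w hw => wordBraid_of_mem_support_serreElt j hw, ih, if_neg hij.symm]
    simp

theorem skewDeriv_serreElt_of_ne {C : CartanDatum I} {i j l : I} (hli : l ≠ i) (hlj : l ≠ j)
    (k : ℕ) : wordLift (skewDeriv C l) (serreElt C i j k) = 0 := by
  induction k with
  | zero => simp [serreElt, skewDeriv, hlj]
  | succ k ih =>
    rw [serreElt_succ, skewDeriv_letterBracket C l i _ _ _
      fun w hw => wordBraid_of_mem_support_serreElt l hw, ih, if_neg hli]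
    simp

theorem serreElt_nil (C : CartanDatum I) (i j : I) (k : ℕ) : serreElt C i j k [] = 0 := by
  by_contra h
  have := (perm_of_mem_support_serreElt (Finsupp.mem_support_iff.2 h)).length_eq
  simp at this

/-- The standard `q`-Serre elements lie in the radical. -/
theorem serreElt_mem {C : CartanDatum I} (hC : ∀ i j, C.pairing i j = C.pairing j i) {i j : I}
    (hij : i ≠ j) (k : ℕ) (hk : letterBraid C i i ^ k * letterBraid C i j ^ 2 = 1) :
    InSerreRadical C (serreElt C i j (k + 1)) := by
  refine inSerreRadical_of_skewDeriv (serreElt_nil _ _ _ _) fun l => ?_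
  by_cases hli : l = i
  · subst hli
    rw [skewDeriv_serreElt_self hij, hk, sub_self, mul_zero, zero_smul]
  · by_cases hlj : l = j
    · subst hlj
      exact skewDeriv_serreElt_right hC hij k
    · exact skewDeriv_serreElt_of_ne hli hlj _

/-! ### Bracket trees as elements of the radical -/

open BracketTree

variable {A : Type} [Ring A] [Algebra GroundField A]

theorem evalWords_letterBracket (x : I → A) (i : I) (t : GroundField)
    (c : List I →₀ GroundField) :
    evalWords x (letterBracket i t c) = x i * evalWords x c - t • (evalWords x c * x i) := by
  simp only [evalWords_eq_wordLift]
  rw [letterBracket, map_sub, map_smul, wordLift_consMap, wordLift_snocMap]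
  have h1 := map_wordLift (LinearMap.mulLeft GroundField (x i)) (fun w => (w.map x).prod) c
  have h2 := map_wordLift (LinearMap.mulRight GroundField (x i)) (fun w => (w.map x).prod) c
  simp only [LinearMap.mulLeft_apply, LinearMap.mulRight_apply] at h1 h2
  rw [h1, h2]
  simp

theorem leaves_iterate (i j : I) (k : ℕ) :
    ((br (gen i))^[k] (gen j)).leaves = List.replicate k i ++ [j] := by
  induction k with
  | zero => rfl
  | succ k ih =>
    rw [Function.iterate_succ_apply', leaves, ih]
    rfl

theorem braid_leaves (C : CartanDatum I) (i : I) (b : BracketTree I) :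
    (paritySign ((gen i).parity C * b.parity C) : GroundField) *
      qElt ^ (gen i).degPairing C b = wordBraid C i b.leaves := by
  rw [wordBraid_eq, wordSign, wordPow, paritySign_list_sum, zpow_list_sum _ qElt_ne_zero,
    List.sum_map_mul_left]
  simp [BracketTree.parity, degPairing, leaves]

theorem eval_iterate (C : CartanDatum I) (x : I → A) (i j : I) (k : ℕ) :
    ((br (gen i))^[k] (gen j)).eval C x = evalWords x (serreElt C i j k) := by
  induction k with
  | zero => simp [BracketTree.eval, serreElt, evalWords]
  | succ k ih =>
    rw [Function.iterate_succ_apply', BracketTree.eval, braid_leaves, ih, serreElt,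
      evalWords_letterBracket, leaves_iterate]
    simp [BracketTree.eval, wordBraid]

/-- The square of an isotropic odd letter lies in the radical. -/
theorem single_square_mem {C : CartanDatum I} {i : I} (h : letterBraid C i i = -1) :
    InSerreRadical C (Finsupp.single [i, i] 1) := by
  refine inSerreRadical_of_skewDeriv (by simp) fun l => ?_
  by_cases hl : l = i
  · subst hl
    simp [skewDeriv_cons', skewDeriv_nil, h]
  · simp [skewDeriv_cons', skewDeriv_nil, hl]

theorem letterBraid_ne_zero (C : CartanDatum I) (i j : I) : letterBraid C i j ≠ 0 :=
  mul_ne_zero (paritySign_ne_zero _) (zpow_ne_zero _ qElt_ne_zero)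

/-- For distinct indices this is the shortest Serre element. For equal indices the bracket is
identically zero if the letter is even, and twice a square lying in the radical if the letter is
odd. -/
theorem eval_gen_gen_eq_zero {C : CartanDatum I} (hC : ∀ i j, C.pairing i j = C.pairing j i)
    (x : I → A) (hx : ∀ c, InSerreRadical C c → evalWords x c = 0) {i j : I}
    (h : C.pairing i j = 0) : (br (gen i) (gen j)).eval C x = 0 := by
  by_cases hij : i = j
  · subst hij
    rw [BracketTree.eval, braid_leaves]
    simp only [BracketTree.eval, leaves, wordBraid, List.map_cons, List.map_nil, List.prod_cons,
      List.prod_nil, mul_one]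
    by_cases hp : paritySign (C.parity i * C.parity i) = 1
    · simp [letterBraid, hp, h]
    · have hp : paritySign (C.parity i * C.parity i) = -1 := by
        revert hp
        unfold paritySign
        split_ifs <;> simp
      have h1 : letterBraid C i i = -1 := by simp [letterBraid, hp, h]
      have h2 := hx _ (single_square_mem h1)
      simp [evalWords] at h2
      rw [h2]
      simp
  · have h1 := serreElt_mem hC hij 0 (by
      rw [pow_zero, one_mul, letterBraid, h, zpow_zero, mul_one, pow_two, paritySign_mul_self])
    exact (eval_iterate C x i j 1).trans (hx _ h1)

/-- The powers of $q$ in the Serre condition cancel by `h`. The remaining sign is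
$(-1)^{r|\alpha_i|}$, which is why `hp` is needed. -/
theorem eval_iterate_eq_zero {C : CartanDatum I} (hC : ∀ i j, C.pairing i j = C.pairing j i)
    (x : I → A) (hx : ∀ c, InSerreRadical C c → evalWords x c = 0) {i j : I} (hij : i ≠ j)
    (r : ℕ) (h : (r : ℤ) * C.pairing i i = -2 * C.pairing i j)
    (hp : C.parity i = 0 ∨ Even r) : ((br (gen i))^[r + 1] (gen j)).eval C x = 0 := by
  rw [eval_iterate]
  refine hx _ (serreElt_mem hC hij r ?_)
  have h1 : (paritySign (C.parity i * C.parity i) : GroundField) ^ r = 1 := by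
    rcases hp with hp | hp
    · simp [hp, paritySign]
    · obtain ⟨k, rfl⟩ := hp
      rw [← two_mul, pow_mul, pow_two, paritySign_mul_self, one_pow]
  rw [letterBraid, letterBraid, mul_pow, mul_pow, h1, pow_two (paritySign _ : GroundField),
    paritySign_mul_self, ← zpow_natCast, ← zpow_natCast, ← zpow_mul, ← zpow_mul, one_mul,
    one_mul, ← zpow_add₀ qElt_ne_zero]
  have : C.pairing i i * (r : ℤ) + C.pairing i j * ((2 : ℕ) : ℤ) = 0 := by
    push_cast
    linarith
  rw [this, zpow_zero]

/-- This identity and the next two are the derivatives of the triangle relation in its three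
letters. Each holds because the braiding factors of the three edges multiply to $-1$. -/
theorem triangle_aux₁ {F V : Type*} [Field F] [AddCommGroup V] [Module F V] {a b c : F}
    (ha : a ≠ 0) (hb : b ≠ 0) (hc : c = -(a * b)⁻¹) (X Y : V) :
    (b - b⁻¹) • ((X - a • a • X) - (b * c) • (b • Y - a • b • a • Y)) -
      (a - a⁻¹) • ((Y - b • b • Y) - (a * c) • (a • X - b • a • b • X)) = 0 := by
  subst hc
  match_scalars <;> field_simp <;> ring

theorem triangle_aux₂ {F V : Type*} [Field F] [AddCommGroup V] [Module F V] {a b c : F}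
    (ha : a ≠ 0) (hb : b ≠ 0) (hc : c = -(a * b)⁻¹) (X Y : V) :
    (b - b⁻¹) • ((a • X - a • X) - (b * c) • (c • a • Y - a • c • Y)) -
      (a - a⁻¹) • ((a • c • X - b • c • a • Y) - (a * c) • (X - b • Y)) = 0 := by
  subst hc
  match_scalars <;> field_simp <;> ring

theorem triangle_aux₃ {F V : Type*} [Field F] [AddCommGroup V] [Module F V] {a b c : F}
    (ha : a ≠ 0) (hb : b ≠ 0) (hc : c = -(a * b)⁻¹) (X Y : V) :
    (b - b⁻¹) • ((b • c • X - a • c • b • Y) - (b * c) • (X - a • Y)) -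
      (a - a⁻¹) • ((b • X - b • X) - (a * c) • (c • b • Y - b • c • Y)) = 0 := by
  subst hc
  match_scalars <;> field_simp <;> ring

theorem eval_triangle {C : CartanDatum I} (hC : ∀ i j, C.pairing i j = C.pairing j i)
    (x : I → A) (hx : ∀ c, InSerreRadical C c → evalWords x c = 0) {i j k : I} (hij : i ≠ j)
    (hik : i ≠ k) (hjk : j ≠ k)
    (h : C.pairing i j + C.pairing i k + C.pairing j k = 0)
    (hp : C.parity i * C.parity j + C.parity i * C.parity k + C.parity j * C.parity k = 1) :
    ((paritySign (C.parity i * C.parity k) : GroundField) * qInt (C.pairing i k)) •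
        (br (br (gen i) (gen j)) (gen k)).eval C x =
      ((paritySign (C.parity i * C.parity j) : GroundField) * qInt (C.pairing i j)) •
        (br (br (gen i) (gen k)) (gen j)).eval C x := by
  set a := letterBraid C i j with ha
  set b := letterBraid C i k with hb
  set c := letterBraid C j k with hc
  -- The pairings sum to zero, so the powers of $q$ cancel, and the parity hypothesis makes the
  -- product of the signs $-1$.
  have habc : a * b * c = -1 := by
    have h1 : (paritySign (C.parity i * C.parity j) : GroundField) *
        paritySign (C.parity i * C.parity k) * paritySign (C.parity j * C.parity k) = -1 := by
      rw [← paritySign_add, ← paritySign_add, hp]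
      simp [paritySign]
    have h2 : qElt ^ C.pairing i j * qElt ^ C.pairing i k * qElt ^ C.pairing j k = 1 := by
      rw [← zpow_add₀ qElt_ne_zero, ← zpow_add₀ qElt_ne_zero, h, zpow_zero]
    rw [ha, hb, hc, letterBraid, letterBraid, letterBraid]
    linear_combination (qElt ^ C.pairing i j * qElt ^ C.pairing i k * qElt ^ C.pairing j k) * h1 
      - h2
  have ha0 : a ≠ 0 := letterBraid_ne_zero _ _ _
  have hb0 : b ≠ 0 := letterBraid_ne_zero _ _ _
  have hcval : c = -(a * b)⁻¹ := by
    field_simp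
    linear_combination habc
  -- A signed $q$-integer is the antisymmetrized braiding factor up to a common scalar. The whole
  -- relation is thereby expressed in `a`, `b`, `c`.
  have hcoef : ∀ i k, (paritySign (C.parity i * C.parity k) : GroundField) *
      qInt (C.pairing i k) =
      (qElt - qElt⁻¹)⁻¹ * (letterBraid C i k - (letterBraid C i k)⁻¹) := by
    intro i k
    have h1 : (paritySign (C.parity i * C.parity k) : GroundField)⁻¹ =
        paritySign (C.parity i * C.parity k) :=
      inv_eq_of_mul_eq_one_left (paritySign_mul_self _)
    rw [qInt, letterBraid, mul_inv, h1, zpow_neg, div_eq_mul_inv]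
    ring
  have hbr : ∀ i j k, (br (br (gen i) (gen j)) (gen k)).eval C x =
      evalWords x (Finsupp.single [i, j, k] 1 - letterBraid C i j • Finsupp.single [j, i, k] 1 -
        (letterBraid C i k * letterBraid C j k) • (Finsupp.single [k, i, j] 1 -
          letterBraid C i j • Finsupp.single [k, j, i] 1)) := by
    intro i j k
    have e1 : (paritySign ((br (gen i) (gen j)).parity C * (gen k).parity C) : GroundField) *
        qElt ^ (br (gen i) (gen j)).degPairing C (gen k) =
        letterBraid C i k * letterBraid C j k := by
      simp only [BracketTree.parity, degPairing, leaves, letterBraid, List.map_cons,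
        List.map_nil, List.sum_cons, List.sum_nil, List.cons_append, List.nil_append, add_zero,
        add_mul, paritySign_add, zpow_add₀ qElt_ne_zero]
      ring
    have e2 := braid_leaves C i (gen j)
    simp only [BracketTree.eval]
    rw [e1, e2]
    simp only [ evalWords_eq_wordLift, map_sub, map_smul, wordLift,
      Finsupp.linearCombination_single, leaves, wordBraid, List.map_cons, List.map_nil,
      List.prod_cons, List.prod_nil, mul_one, one_smul, sub_mul, mul_sub, smul_mul_assoc,
      mul_smul_comm, mul_assoc]
  rw [hbr, hbr, hcoef, hcoef, ← ha, ← hb, ← hc, letterBraid_comm hC k j, ← hc, ← sub_eq_zero,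
    mul_smul (qElt - qElt⁻¹)⁻¹ (b - b⁻¹), mul_smul (qElt - qElt⁻¹)⁻¹ (a - a⁻¹), ← smul_sub]
  simp only [evalWords_eq_wordLift]
  rw [← map_smul, ← map_smul, ← map_sub, ← evalWords_eq_wordLift, hx, smul_zero]
  refine inSerreRadical_of_skewDeriv (by simp) fun l => ?_
  have hword : ∀ l i j k, skewDeriv C l [i, j, k] =
      (if l = i then Finsupp.single [j, k] 1 else 0) +
      letterBraid C l i • ((if l = j then Finsupp.single [i, k] 1 else 0) +
        letterBraid C l j • (if l = k then Finsupp.single [i, j] 1 else 0)) := by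
    intro l i j k
    rw [skewDeriv_cons', skewDeriv_cons', skewDeriv_cons']
    simp only [skewDeriv, map_zero, smul_zero, add_zero, map_add, map_smul]
    split_ifs <;> simp
  simp only [map_sub, map_smul, wordLift, Finsupp.linearCombination_single, one_smul, hword]
  by_cases hi : l = i
  · subst hi
    simp only [hij, hik, if_true, if_false, ← ha, ← hb, smul_zero, add_zero, zero_add]
    exact triangle_aux₁ ha0 hb0 hcval _ _
  · by_cases hj : l = j
    · subst hj
      simp only [hi, hjk, if_true, if_false, ← hc, smul_zero, add_zero, zero_add,
        letterBraid_comm hC l i]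
      exact triangle_aux₂ ha0 hb0 hcval _ _
    · by_cases hk : l = k
      · subst hk
        simp only [hi, hj, if_true, if_false, smul_zero, add_zero, zero_add,
          letterBraid_comm hC l i, letterBraid_comm hC l j]
        exact triangle_aux₃ ha0 hb0 hcval _ _
      · simp [hi, hj, hk]
end SerreElements
end

noncomputable section
set_option linter.unusedSectionVars false

theorem paritySign_self (p : ZMod 2) : paritySign p * paritySign p = 1 := by
  revert p; decide

theorem paritySign_add_int (p r : ZMod 2) :
    paritySign (p + r) = paritySign p * paritySign r := by
  revert p r; decide

namespace Setup

variable {m n : ℕ} (S : Setup m n)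

/-! ### Parities, signs and weights of the basis vectors -/

/-- The parity of a basis vector. -/
def vpar (a : Fin (m + n)) : ZMod 2 := S.par (a + 1)

/-- The sign `ϑ` of a basis vector. -/
def vsgn (a : Fin (m + n)) : ℤ := S.sgn (a + 1)

theorem mem_Icc (a : Fin (m + n)) : (a : ℕ) + 1 ∈ Finset.Icc 1 (m + n) := by
  rw [Finset.mem_Icc]; lia

theorem rev_add_one (a : Fin (m + n)) : (a.rev : ℕ) + 1 = m + n + 1 - ((a : ℕ) + 1) := by
  rw [Fin.val_rev]; lia

theorem vpar_rev (a : Fin (m + n)) : S.vpar a.rev = S.vpar a := by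
  rw [vpar, rev_add_one]
  exact S.par_prime _ (mem_Icc a)

theorem vsgn_mul_self (a : Fin (m + n)) : S.vsgn a * S.vsgn a = 1 := by
  rcases S.sgn_unit _ (mem_Icc a) with h | h <;> rw [vsgn, h] <;> rfl

theorem zmod2_cases (p : ZMod 2) : p = 0 ∨ p = 1 := by
  revert p; decide

theorem vsgn_rev (a : Fin (m + n)) : S.vsgn a.rev = paritySign (S.vpar a) * S.vsgn a := by
  rcases zmod2_cases (S.vpar a) with h | h
  · have h1 := S.sgn_even _ (mem_Icc a) h
    have h2 := S.sgn_even _ (mem_Icc a.rev) ((S.vpar_rev a).trans h)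
    rw [vsgn, vsgn, h1, h2, h]
    rfl
  · have h1 := S.sgn_odd _ (mem_Icc a) h
    rw [← rev_add_one] at h1
    change S.vsgn a = -S.vsgn a.rev at h1
    rw [h1, h]
    simp [paritySign]

/-- An odd fixed index would satisfy $\vartheta_a=-\vartheta_a$. -/
theorem vpar_of_rev_eq {a : Fin (m + n)} (h : a.rev = a) : S.vpar a = 0 := by
  rcases zmod2_cases (S.vpar a) with h1 | h1
  · exact h1
  · have h2 := S.vsgn_rev a
    have h3 := S.vsgn_mul_self a
    rw [h, h1] at h2
    have h4 : paritySign (1 : ZMod 2) = -1 := rfl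
    rw [h4] at h2
    have : S.vsgn a = 0 := by linarith
    rw [this] at h3
    simp at h3

/-- The weight of a basis vector. -/
def wt (a : Fin (m + n)) : Fin (rk m n) → ℤ := S.eps (a + 1)

theorem wt_apply (a : Fin (m + n)) (k : Fin (rk m n)) :
    S.wt a k = (if (a : ℕ) = k then 1 else 0) - (if (a.rev : ℕ) = k then 1 else 0) := by
  rw [wt, eps, ← rev_add_one]
  simp

/-- The pairing of weights as a bilinear map. -/
def pairHom : (Fin (rk m n) → ℤ) →+ (Fin (rk m n) → ℤ) →+ ℤ :=
  AddMonoidHom.mk' (fun x => AddMonoidHom.mk' (fun y => S.pairP x y) fun y z => by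
      simp [pairP, mul_add, Finset.sum_add_distrib]) fun x y => by
    ext z
    simp [pairP, mul_add, add_mul, Finset.sum_add_distrib]

theorem pairHom_apply (x y : Fin (rk m n) → ℤ) : S.pairHom x y = S.pairP x y := rfl

/-- The parity of weights as a homomorphism. -/
def parityHom : (Fin (rk m n) → ℤ) →+ ZMod 2 :=
  AddMonoidHom.mk' (fun x => S.parityP x) fun x y => by
    simp [parityP, add_mul, Finset.sum_add_distrib]

theorem pairP_comm (x y : Fin (rk m n) → ℤ) : S.pairP x y = S.pairP y x := by
  unfold pairP
  exact Finset.sum_congr rfl fun k _ => by ring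

theorem val_trichotomy (a : Fin (m + n)) :
    (a : ℕ) < rk m n ∨ (a.rev : ℕ) < rk m n ∨ a.rev = a ∧ ¬ (a : ℕ) < rk m n := by
  rw [Fin.ext_iff, Fin.val_rev]
  unfold rk
  lia

/-- One formula for both halves of the basis. It also covers the middle vector, whose weight is
zero, since there the two indicators coincide and cancel. -/
theorem pairP_wt (a b : Fin (m + n)) : S.pairP (S.wt a) (S.wt b) =
    paritySign (S.vpar a) * ((if a = b then 1 else 0) - (if a = b.rev then 1 else 0)) := by
  have hs : ∀ (k : Fin (rk m n)) (y : Fin (rk m n) → ℤ),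
      ∑ l : Fin (rk m n), S.psign (l + 1) * (if (k : ℕ) = l then 1 else 0) * y l =
        S.psign (k + 1) * y k := by
    intro k y
    rw [Finset.sum_eq_single k]
    · simp
    · intro l _ hl
      rw [if_neg fun h => hl (Fin.ext h.symm)]
      simp
    · simp
  rcases val_trichotomy a with ha | ha | ⟨ha, ha'⟩
  · have h1 : ∀ l : Fin (rk m n), S.wt a l = if (a : ℕ) = l then 1 else 0 := by
      intro l
      rw [wt_apply, if_neg (c := (a.rev : ℕ) = l), sub_zero]
      rw [Fin.val_rev]
      have := l.2
      unfold rk at *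
      lia
    simp only [pairP, h1]
    rw [hs ⟨a, ha⟩, wt_apply]
    simp only [psign, vpar, Fin.ext_iff, Fin.val_rev]
    congr 2
    · congr 1
      exact propext eq_comm
    · congr 1
      apply propext; lia
  · have h1 : ∀ l : Fin (rk m n), S.wt a l = -(if (a.rev : ℕ) = l then 1 else 0) := by
      intro l
      rw [wt_apply, if_neg (c := (a : ℕ) = l), zero_sub]
      rw [Fin.val_rev] at ha
      have := l.2
      unfold rk at *
      lia
    simp only [pairP, h1, mul_neg, neg_mul, Finset.sum_neg_distrib]
    rw [hs ⟨a.rev, ha⟩, wt_apply]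
    have h2 : S.psign (((⟨a.rev, ha⟩ : Fin (rk m n)) : ℕ) + 1) = paritySign (S.vpar a) := by
      rw [← S.vpar_rev]; rfl
    have h3 : ((b : ℕ) = a.rev) ↔ a = b.rev := by
      simp only [Fin.ext_iff, Fin.val_rev]; lia
    have h4 : ((b.rev : ℕ) = a.rev) ↔ a = b := by
      simp only [Fin.ext_iff, Fin.val_rev]; lia
    rw [h2]
    simp only [h3, h4]
    ring
  · have h1 : ∀ l : Fin (rk m n), S.wt a l = 0 := by
      intro l
      rw [wt_apply, ha, sub_self]
    have h3 : a = b ↔ a = b.rev := by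
      simp only [Fin.ext_iff, Fin.val_rev] at ha ⊢; lia
    simp [pairP, h1, h3]

theorem parityP_wt (a : Fin (m + n)) : S.parityP (S.wt a) = S.vpar a := by
  have hs : ∀ k : Fin (rk m n),
      ∑ l : Fin (rk m n), ((if (k : ℕ) = l then 1 else 0 : ℤ) : ZMod 2) * S.par (l + 1) =
        S.par (k + 1) := by
    intro k
    rw [Finset.sum_eq_single k]
    · simp
    · intro l _ hl
      rw [if_neg fun h => hl (Fin.ext h.symm)]
      simp
    · simp
  rcases val_trichotomy a with ha | ha | ⟨ha, ha'⟩
  · have h1 : ∀ l : Fin (rk m n), S.wt a l = if (a : ℕ) = l then 1 else 0 := by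
      intro l
      rw [wt_apply, if_neg (c := (a.rev : ℕ) = l), sub_zero]
      rw [Fin.val_rev]
      have := l.2
      unfold rk at *
      lia
    simp only [parityP, h1]
    exact hs ⟨a, ha⟩
  · have h1 : ∀ l : Fin (rk m n), S.wt a l = -(if (a.rev : ℕ) = l then 1 else 0) := by
      intro l
      rw [wt_apply, if_neg (c := (a : ℕ) = l), zero_sub]
      rw [Fin.val_rev] at ha
      have := l.2
      unfold rk at *
      lia
    simp only [parityP, h1, Int.cast_neg, CharTwo.neg_eq]
    exact (hs ⟨a.rev, ha⟩).trans (S.vpar_rev a)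
  · have h1 : ∀ l : Fin (rk m n), S.wt a l = 0 := by
      intro l
      rw [wt_apply, ha, sub_self]
    simp [parityP, h1, S.vpar_of_rev_eq ha]

theorem wt_rev (a : Fin (m + n)) : S.wt a.rev = -S.wt a := by
  funext k
  simp [wt_apply]

/-- The Gram matrix of the weights separates the indices: by `pairP_wt` two different vectors of
equal weight would give contradictory pairings. -/
theorem wt_injective : Function.Injective S.wt := by
  intro a b h
  have h1 := S.pairP_wt a a
  have h2 := S.pairP_wt b b
  have h3 := S.pairP_wt a b
  rw [h] at h1 h3
  have ha := paritySign_self (S.vpar a)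
  have hb := paritySign_self (S.vpar b)
  by_contra hne
  rw [h2, if_neg hne, if_pos rfl] at h3
  rw [h2] at h1
  simp only [if_true] at h1
  by_cases hbr : b = b.rev
  · have har : a = a.rev := by
      by_contra har
      rw [if_pos hbr, if_neg har] at h1
      simp only [sub_self, mul_zero, sub_zero, mul_one] at h1
      rw [← h1] at ha
      simp at ha
    apply hne
    simp only [Fin.ext_iff, Fin.val_rev] at *
    lia
  · rw [if_neg hbr] at h3
    by_cases hab : a = b.rev
    · rw [if_pos hab, hab, S.vpar_rev] at h3
      have : paritySign (S.vpar b) = 0 := by linarith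
      rw [this] at hb
      simp at hb
    · rw [if_neg hab] at h3
      simp only [sub_zero, mul_zero, mul_one] at h3
      rw [h3] at hb
      simp at hb

/-! ### The elements `X_{ab}` -/

/-- The sign in `X_{ab}`. -/
def xsign (a b : Fin (m + n)) : ℤ :=
  paritySign (S.vpar a * (S.vpar a + S.vpar b)) * S.vsgn a * S.vsgn b

/-- `X_{ab}` indexed by elements of `Fin N`. -/
def Y (R : Type) [CommRing R] (a b : Fin (m + n)) : Mat m n R :=
  Matrix.single a b 1 - (S.xsign a b : R) • Matrix.single b.rev a.rev 1

theorem E_eq_single (R : Type) [CommRing R] (a b : Fin (m + n)) (i j : ℕ) (hi : i = a + 1)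
    (hj : j = b + 1) : E m n R i j = Matrix.single a b 1 := by
  subst hi hj
  ext c d
  simp only [E, Matrix.of_apply, Matrix.single_apply, Fin.ext_iff]
  congr 1
  apply propext
  lia

theorem X_eq (R : Type) [CommRing R] (a b : Fin (m + n)) (i j : ℕ) (hi : i = a + 1)
    (hj : j = b + 1) : S.X R i j = S.Y R a b := by
  subst hi hj
  rw [X, Y, E_eq_single R a b _ _ rfl rfl,
    E_eq_single R b.rev a.rev (S.prime _) (S.prime _) (rev_add_one b).symm (rev_add_one a).symm]
  rfl

theorem xsign_self (a : Fin (m + n)) : S.xsign a a = 1 := by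
  rw [xsign, CharTwo.add_self_eq_zero, mul_zero, mul_assoc, vsgn_mul_self]
  rfl

theorem xsign_mul_self (a b : Fin (m + n)) : S.xsign a b * S.xsign a b = 1 := by
  rw [xsign]
  linear_combination (S.vsgn a * S.vsgn a * S.vsgn b * S.vsgn b) * 
    paritySign_self (S.vpar a * (S.vpar a + S.vpar b)) + 
    (S.vsgn b * S.vsgn b) * S.vsgn_mul_self a + S.vsgn_mul_self b

theorem xsign_swap (a b : Fin (m + n)) :
    S.xsign b a = paritySign (S.vpar a + S.vpar b) * S.xsign a b := by
  rw [xsign, xsign]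
  have : ∀ p r : ZMod 2, paritySign (r * (r + p)) =
      paritySign (p + r) * paritySign (p * (p + r)) := by decide
  rw [this (S.vpar a)]
  ring

theorem Y_apply (R : Type) [CommRing R] (a b c d : Fin (m + n)) : S.Y R a b c d =
    (if a = c ∧ b = d then 1 else 0) -
      (S.xsign a b : R) * (if b.rev = c ∧ a.rev = d then 1 else 0) := by
  simp [Y, Matrix.single_apply]

theorem Y_wt (R : Type) [CommRing R] (a b c d : Fin (m + n)) (h : S.Y R a b c d ≠ 0) :
    S.wt c - S.wt d = S.wt a - S.wt b ∧ S.vpar c + S.vpar d = S.vpar a + S.vpar b := by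
  rw [Y_apply] at h
  by_cases h1 : a = c ∧ b = d
  · rw [h1.1, h1.2]; exact ⟨rfl, rfl⟩
  · by_cases h2 : b.rev = c ∧ a.rev = d
    · rw [← h2.1, ← h2.2, wt_rev, wt_rev, vpar_rev, vpar_rev]
      exact ⟨by abel, add_comm _ _⟩
    · simp [h1, h2] at h

end Setup
end

noncomputable section
set_option linter.unusedSectionVars false

namespace Setup

variable {m n : ℕ} (S : Setup m n)

/-! ### Supercommutators of the elements `X_{ab}` -/

section commutators

variable (R : Type) [CommRing R]

theorem single_mul_single' {ι : Type} [Fintype ι] [DecidableEq ι] (a b c d : ι) :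
    (Matrix.single a b 1 : Matrix ι ι R) * Matrix.single c d 1 =
      if b = c then Matrix.single a d 1 else 0 := by
  split_ifs with h
  · subst h; simp
  · exact Matrix.single_mul_single_of_ne _ _ _ _ h _

theorem Y_mul (a b c d : Fin (m + n)) : S.Y R a b * S.Y R c d =
    (if b = c then Matrix.single a d 1 else 0) -
      (S.xsign c d : R) • (if b = d.rev then Matrix.single a c.rev 1 else 0) -
      (S.xsign a b : R) • (if a.rev = c then Matrix.single b.rev d 1 else 0) +
      ((S.xsign a b * S.xsign c d : ℤ) : R) •
        (if a = d then Matrix.single b.rev c.rev 1 else 0) := by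
  simp only [Y, sub_mul, mul_sub, smul_mul_assoc, mul_smul_comm, single_mul_single', Fin.rev_inj,
    smul_sub, smul_smul, Int.cast_mul, mul_comm]
  abel

theorem Y_mul_eq_zero {a b c d : Fin (m + n)} (h1 : b ≠ c) (h2 : b ≠ d.rev) (h3 : a.rev ≠ c)
    (h4 : a ≠ d) : S.Y R a b * S.Y R c d = 0 := by
  simp [Y_mul, h1, h2, h3, h4]

theorem rev_ne {a b : Fin (m + n)} (h : a ≠ b.rev) : a.rev ≠ b := fun h' => h (by simp [← h'])

/-- Away from the long case `x = y.rev`, the terms that survive in the two products are diagonal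
matrix units at `x`, `y` and their mirrors. -/
theorem Y_commutator_diagonal {x y : Fin (m + n)} (h2 : x ≠ y.rev) :
    S.Y R x y * S.Y R y x -
      (paritySign (S.vpar x + S.vpar y) : R) • (S.Y R y x * S.Y R x y) =
    Matrix.diagonal fun c => (((if x = c then 1 else 0) - (if x = c.rev then 1 else 0) -
      paritySign (S.vpar x + S.vpar y) *
        ((if y = c then 1 else 0) - (if y = c.rev then 1 else 0)) : ℤ) : R) := by
  have h3 : y ≠ x.rev := (rev_ne h2).symm
  have hp := paritySign_self (S.vpar x + S.vpar y)
  have e1 : S.xsign x y * S.xsign y x = paritySign (S.vpar x + S.vpar y) := by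
    rw [xsign_swap S x y]
    linear_combination paritySign (S.vpar x + S.vpar y) * S.xsign_mul_self x y
  have e2 : S.xsign y x * S.xsign x y = paritySign (S.vpar x + S.vpar y) := by
    rw [mul_comm, e1]
  rw [Y_mul, Y_mul, e1, e2]
  simp only [h2, h3, h3.symm, h2.symm, if_true, if_false, smul_zero, sub_zero]
  set p := paritySign (S.vpar x + S.vpar y)
  ext c d
  simp only [Matrix.sub_apply, Matrix.add_apply, Matrix.smul_apply, smul_eq_mul,
    Matrix.diagonal_apply, Matrix.single_apply]
  have hpR : (p : R) * p = 1 := by exact_mod_cast congrArg (Int.cast : ℤ → R) hp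
  have f1 : ∀ z : Fin (m + n), (z.rev = c ∧ z.rev = d) ↔ (c = d ∧ z = c.rev) := by
    intro z
    constructor
    · rintro ⟨rfl, rfl⟩; simp
    · rintro ⟨rfl, rfl⟩; simp
  have f2 : ∀ z : Fin (m + n), (z = c ∧ z = d) ↔ (c = d ∧ z = c) := by
    intro z
    constructor
    · rintro ⟨rfl, rfl⟩; simp
    · rintro ⟨rfl, rfl⟩; simp
  simp only [f1, f2]
  by_cases hcd : c = d
  · simp only [hcd, true_and, if_true]
    push_cast
    linear_combination (- (if x = d.rev then 1 else 0 : R)) * hpR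
  · simp [hcd]

/-- The two matrix units in $X_{xx'}$ coincide, and for odd `x` the sign makes them add up. This is
the source of the factors $2$ and $\tfrac12$ at long roots. -/
theorem Y_long {x : Fin (m + n)} (hx : S.vpar x = 1) :
    S.Y R x x.rev = (2 : R) • Matrix.single x x.rev 1 := by
  have : S.xsign x x.rev = -1 := by
    rw [xsign, vpar_rev, CharTwo.add_self_eq_zero, mul_zero, vsgn_rev, hx]
    have := S.vsgn_mul_self x
    simp only [paritySign, if_true, one_mul, one_ne_zero, if_false]
    linarith
  rw [Y, this, Fin.rev_rev, two_smul]
  simp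

/-- The fork at the finite end of the diagram. Both products are nonzero multiples of $E_{y'y}$, and
they cancel because `y` is even. -/
theorem Y_commutator_source {x y : Fin (m + n)} (h1 : x ≠ y) (h2 : x ≠ y.rev) (h3 : y ≠ y.rev)
    (hy : S.vpar y = 0) :
    S.Y R x y * S.Y R y.rev x -
      (paritySign ((S.vpar x + S.vpar y) * (S.vpar x + S.vpar y.rev)) : R) •
        (S.Y R y.rev x * S.Y R x y) = 0 := by
  have h4 : y ≠ x.rev := (rev_ne h2).symm
  have e1 : S.xsign x y * S.xsign y.rev x = paritySign (S.vpar x * S.vpar x) := by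
    rw [xsign, xsign, vsgn_rev, vpar_rev, hy, zero_mul, add_zero]
    have hx := S.vsgn_mul_self x
    have hy := S.vsgn_mul_self y
    simp only [paritySign, if_true, one_mul]
    linear_combination (if S.vpar x * S.vpar x = 0 then 1 else -1) * (S.vsgn y * S.vsgn y * hx + hy)
  rw [Y_mul, Y_mul, e1, vpar_rev, hy, add_zero]
  simp [h1, h2, h3, h4, h1.symm, h3.symm]

/-- The fork at the affine end: both products are multiples of $E_{w'w}$. The companion statement,
with multiples of $E_{ww'}$, exchanges the roles of the two nodes. -/
theorem Y_commutator_target {w z : Fin (m + n)} (h1 : w ≠ z) (h2 : w ≠ z.rev) (h3 : w ≠ w.rev)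
    (hw : S.vpar w = 0) :
    S.Y R z.rev w * S.Y R z w -
      (paritySign ((S.vpar z.rev + S.vpar w) * (S.vpar w + S.vpar z)) : R) •
        (S.Y R z w * S.Y R z.rev w) = 0 := by
  have h4 : z ≠ w.rev := (rev_ne h2).symm
  have e1 : S.xsign z.rev w = paritySign (S.vpar z * S.vpar z) * S.xsign z w := by
    rw [xsign, xsign, vsgn_rev, vpar_rev, hw, add_zero]
    have : ∀ p : ZMod 2, paritySign (p * p) = paritySign p := by decide
    rw [this]
    ring
  rw [Y_mul, Y_mul, e1, vpar_rev, hw, add_zero, zero_add]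
  simp [h1, h2, h1.symm, h2.symm, h3]

theorem Y_commutator_target' {w z : Fin (m + n)} (h1 : w ≠ z) (h2 : w ≠ z.rev) (h3 : w ≠ w.rev)
    (hw : S.vpar w = 0) :
    S.Y R w z * S.Y R w z.rev -
      (paritySign ((S.vpar w + S.vpar z) * (S.vpar z.rev + S.vpar w)) : R) •
        (S.Y R w z.rev * S.Y R w z) = 0 := by
  have h4 : z ≠ w.rev := (rev_ne h2).symm
  have e1 : S.xsign w z.rev = paritySign (S.vpar z * S.vpar z) * S.xsign w z := by
    rw [xsign, xsign, vsgn_rev, vpar_rev, hw, zero_mul]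
    have : ∀ p : ZMod 2, paritySign (p * p) = paritySign p := by decide
    rw [this]
    ring
  rw [Y_mul, Y_mul, e1, vpar_rev, hw, add_zero, zero_add]
  simp [h1, h2, h3.symm, h1.symm, h2.symm]

end commutators

/-! ### The nodes of the affine Dynkin diagram -/

/-- The index `a` with `α_i = ε_a - ε_b`. -/
def src (i : Fin (rk m n + 1)) : Fin (m + n) :=
  if (i : ℕ) = 0 then
    (if S.par 1 = 0 then ⟨m + n - 2, by have := S.two_lt; lia⟩
      else ⟨m + n - 1, by have := S.two_lt; lia⟩)
  else if Odd m ∨ (i : ℕ) < rk m n then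
    ⟨i - 1, by have := S.two_lt; have := i.2; unfold rk at this; lia⟩
  else if S.par (rk m n) = 0 then ⟨rk m n - 2, by have := S.two_lt; unfold rk; lia⟩
  else ⟨rk m n - 1, by have := S.two_lt; unfold rk; lia⟩

/-- The index `b` with `α_i = ε_a - ε_b`. -/
def tgt (i : Fin (rk m n + 1)) : Fin (m + n) :=
  ⟨i, by have := S.two_lt; have := i.2; unfold rk at this; lia⟩

theorem odd_iff (S : Setup m n) : Odd m ↔ (m + n) % 2 = 1 := by
  obtain ⟨k, hk⟩ := S.even_n
  rw [Nat.odd_iff]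
  lia

/-- The five kinds of nodes: affine with $v_1$ even, affine with $v_1$ odd, a difference of
consecutive weights, a fork at the finite end, and a long root at the finite end. The data are
stated as equations without subtraction, so that later index checks are linear arithmetic. -/
theorem node_cases (i : Fin (rk m n + 1)) :
    ((i : ℕ) = 0 ∧ S.par 1 = 0 ∧ (S.src i : ℕ) + 2 = m + n) ∨
    ((i : ℕ) = 0 ∧ S.par 1 = 1 ∧ (S.src i : ℕ) + 1 = m + n) ∨
    (((m + n) % 2 = 1 ∨ (i : ℕ) < rk m n) ∧ (S.src i : ℕ) + 1 = i) ∨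
    ((m + n) % 2 = 0 ∧ (i : ℕ) = rk m n ∧ S.par (rk m n) = 0 ∧ (S.src i : ℕ) + 2 = rk m n) ∨
    ((m + n) % 2 = 0 ∧ (i : ℕ) = rk m n ∧ S.par (rk m n) = 1 ∧ (S.src i : ℕ) + 1 = rk m n) := by
  have hN := S.two_lt
  have hi := i.2
  have ho := S.odd_iff
  by_cases h0 : (i : ℕ) = 0
  · rcases zmod2_cases (S.par 1) with h1 | h1
    · left
      refine ⟨h0, h1, ?_⟩
      simp only [src, h0, h1, if_true]
      lia
    · right; left
      refine ⟨h0, h1, ?_⟩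
      simp only [src, h0, h1, if_true, one_ne_zero, if_false]
      lia
  · by_cases h1 : Odd m ∨ (i : ℕ) < rk m n
    · right; right; left
      refine ⟨by rwa [← ho], ?_⟩
      simp only [src, h0, h1, if_true, if_false]
      lia
    · have h2 : (m + n) % 2 = 0 ∧ (i : ℕ) = rk m n := by
        rw [not_or, ho] at h1
        lia
      right; right; right
      rcases zmod2_cases (S.par (rk m n)) with h3 | h3
      · left
        refine ⟨h2.1, h2.2, h3, ?_⟩
        simp only [src, h0, h1, h3, if_true, if_false]
        unfold rk
        lia
      · right
        refine ⟨h2.1, h2.2, h3, ?_⟩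
        simp only [src, h0, h1, h3, one_ne_zero, if_false]
        unfold rk
        lia

theorem eps_eq_wt (a : Fin (m + n)) (i : ℕ) (h : i = a + 1) : S.eps i = S.wt a := by
  rw [h]; rfl

/-- Since $\varepsilon_{i'}=-\varepsilon_i$, sums and doubles of weights also become differences of
weights of basis vectors. All nodes can then be treated by one formula. -/
theorem alphaHat_eq (i : Fin (rk m n + 1)) : (S.alphaHat i).2 = S.wt (S.src i) - S.wt (S.tgt i) := by
  have hN := S.two_lt
  have ho := S.odd_iff
  have ht : (S.tgt i : ℕ) = i := rfl
  rcases S.node_cases i with ⟨h0, h1, h2⟩ | ⟨h0, h1, h2⟩ | ⟨h0, h2⟩ | ⟨h0, h0', h1, h2⟩ |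
    ⟨h0, h0', h1, h2⟩
  · have e1 : S.eps 2 = -S.wt (S.src i) := by
      rw [← wt_rev]
      exact S.eps_eq_wt _ _ (by rw [Fin.val_rev]; lia)
    rw [alphaHat, if_pos h0, theta, if_pos h1, e1, S.eps_eq_wt (S.tgt i) 1 (by lia)]
    exact (neg_add_rev _ _).trans (by rw [neg_neg, sub_eq_add_neg])
  · have e1 : S.eps 1 = -S.wt (S.src i) := by
      rw [← wt_rev]
      exact S.eps_eq_wt _ _ (by rw [Fin.val_rev]; lia)
    have e2 := S.eps_eq_wt (S.tgt i) 1 (by lia)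
    rw [alphaHat, if_pos h0, theta, if_neg (by rw [h1]; decide), two_smul]
    nth_rw 1 [e1]
    rw [e2]
    exact (neg_add_rev _ _).trans (by rw [neg_neg, add_comm, sub_eq_add_neg])
  · have hi : (i : ℕ) ≠ 0 := by lia
    rw [alphaHat, if_neg hi, alpha, if_pos (by rwa [ho]), S.eps_eq_wt (S.src i) _ h2.symm,
      S.eps_eq_wt (S.tgt i) _ (by lia)]
  · have hi : (i : ℕ) ≠ 0 := by unfold rk at *; lia
    rw [alphaHat, if_neg hi, alpha, if_neg (by rw [ho]; lia), if_pos h1,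
      S.eps_eq_wt (S.src i) _ (by lia), S.eps_eq_wt (S.tgt i) _ (by lia)]
  · have hi : (i : ℕ) ≠ 0 := by unfold rk at *; lia
    have e1 : S.eps (rk m n) = -S.wt (S.tgt i) := by
      rw [← wt_rev]
      exact S.eps_eq_wt _ _ (by rw [Fin.val_rev]; unfold rk at *; lia)
    rw [alphaHat, if_neg hi, alpha, if_neg (by rw [ho]; lia), if_neg (by rw [h1]; decide),
      two_smul]
    nth_rw 2 [e1]
    rw [S.eps_eq_wt (S.src i) _ (by lia)]
    exact (sub_eq_add_neg _ _).symm

theorem affDatum_pairing (i j : Fin (rk m n + 1)) : S.affDatum.pairing i j =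
    S.pairHom (S.wt (S.src i) - S.wt (S.tgt i)) (S.wt (S.src j) - S.wt (S.tgt j)) := by
  rw [← alphaHat_eq, ← alphaHat_eq]
  rfl

theorem affDatum_pairing_comm (i j : Fin (rk m n + 1)) :
    S.affDatum.pairing i j = S.affDatum.pairing j i := S.pairP_comm _ _

theorem affDatum_parity (i : Fin (rk m n + 1)) :
    S.affDatum.parity i = S.vpar (S.src i) + S.vpar (S.tgt i) := by
  change S.parityHom (S.alphaHat i).2 = _
  rw [alphaHat_eq, map_sub, CharTwo.sub_eq_add]
  change S.parityP _ + S.parityP _ = _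
  rw [parityP_wt, parityP_wt]

theorem src_ne_tgt (i : Fin (rk m n + 1)) : S.src i ≠ S.tgt i := by
  have hN := S.two_lt
  have ht : (S.tgt i : ℕ) = i := rfl
  intro h
  have h' := congrArg Fin.val h
  rcases S.node_cases i with ⟨h0, h1, h2⟩ | ⟨h0, h1, h2⟩ | ⟨h0, h2⟩ | ⟨h0, h0', h1, h2⟩ |
    ⟨h0, h0', h1, h2⟩ <;> unfold rk at * <;> lia

/-- If `α_i` is twice a weight, then the weight is odd. -/
theorem vpar_of_long {i : Fin (rk m n + 1)} (h : S.src i = (S.tgt i).rev) :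
    S.vpar (S.src i) = 1 := by
  have hN := S.two_lt
  have ht : (S.tgt i : ℕ) = i := rfl
  have h' := congrArg Fin.val h
  rw [Fin.val_rev] at h'
  rcases S.node_cases i with ⟨h0, h1, h2⟩ | ⟨h0, h1, h2⟩ | ⟨h0, h2⟩ | ⟨h0, h0', h1, h2⟩ |
    ⟨h0, h0', h1, h2⟩
  · lia
  · rw [h, vpar_rev, vpar, ht, h0]
    exact h1
  · unfold rk at *; lia
  · unfold rk at *; lia
  · rw [vpar, h2]
    exact h1

end Setup
end

noncomputable section
set_option linter.unusedSectionVars false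

/-! ### The indeterminate is not a root of unity -/

theorem intDegree_qHalf_pow (k : ℕ) : (qHalf ^ k).intDegree = k := by
  induction k with
  | zero => simp
  | succ k ih =>
    have h := RatFunc.intDegree_mul (x := (RatFunc.X : RatFunc ℂ) ^ k)
      (pow_ne_zero _ RatFunc.X_ne_zero) RatFunc.X_ne_zero
    rw [pow_succ]
    refine h.trans ?_
    rw [show RatFunc.intDegree ((RatFunc.X : RatFunc ℂ) ^ k) = k from ih, RatFunc.intDegree_X]
    push_cast
    rfl

/-- The degree in the indeterminate forces the exponent to be zero, and $1\ne-1$. -/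
theorem qElt_zpow_ne_neg_one (k : ℤ) : qElt ^ k ≠ -1 := by
  have hdeg : ∀ k : ℕ, qElt ^ k = -1 → False := by
    intro k h
    have h1 := intDegree_qHalf_pow (2 * k)
    rw [pow_mul] at h1
    change (qElt ^ k).intDegree = _ at h1
    rw [h, RatFunc.intDegree_neg, RatFunc.intDegree_one] at h1
    have hk : k = 0 := by lia
    rw [hk, pow_zero] at h
    have h3 : (2 : GroundField) = 0 := by linear_combination h
    exact two_ne_zero h3
  intro h
  rcases Int.eq_nat_or_neg k with ⟨l, rfl | rfl⟩
  · exact hdeg l (by simpa using h)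
  · refine hdeg l ?_
    rw [zpow_neg, zpow_natCast] at h
    rw [← inv_inv (qElt ^ l), h]
    norm_num

theorem one_add_qElt_zpow_ne_zero (k : ℤ) : 1 + qElt ^ k ≠ 0 := fun h =>
  qElt_zpow_ne_neg_one k (by linear_combination h)

theorem qElt_sub_inv_ne_zero : qElt - qElt⁻¹ ≠ 0 := by
  have h0 := qElt_ne_zero
  intro h
  have h1 : qElt ^ 2 = 1 := by
    field_simp at h
    linear_combination h
  have h2 := intDegree_qHalf_pow 4
  rw [show (4 : ℕ) = 2 * 2 from rfl, pow_mul] at h2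
  change (qElt ^ 2).intDegree = _ at h2
  rw [h1, RatFunc.intDegree_one] at h2
  simp at h2

theorem qElt_add_inv_ne_zero : qElt + qElt⁻¹ ≠ 0 := by
  have h0 := qElt_ne_zero
  intro h
  apply one_add_qElt_zpow_ne_zero 2
  field_simp at h
  rw [zpow_ofNat]
  linear_combination h

/-- $q$-integers agree with integers in this range. This is why the undeformed matrices already
satisfy the quantum relations at all but long roots. -/
theorem qnum_of_abs_le_one {h : ℤ} (hh : h = -1 ∨ h = 0 ∨ h = 1) :
    (qElt - qElt⁻¹)⁻¹ * (qElt ^ h - qElt ^ (-h)) = h := by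
  have h0 := qElt_sub_inv_ne_zero
  have h1 : (qElt - qElt⁻¹)⁻¹ * (qElt - qElt⁻¹) = 1 := inv_mul_cancel₀ h0
  rcases hh with rfl | rfl | rfl
  · simp only [neg_neg, zpow_neg_one, zpow_one]
    push_cast
    linear_combination -h1
  · simp
  · simp only [zpow_neg_one, zpow_one]
    push_cast
    exact h1

theorem qnum_two : (qElt - qElt⁻¹)⁻¹ * (qElt ^ (2 : ℤ) - qElt ^ (-(2 : ℤ))) = qElt + qElt⁻¹ := by
  have h0 := qElt_sub_inv_ne_zero
  have h1 : (qElt - qElt⁻¹)⁻¹ * (qElt - qElt⁻¹) = 1 := inv_mul_cancel₀ h0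
  rw [zpow_neg, zpow_ofNat]
  linear_combination (qElt + qElt⁻¹) * h1

theorem qnum_neg_two :
    (qElt - qElt⁻¹)⁻¹ * (qElt ^ (-2 : ℤ) - qElt ^ (-(-2 : ℤ))) = -(qElt + qElt⁻¹) := by
  rw [← qnum_two, neg_neg]
  ring

/-! ### Operators supercommuting with all $f_j$ -/

namespace WeightRep

variable {I : Type} [DecidableEq I] {C : CartanDatum I} {ι : Type} [Fintype ι]
    [DecidableEq ι] {W : Type} [AddCommGroup W] (D : WeightRep C ι W)

/-- The operators `f j` move the basis vector `a` to a multiple of `b`. -/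
def Arrow (a b : ι) : Prop := ∃ j, D.f j b a ≠ 0

variable {D}

/-- As the weights are distinct, $f_jv_a$ is a nonzero multiple of $v_b$. If $M$ kills $v_a$, it
therefore kills $v_b$. -/
theorem column_step (hwt : Function.Injective D.wt) {w : List I} {M : Matrix ι ι GroundField}
    (hM : ∀ j, M * D.f j = wordSign C j w • (D.f j * M)) {a b : ι} (hab : D.Arrow a b)
    (ha : ∀ d, M d a = 0) (d : ι) : M d b = 0 := by
  obtain ⟨j, hj⟩ := hab
  have h1 := congrFun (congrFun (hM j) d) a
  rw [Matrix.mul_apply, Finset.sum_eq_single b, Matrix.smul_apply, Matrix.mul_apply,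
    Finset.sum_eq_zero (fun c _ => by rw [ha c, mul_zero]), smul_zero] at h1
  · exact (mul_eq_zero.1 h1).resolve_right hj
  · intro c _ hc
    rw [mul_eq_zero]
    right
    by_contra h
    exact hc (hwt (by
      have e1 := D.f_wt j c a h
      have e2 := D.f_wt j b a hj
      rw [← e2] at e1
      exact sub_left_injective e1))
  · simp

theorem column_reach (hwt : Function.Injective D.wt) {w : List I} {M : Matrix ι ι GroundField}
    (hM : ∀ j, M * D.f j = wordSign C j w • (D.f j * M)) {a b : ι}
    (hab : Relation.ReflTransGen D.Arrow a b) (ha : ∀ d, M d a = 0) (d : ι) : M d b = 0 := by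
  induction hab generalizing d with
  | refl => exact ha d
  | tail _ h ih => exact column_step hwt hM h ih d

theorem exists_column (hwt : Function.Injective D.wt) {w : List I} {M : Matrix ι ι GroundField}
    (hM : ∀ j, M * D.f j = wordSign C j w • (D.f j * M)) {a₀ : ι}
    (hreach : ∀ b, Relation.ReflTransGen D.Arrow a₀ b) (hM0 : M ≠ 0) {a : ι}
    (ha : Relation.ReflTransGen D.Arrow a a₀) : ∃ d, M d a ≠ 0 := by
  by_contra! h
  apply hM0
  ext d b
  exact column_reach hwt hM (ha.trans (hreach b)) h d

/-- An operator of weight zero is diagonal and its parity signs are trivial. Commuting with the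
arrows makes its entries equal along every path from `a₀`. -/
theorem scalar_of_rootSum_eq_zero (hwt : Function.Injective D.wt) {w : List I}
    {M : Matrix ι ι GroundField} (hMwt : ∀ a b, M a b ≠ 0 → D.wt a - D.wt b = D.rootSum w)
    (hM : ∀ j, M * D.f j = wordSign C j w • (D.f j * M)) {a₀ : ι}
    (hreach : ∀ b, Relation.ReflTransGen D.Arrow a₀ b) (h0 : D.rootSum w = 0) :
    ∃ r : GroundField, M = r • 1 := by
  have hdiag : ∀ a b, a ≠ b → M a b = 0 := by
    intro a b hab
    by_contra h
    have := hMwt a b h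
    rw [h0, sub_eq_zero] at this
    exact hab (hwt this)
  have hsign : ∀ j, wordSign C j w = 1 := by
    intro j
    have h1 := D.sum_parity w (C.parity j)
    rw [h0, map_zero, zero_mul] at h1
    rw [wordSign, paritySign_list_sum]
    simp only [mul_comm (C.parity j)]
    rw [h1]
    simp [paritySign]
  have hstep : ∀ a b, D.Arrow a b → M b b = M a a := by
    rintro a b ⟨j, hj⟩
    have h1 := congrFun (congrFun (hM j) b) a
    rw [hsign, one_smul, Matrix.mul_apply, Matrix.mul_apply, Finset.sum_eq_single b,
      Finset.sum_eq_single a, mul_comm] at h1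
    · exact mul_left_cancel₀ hj h1
    · intro c _ hc
      rw [hdiag c a hc, mul_zero]
    · simp
    · intro c _ hc
      rw [hdiag b c hc.symm, zero_mul]
    · simp
  have hall : ∀ b, M b b = M a₀ a₀ := by
    intro b
    induction hreach b with
    | refl => rfl
    | tail _ h ih => rw [hstep _ _ h, ih]
  refine ⟨M a₀ a₀, ?_⟩
  ext a b
  by_cases hab : a = b
  · subst hab
    simp [hall a]
  · simp [hdiag a b hab, hab]

/-- By strong connectivity a nonzero $M$ has no zero column, so translation by its weight permutes
the finite set of weights. Summing all weights shows that a positive multiple of the translation is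
zero. -/
theorem rootSum_eq_zero_of_connected [IsAddTorsionFree W] (hwt : Function.Injective D.wt)
    {w : List I} {M : Matrix ι ι GroundField}
    (hMwt : ∀ a b, M a b ≠ 0 → D.wt a - D.wt b = D.rootSum w)
    (hM : ∀ j, M * D.f j = wordSign C j w • (D.f j * M)) {a₀ : ι}
    (hreach : ∀ b, Relation.ReflTransGen D.Arrow a₀ b)
    (hreach' : ∀ b, Relation.ReflTransGen D.Arrow b a₀) (hM0 : M ≠ 0) : D.rootSum w = 0 := by
  choose d hd using fun a => exists_column hwt hM hreach hM0 (hreach' a)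
  have hd' : ∀ a, D.wt (d a) = D.wt a + D.rootSum w := fun a => by
    rw [← hMwt _ _ (hd a)]; abel
  have hinj : Function.Injective d := by
    intro a b hab
    have := hd' a
    rw [hab, hd' b] at this
    exact (hwt (add_right_cancel this)).symm
  have hbij : Function.Bijective d := Finite.injective_iff_bijective.1 hinj
  have hsum := Function.Bijective.sum_comp hbij D.wt
  simp only [hd', Finset.sum_add_distrib, Finset.sum_const, Finset.card_univ] at hsum
  have h1 : Fintype.card ι • D.rootSum w = 0 := by simpa using hsum
  have : Nonempty ι := ⟨a₀⟩
  exact (smul_eq_zero.1 h1).resolve_left Fintype.card_ne_zero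

end WeightRep

namespace Setup

variable {m n : ℕ} (S : Setup m n)

/-! ### The operators of the Chevalley generators -/

/-- The coefficient of `e_i` with respect to `X_{ab}`. -/
def eCoef (a u : GroundField) (i : Fin (rk m n + 1)) : GroundField :=
  (if (i : ℕ) = 0 then a * u else 1) * (if S.src i = (S.tgt i).rev then 2⁻¹ else 1)

/-- The coefficient of `f_i` with respect to `X_{ba}`. -/
def fCoef (b u : GroundField) (i : Fin (rk m n + 1)) : GroundField :=
  if (i : ℕ) = 0 then b * u⁻¹ * (if S.src i = (S.tgt i).rev then 2⁻¹ else 1)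
  else if S.src i = (S.tgt i).rev then -(qElt + qElt⁻¹) / 2
  else (paritySign (S.vpar (S.src i)) : GroundField)

/-- The operator of `e_i`. -/
def opE (a u : GroundField) (i : Fin (rk m n + 1)) : Mat m n GroundField :=
  S.eCoef a u i • S.Y GroundField (S.src i) (S.tgt i)

/-- The operator of `f_i`. -/
def opF (b u : GroundField) (i : Fin (rk m n + 1)) : Mat m n GroundField :=
  S.fCoef b u i • S.Y GroundField (S.tgt i) (S.src i)

variable {S} {u a b : GroundField}

theorem eCoef_ne_zero (hu : u ≠ 0) (ha : a ≠ 0) (i : Fin (rk m n + 1)) : S.eCoef a u i ≠ 0 := by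
  unfold eCoef
  split_ifs <;> simp [hu, ha]

theorem fCoef_ne_zero (hu : u ≠ 0) (hb : b ≠ 0) (i : Fin (rk m n + 1)) : S.fCoef b u i ≠ 0 := by
  unfold fCoef
  split_ifs
  · simp [hu, hb]
  · simp [hu, hb]
  · exact div_ne_zero (neg_ne_zero.2 qElt_add_inv_ne_zero) two_ne_zero
  · exact paritySign_ne_zero _

/-- The only place where the normalization of $ab$ is used: it gives the affine node the same
product of coefficients as the finite nodes. The denominator $4$ undoes the factors $2$ of `Y_long`
in $e_i$ and $f_i$. -/
theorem eCoef_mul_fCoef (hu : u ≠ 0) (hab_odd : S.par 1 = 1 → a * b = -(qElt + qElt⁻¹))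
    (hab_even : S.par 1 = 0 → a * b = (S.psign 2 : GroundField)) (i : Fin (rk m n + 1)) :
    S.eCoef a u i * S.fCoef b u i = if S.src i = (S.tgt i).rev then -(qElt + qElt⁻¹) / 4
      else (paritySign (S.vpar (S.src i)) : GroundField) := by
  have hN := S.two_lt
  have ht : (S.tgt i : ℕ) = i := rfl
  unfold eCoef fCoef
  by_cases h0 : (i : ℕ) = 0
  · by_cases hl : S.src i = (S.tgt i).rev
    · have h1 : S.par 1 = 1 := by
        have := vpar_of_long S hl
        rw [hl, vpar_rev, vpar, ht, h0] at this
        exact this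
      simp only [h0, hl, if_true]
      have := hab_odd h1
      have huu : u * u⁻¹ = 1 := mul_inv_cancel₀ hu
      have h22 : (2 : GroundField)⁻¹ * 2⁻¹ = 4⁻¹ := by norm_num
      calc a * u * 2⁻¹ * (b * u⁻¹ * 2⁻¹) = (a * b) * (u * u⁻¹) * (2⁻¹ * 2⁻¹) := by ring
        _ = _ := by rw [this, huu, h22, mul_one, div_eq_mul_inv]
    · have h1 : S.par 1 = 0 ∧ (S.src i : ℕ) + 2 = m + n := by
        rcases S.node_cases i with h | h | h | h | h
        · exact h.2
        · exfalso
          apply hl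
          rw [Fin.ext_iff, Fin.val_rev]
          lia
        all_goals
          exfalso
          unfold rk at h
          lia
      have h2 : S.vpar (S.src i) = S.par 2 := by
        rw [← vpar_rev, vpar, Fin.val_rev]
        congr 1
        lia
      simp only [h0, hl, if_true, if_false, mul_one]
      have := hab_even h1.1
      have huu : u * u⁻¹ = 1 := mul_inv_cancel₀ hu
      rw [h2]
      calc a * u * (b * u⁻¹) = (a * b) * (u * u⁻¹) := by ring
        _ = _ := by rw [this, huu, mul_one]; rfl
  · by_cases hl : S.src i = (S.tgt i).rev
    · simp only [h0, hl, if_true, if_false]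
      ring
    · simp only [h0, hl, if_false, mul_one, one_mul]

theorem commutator_self (hu : u ≠ 0) (hab_odd : S.par 1 = 1 → a * b = -(qElt + qElt⁻¹))
    (hab_even : S.par 1 = 0 → a * b = (S.psign 2 : GroundField)) (i : Fin (rk m n + 1)) :
    S.opE a u i * S.opF b u i -
      (paritySign (S.affDatum.parity i * S.affDatum.parity i) : GroundField) •
        (S.opF b u i * S.opE a u i) =
    (qElt - qElt⁻¹)⁻¹ •
      (Matrix.diagonal (fun c => qElt ^ S.pairHom (S.alphaHat i).2 (S.wt c)) -
        Matrix.diagonal (fun c => qElt ^ (-S.pairHom (S.alphaHat i).2 (S.wt c)))) := by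
  have hne := S.src_ne_tgt i
  have hc := eCoef_mul_fCoef hu hab_odd hab_even i
  have hsq : ∀ p : ZMod 2, p * p = p := by decide
  rw [hsq, affDatum_parity]
  have e1 : S.opE a u i * S.opF b u i -
      (paritySign (S.vpar (S.src i) + S.vpar (S.tgt i)) : GroundField) •
        (S.opF b u i * S.opE a u i) = (S.eCoef a u i * S.fCoef b u i) •
      (S.Y GroundField (S.src i) (S.tgt i) * S.Y GroundField (S.tgt i) (S.src i) -
      (paritySign (S.vpar (S.src i) + S.vpar (S.tgt i)) : GroundField) •
        (S.Y GroundField (S.tgt i) (S.src i) * S.Y GroundField (S.src i) (S.tgt i))) := by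
    simp only [opE, opF, smul_mul_assoc, mul_smul_comm, smul_sub, smul_smul]
    congr 2 <;> ring
  have hform : ∀ c, S.pairHom (S.alphaHat i).2 (S.wt c) =
      paritySign (S.vpar (S.src i)) *
        ((if S.src i = c then 1 else 0) - (if S.src i = c.rev then 1 else 0)) -
      paritySign (S.vpar (S.tgt i)) *
        ((if S.tgt i = c then 1 else 0) - (if S.tgt i = c.rev then 1 else 0)) := by
    intro c
    rw [alphaHat_eq, map_sub, AddMonoidHom.sub_apply, pairHom_apply, pairHom_apply, pairP_wt,
      pairP_wt]
  rw [e1, hc]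
  -- At a long root the exponents of $q$ are $-2$, $2$ or $0$, and the coefficients supply $[2]_q$.
  -- At any other root the exponents lie in $\{-1,0,1\}$ and no deformation is visible.
  by_cases hl : S.src i = (S.tgt i).rev
  · rw [if_pos hl]
    have hx := S.vpar_of_long hl
    have hy : S.vpar (S.tgt i) = 1 := by rw [← vpar_rev, ← hl, hx]
    have ht : S.tgt i = (S.src i).rev := by rw [hl, Fin.rev_rev]
    have e2 := S.Y_long GroundField hx
    have e3 := S.Y_long GroundField hy
    rw [← ht] at e2
    rw [← hl] at e3
    rw [e2, e3, hx, hy]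
    ext c d
    simp only [smul_mul_assoc, mul_smul_comm, single_mul_single', if_true, Matrix.smul_apply,
      Matrix.sub_apply, Matrix.single_apply, Matrix.diagonal_apply, smul_eq_mul, hform, hx, hy]
    have hp1 : paritySign (1 : ZMod 2) = -1 := rfl
    have hp2 : paritySign (1 + 1 : ZMod 2) = 1 := rfl
    rw [hp1, hp2]
    by_cases hcd : c = d
    · subst hcd
      have f1 : S.src i = c.rev ↔ S.tgt i = c := by
        rw [hl, Fin.rev_inj]
      have f2 : S.tgt i = c.rev ↔ S.src i = c := by
        rw [ht, Fin.rev_inj]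
      simp only [and_self, if_true, f1, f2]
      by_cases h1 : S.src i = c
      · have h2 : S.tgt i ≠ c := fun h => hne (h1.trans h.symm)
        simp only [h1, h2, if_true, if_false]
        have := qnum_neg_two
        norm_num at this ⊢
        rw [this]
      · by_cases h2 : S.tgt i = c
        · simp only [h1, h2, if_true, if_false]
          have := qnum_two
          norm_num at this ⊢
          rw [this]
        · simp [h1, h2]
    · have f1 : ∀ z, ¬ (z = c ∧ z = d) := by
        rintro z ⟨rfl, rfl⟩; exact hcd rfl
      simp [f1, hcd]
  · rw [if_neg hl, S.Y_commutator_diagonal GroundField hl]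
    ext c d
    simp only [Matrix.smul_apply, Matrix.sub_apply, Matrix.diagonal_apply, smul_eq_mul]
    by_cases hcd : c = d
    · subst hcd
      simp only [if_true]
      rw [qnum_of_abs_le_one, hform]
      · rw [paritySign_add_int]
        have := paritySign_self (S.vpar (S.src i))
        have h1 : (paritySign (S.vpar (S.src i)) : GroundField) *
            paritySign (S.vpar (S.src i)) = 1 := by exact_mod_cast this
        push_cast
        linear_combination (-(paritySign (S.vpar (S.tgt i)) : GroundField) *
          ((if S.tgt i = c then 1 else 0) - (if S.tgt i = c.rev then 1 else 0))) * h1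
      · rw [hform]
        -- A basis vector belongs to at most one of the mirror pairs of source and target, so the
        -- two contributions to the exponent never add.
        have hcases : ∀ z z' : Fin (m + n), z ≠ z' → z ≠ z'.rev →
            ((if z = c then 1 else 0) - (if z = c.rev then 1 else 0) : ℤ) = 0 ∨
            ((if z' = c then 1 else 0) - (if z' = c.rev then 1 else 0) : ℤ) = 0 := by
          intro z z' h1 h2
          by_cases h3 : z = c
          · subst h3
            right
            rw [if_neg h1.symm, if_neg, sub_self]
            rintro rfl
            simp at h2
          · by_cases h4 : z = c.rev
            · subst h4
              right
              rw [if_neg, if_neg h1.symm, sub_self]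
              rintro rfl
              exact h2 rfl
            · left
              rw [if_neg h3, if_neg h4, sub_self]
        have hval : ∀ z : Fin (m + n),
            ((if z = c then 1 else 0) - (if z = c.rev then 1 else 0) : ℤ) = -1 ∨
            ((if z = c then 1 else 0) - (if z = c.rev then 1 else 0) : ℤ) = 0 ∨
            ((if z = c then 1 else 0) - (if z = c.rev then 1 else 0) : ℤ) = 1 := by
          intro z
          split_ifs <;> simp
        have hps : ∀ p : ZMod 2, paritySign p = 1 ∨ paritySign p = -1 := by decide
        have hx := hps (S.vpar (S.src i))
        have hy := hps (S.vpar (S.tgt i))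
        have v1 := hval (S.src i)
        have v2 := hval (S.tgt i)
        rcases hcases _ _ hne hl with h1 | h1 <;> rw [h1]
        · rcases hy with hy | hy <;> rw [hy] <;> lia
        · rcases hx with hx | hx <;> rw [hx] <;> lia
    · simp [hcd]

end Setup
end

noncomputable section
set_option linter.unusedSectionVars false

namespace Setup

variable {m n : ℕ} {S : Setup m n} {u a b : GroundField}

/-! ### Commutation of `e_i` and `f_j` -/

theorem tgt_injective : Function.Injective S.tgt := fun _ _ h =>
  Fin.ext (by simpa [tgt] using h)

/-- The pairs of distinct nodes for which products of `e_i` and `f_j` need not vanish. -/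
theorem node_pair_cases {i j : Fin (rk m n + 1)} (hij : i ≠ j) :
    (S.tgt i ≠ S.tgt j ∧ S.tgt i ≠ (S.src j).rev ∧ (S.src i).rev ≠ S.tgt j ∧ S.src i ≠ S.src j) ∨
    (S.src i = S.src j ∧ S.tgt j = (S.tgt i).rev ∧ S.vpar (S.tgt i) = 0 ∧
      S.src i ≠ (S.tgt i).rev) ∨
    (S.src i = (S.tgt j).rev ∧ S.src j = S.tgt i ∧ S.vpar (S.tgt i) = 0 ∧
      S.tgt i ≠ (S.tgt j).rev ∧ S.tgt i ≠ (S.tgt i).rev) ∨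
    (S.src j = (S.tgt i).rev ∧ S.src i = S.tgt j ∧ S.vpar (S.tgt j) = 0 ∧
      S.tgt j ≠ (S.tgt i).rev ∧ S.tgt j ≠ (S.tgt j).rev) := by
  have hN := S.two_lt
  have hti : (S.tgt i : ℕ) = i := rfl
  have htj : (S.tgt j : ℕ) = j := rfl
  have hij' : (i : ℕ) ≠ j := fun h => hij (Fin.ext h)
  have hi := i.2
  have hj := j.2
  simp only [ne_eq, Fin.ext_iff, Fin.val_rev, hti, htj]
  rcases S.node_cases i with hi' | hi' | hi' | hi' | hi' <;>
  rcases S.node_cases j with hj' | hj' | hj' | hj' | hj'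
  -- The affine node with $v_1$ even interacts only with node $1$. The next case is the same pair in
  -- the other order.
  case inl.inr.inr.inl =>
    by_cases h1 : (j : ℕ) = 1
    · right; right; left
      refine ⟨by lia, by lia, ?_, by lia, by lia⟩
      rw [vpar, hti, hi'.1]; exact hi'.2.1
    · left; unfold rk at *; lia
  case inr.inr.inl.inl =>
    by_cases h1 : (i : ℕ) = 1
    · right; right; right
      refine ⟨by lia, by lia, ?_, by lia, by lia⟩
      rw [vpar, htj, hj'.1]; exact hj'.2.1
    · left; unfold rk at *; lia
  -- The fork at the finite end pairs node $s$ with node $s-1$. The next case is the same pair in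
  -- the other order.
  case inr.inr.inl.inr.inr.inr.inl =>
    by_cases h1 : (i : ℕ) + 1 = rk m n
    · right; left
      refine ⟨by lia, by unfold rk at *; lia, ?_, by unfold rk at *; lia⟩
      rw [vpar, hti, h1]; exact hj'.2.2.1
    · left; unfold rk at *; lia
  case inr.inr.inr.inl.inr.inr.inl =>
    by_cases h1 : (j : ℕ) + 1 = rk m n
    · right; left
      refine ⟨by lia, by unfold rk at *; lia, ?_, by unfold rk at *; lia⟩
      have : S.tgt i = (S.tgt j).rev := by
        simp only [Fin.ext_iff, Fin.val_rev, hti, htj]; unfold rk at *; lia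
      rw [this, vpar_rev, vpar, htj, h1]; exact hi'.2.2.1
    · left; unfold rk at *; lia
  all_goals
    left
    unfold rk at *
    lia

theorem commutator_of_ne {i j : Fin (rk m n + 1)} (hij : i ≠ j) :
    S.opE a u i * S.opF b u j -
      (paritySign (S.affDatum.parity i * S.affDatum.parity j) : GroundField) •
        (S.opF b u j * S.opE a u i) = 0 := by
  have key : S.Y GroundField (S.src i) (S.tgt i) * S.Y GroundField (S.tgt j) (S.src j) -
      (paritySign ((S.vpar (S.src i) + S.vpar (S.tgt i)) * (S.vpar (S.src j) + S.vpar (S.tgt j))) :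
        GroundField) •
        (S.Y GroundField (S.tgt j) (S.src j) * S.Y GroundField (S.src i) (S.tgt i)) = 0 := by
    rcases S.node_pair_cases hij with h | h | h | h
    · rw [Y_mul_eq_zero _ _ h.1 h.2.1 h.2.2.1 h.2.2.2, Y_mul_eq_zero _ _ h.2.2.2.symm
        (rev_ne h.2.1).symm (fun h' => h.2.2.1 (by rw [← h', Fin.rev_rev])) h.1.symm,
        smul_zero, sub_zero]
    · rw [← h.1, h.2.1]
      refine S.Y_commutator_source _ (S.src_ne_tgt i) h.2.2.2 ?_ h.2.2.1
      rw [← h.2.1]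
      exact fun h' => hij (tgt_injective h')
    · rw [h.1, h.2.1, add_comm (S.vpar (S.tgt i)) (S.vpar (S.tgt j)), add_comm (S.vpar _) (S.vpar (S.tgt i))]
      have := S.Y_commutator_target GroundField (w := S.tgt i) (z := S.tgt j)
        (fun h' => hij (tgt_injective h')) h.2.2.2.1 h.2.2.2.2 h.2.2.1
      simpa only [add_comm] using this
    · rw [h.1, h.2.1]
      exact S.Y_commutator_target' GroundField (w := S.tgt j) (z := S.tgt i)
        (fun h' => hij (tgt_injective h').symm) h.2.2.2.1 h.2.2.2.2 h.2.2.1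
  rw [affDatum_parity, affDatum_parity, opE, opF]
  simp only [smul_mul_assoc, mul_smul_comm, smul_smul]
  rw [← smul_zero (S.eCoef a u i * S.fCoef b u j), ← key, smul_sub, smul_smul]
  congr 2 <;> ring

theorem opE_wt (i : Fin (rk m n + 1)) (c d : Fin (m + n)) (h : S.opE a u i c d ≠ 0) :
    S.wt c - S.wt d = S.wt (S.src i) - S.wt (S.tgt i) ∧
      S.vpar c + S.vpar d = S.vpar (S.src i) + S.vpar (S.tgt i) := by
  rw [opE, Matrix.smul_apply] at h
  exact S.Y_wt _ _ _ _ _ (right_ne_zero_of_mul h)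

theorem opF_wt (i : Fin (rk m n + 1)) (c d : Fin (m + n)) (h : S.opF b u i c d ≠ 0) :
    S.wt c - S.wt d = S.wt (S.tgt i) - S.wt (S.src i) ∧
      S.vpar c + S.vpar d = S.vpar (S.tgt i) + S.vpar (S.src i) := by
  rw [opF, Matrix.smul_apply] at h
  exact S.Y_wt _ _ _ _ _ (right_ne_zero_of_mul h)

/-- The natural module as a weight representation. -/
def naturalRep (S : Setup m n) (hu : u ≠ 0) (hab_odd : S.par 1 = 1 → a * b = -(qElt + qElt⁻¹))
    (hab_even : S.par 1 = 0 → a * b = (S.psign 2 : GroundField)) :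
    WeightRep S.affDatum (Fin (m + n)) (Fin (rk m n) → ℤ) where
  e := S.opE a u
  f := S.opF b u
  wt := S.wt
  root i := (S.alphaHat i).2
  form := S.pairHom
  parW := S.parityHom
  par := S.vpar
  pairing_eq _ _ := rfl
  pairing_comm := S.affDatum_pairing_comm
  parity_eq _ := rfl
  e_wt i c d h := by rw [alphaHat_eq]; exact (opE_wt i c d h).1
  f_wt i c d h := by rw [alphaHat_eq, neg_sub]; exact (opF_wt i c d h).1
  e_par i c d h := by rw [affDatum_parity]; exact (opE_wt i c d h).2
  e_f i j := by
    split_ifs with hij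
    · subst hij
      exact commutator_self hu hab_odd hab_even i
    · exact commutator_of_ne hij

/-! ### The crossing symmetry -/

/-- The partial sums of the signs `(-1)^{|v_j|}`. -/
def signSum (S : Setup m n) (k : ℕ) : ℤ := ∑ j ∈ Finset.range k, S.psign (j + 1)

/-- The exponent of `q` that is conjugate to its negative under the crossing symmetry. -/
def crossLevel (S : Setup m n) : ℤ := 2 * S.signSum (rk m n) - 1 + ((m + n) % 2 : ℕ)

/-- The exponents of `q` in the crossing symmetry. -/
def crossExp (S : Setup m n) (c : Fin (m + n)) : ℤ :=
  if (c : ℕ) < rk m n then S.signSum (c + 1) else S.crossLevel - S.signSum c.rev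

/-- The exponents on mirror vectors are tied together up to a sign term. This lets the second
crossing equation be deduced from the first. -/
theorem crossExp_add_rev (c : Fin (m + n)) : S.crossExp c + S.crossExp c.rev =
    S.crossLevel + paritySign (S.vpar c) * (if c = c.rev then 0 else 1) := by
  have hr : ∀ c : Fin (m + n), (c : ℕ) < rk m n → S.crossExp c + S.crossExp c.rev =
      S.crossLevel + paritySign (S.vpar c) := by
    intro c hc
    have h2 : ¬ (c.rev : ℕ) < rk m n := by rw [Fin.val_rev]; unfold rk at *; lia
    rw [crossExp, crossExp, if_pos hc, if_neg h2, Fin.rev_rev, signSum, signSum,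
      Finset.sum_range_succ]
    change _ + paritySign (S.vpar c) + _ = _
    ring
  rcases val_trichotomy c with h | h | ⟨h, h'⟩
  · rw [hr c h, if_neg, mul_one]
    intro h'
    have := congrArg Fin.val h'
    rw [Fin.val_rev] at this
    unfold rk at *; lia
  · have := hr c.rev h
    rw [Fin.rev_rev, vpar_rev] at this
    rw [add_comm, this, if_neg, mul_one]
    intro h'
    have := congrArg Fin.val h'
    rw [Fin.val_rev] at *
    unfold rk at *; lia
  · rw [h, if_pos rfl, crossExp, if_neg h', h, crossLevel]
    have h1 := congrArg Fin.val h
    rw [Fin.val_rev] at h1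
    have h2 : (c : ℕ) = rk m n := by unfold rk; lia
    have h3 : (m + n) % 2 = 1 := by lia
    rw [h2, h3]
    push_cast
    ring

/-- The exponents of the rescaling in the crossing symmetry. -/
def crossShift (S : Setup m n) (i : Fin (rk m n + 1)) : ℤ :=
  if (i : ℕ) = 0 then 1 - S.crossLevel else 0

/-- The crossing equation on exponents of $q$. Along consecutive weights it is the recursion of the
partial sums; at node $s$ it holds by the choice of `crossLevel`. Nothing is left to adjust at the
affine node, which gets the shift. -/
theorem crossExp_src (i : Fin (rk m n + 1)) :
    S.pairHom (S.alphaHat i).2 (S.wt (S.tgt i)) + S.crossExp (S.tgt i) =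
      S.crossShift i + S.crossExp (S.src i) := by
  have hN := S.two_lt
  have hti : (S.tgt i : ℕ) = i := rfl
  have hf : S.pairHom (S.alphaHat i).2 (S.wt (S.tgt i)) =
      -paritySign (S.vpar (S.src i)) * (if S.src i = (S.tgt i).rev then 1 else 0) -
      paritySign (S.vpar (S.tgt i)) * (if S.tgt i = (S.tgt i).rev then 0 else 1) := by
    rw [alphaHat_eq, map_sub, AddMonoidHom.sub_apply, pairHom_apply, pairHom_apply, pairP_wt,
      pairP_wt, if_neg (S.src_ne_tgt i), if_pos rfl]
    split_ifs <;> ring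
  have hi := i.2
  have hx : ∀ k, (S.src i : ℕ) + 1 = k → S.psign k = paritySign (S.vpar (S.src i)) := by
    rintro _ rfl; rfl
  have hT : ∀ k, S.signSum (k + 1) = S.signSum k + S.psign (k + 1) := fun k =>
    Finset.sum_range_succ _ _
  have hT0 : S.signSum 0 = 0 := rfl
  have hp0 : ∀ k, S.par k = 0 → S.psign k = 1 := fun k h => by rw [psign, h]; rfl
  have hp1 : ∀ k, S.par k = 1 → S.psign k = -1 := fun k h => by rw [psign, h]; rfl
  have hy : ∀ k, (S.tgt i : ℕ) + 1 = k → paritySign (S.vpar (S.tgt i)) = S.psign k := by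
    rintro _ rfl; rfl
  have hy' : ∀ k, ((S.tgt i).rev : ℕ) + 1 = k → paritySign (S.vpar (S.tgt i)) = S.psign k := by
    rintro _ rfl; rw [← vpar_rev]; rfl
  rw [hf, crossExp, crossExp, crossShift]
  simp only [Fin.ext_iff, Fin.val_rev] at hy' ⊢
  rcases S.node_cases i with ⟨h0, h1, h2⟩ | ⟨h0, h1, h2⟩ | ⟨h0, h2⟩ | ⟨h0, h0', h1, h2⟩ |
    ⟨h0, h0', h1, h2⟩
  · rw [if_neg (by lia), if_neg (by lia), if_pos (by unfold rk at *; lia), if_pos h0,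
      if_neg (by unfold rk at *; lia), hy 1 (by lia),
      show m + n - ((S.src i : ℕ) + 1) = 1 by lia, show (S.tgt i : ℕ) = 0 by lia, hT, hT0,
      hp0 _ h1]
    ring
  · rw [if_pos (by lia), if_neg (by lia), if_pos (by unfold rk at *; lia), if_pos h0,
      if_neg (by unfold rk at *; lia), hy 1 (by lia), ← S.vpar_rev (S.src i),
      show (S.src i).rev = S.tgt i from Fin.ext (by rw [Fin.val_rev]; lia), hy 1 (by lia),
      show m + n - ((S.src i : ℕ) + 1) = 0 by lia, show (S.tgt i : ℕ) = 0 by lia, hT, hT0,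
      hp1 _ h1]
    ring
  · by_cases h3 : (i : ℕ) < rk m n
    · rw [if_neg (by unfold rk at *; lia), if_neg (by unfold rk at *; lia),
        if_pos (by lia), if_neg (by lia), if_pos (by lia), hy _ rfl, h2, hti, hT]
      ring
    -- Node $s$ for odd $N$: the target is the middle vector of weight zero, and the parity term in
    -- `crossLevel` compensates for the missing sign.
    · rw [if_neg (by unfold rk at *; lia), if_pos (by unfold rk at *; lia),
        if_neg (by lia), if_neg (by lia), if_pos (by lia), h2,
        show m + n - ((S.tgt i : ℕ) + 1) = rk m n by unfold rk at *; lia,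
        show (i : ℕ) = rk m n by lia, crossLevel, show (m + n) % 2 = 1 by lia]
      push_cast
      ring
  · obtain ⟨k, hk⟩ : ∃ k, rk m n = k + 2 := ⟨rk m n - 2, by lia⟩
    rw [hk] at h1
    rw [if_neg (by unfold rk at *; lia), if_neg (by unfold rk at *; lia),
      if_neg (by lia), if_neg (by unfold rk at *; lia), if_pos (by lia),
      show m + n - ((S.tgt i : ℕ) + 1) = k + 1 by unfold rk at *; lia,
      show (S.src i : ℕ) + 1 = k + 1 by lia, hy' (k + 2) (by unfold rk at *; lia), crossLevel, hk,
      h0, hT (k + 1), hp0 _ h1]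
    push_cast
    ring
  · obtain ⟨k, hk⟩ : ∃ k, rk m n = k + 1 := ⟨rk m n - 1, by unfold rk at *; lia⟩
    rw [hk] at h1
    rw [if_pos (by unfold rk at *; lia), if_neg (by unfold rk at *; lia),
      if_neg (by lia), if_neg (by unfold rk at *; lia), if_pos (by lia),
      show m + n - ((S.tgt i : ℕ) + 1) = k by unfold rk at *; lia,
      show (S.src i : ℕ) + 1 = k + 1 by lia, hy' (k + 1) (by unfold rk at *; lia), crossLevel, hk,
      h0, hT k, ← hx (k + 1) (by lia), hp1 _ h1]
    push_cast
    ring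

theorem crossExp_tgt (i : Fin (rk m n + 1)) :
    -S.pairHom (S.alphaHat i).2 (S.wt (S.src i)) + S.crossExp (S.src i).rev =
      S.crossShift i + S.crossExp (S.tgt i).rev := by
  have h1 := S.crossExp_src i
  have h2 := S.crossExp_add_rev (S.src i)
  have h3 := S.crossExp_add_rev (S.tgt i)
  rw [alphaHat_eq, map_sub, AddMonoidHom.sub_apply, pairHom_apply, pairHom_apply, pairP_wt,
      pairP_wt] at *
  rw [if_pos rfl, if_neg (S.src_ne_tgt i).symm] at *
  rw [if_neg (S.src_ne_tgt i)] at h1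
  have h4 : S.tgt i = (S.src i).rev ↔ S.src i = (S.tgt i).rev := by
    constructor <;> intro h <;> rw [h, Fin.rev_rev]
  simp only [h4]
  by_cases h5 : S.src i = (S.tgt i).rev
  · have h6 : paritySign (S.vpar (S.src i)) = paritySign (S.vpar (S.tgt i)) := by
      rw [h5, vpar_rev]
    rw [if_pos h5] at *
    rw [h6] at h1 h2 ⊢
    split_ifs at * <;> linarith
  · rw [if_neg h5] at *
    split_ifs at * <;> linarith

/-- The nonzero entries of the crossing symmetry. -/
def crossEntry (S : Setup m n) (c : Fin (m + n)) : GroundField :=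
  (paritySign (S.vpar c) * S.vsgn c : ℤ) * qElt ^ S.crossExp c

theorem crossEntry_ne_zero (c : Fin (m + n)) : S.crossEntry c ≠ 0 := by
  refine mul_ne_zero (Int.cast_ne_zero.2 (mul_ne_zero ?_ ?_)) (zpow_ne_zero _ qElt_ne_zero)
  · intro h
    have := paritySign_self (S.vpar c)
    simp [h] at this
  · intro h
    have := S.vsgn_mul_self c
    simp [h] at this

theorem xsign_sign_src (x y : Fin (m + n)) :
    S.xsign x y * (paritySign ((S.vpar x + S.vpar y) * S.vpar y) *
      (paritySign (S.vpar y) * S.vsgn y)) = paritySign (S.vpar x) * S.vsgn x := by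
  have h : ∀ p r : ZMod 2, paritySign (p * (p + r)) * paritySign ((p + r) * r) * paritySign r =
      paritySign p := by decide
  rw [xsign]
  linear_combination (S.vsgn x * (S.vsgn y * S.vsgn y)) * h (S.vpar x) (S.vpar y) +
    paritySign (S.vpar x) * S.vsgn x * S.vsgn_mul_self y

theorem xsign_sign_tgt (x y : Fin (m + n)) :
    paritySign ((S.vpar x + S.vpar y) * S.vpar x) *
      (paritySign (S.vpar x.rev) * S.vsgn x.rev) =
    S.xsign x y * (paritySign (S.vpar y.rev) * S.vsgn y.rev) := by
  rw [xsign, vpar_rev, vpar_rev, vsgn_rev, vsgn_rev, mul_comm (S.vpar x + S.vpar y)]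
  have h1 := paritySign_self (S.vpar x)
  have h2 := paritySign_self (S.vpar y)
  linear_combination (paritySign (S.vpar x * (S.vpar x + S.vpar y)) * S.vsgn x) *
    (h1 - h2 - paritySign (S.vpar y) * paritySign (S.vpar y) * S.vsgn_mul_self y)

/-- The crossing symmetry of the natural module. -/
def naturalCrossing (S : Setup m n) (hu : u ≠ 0)
    (hab_odd : S.par 1 = 1 → a * b = -(qElt + qElt⁻¹))
    (hab_even : S.par 1 = 0 → a * b = (S.psign 2 : GroundField)) :
    (S.naturalRep hu hab_odd hab_even).Crossing where
  G := Matrix.of fun c d => if c = d.rev then S.crossEntry d else 0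
  Ginv := Matrix.of fun c d => if c = d.rev then (S.crossEntry c)⁻¹ else 0
  mul_inv := by
    ext c d
    rw [Matrix.mul_apply, Finset.sum_eq_single d.rev]
    · by_cases h : c = d
      · subst h
        simp [crossEntry_ne_zero]
      · simp [h]
    · intro e _ he
      simp [he]
    · simp
  scale i := qElt ^ S.crossShift i
  transpose_mul i := by
    have hG : ∀ x y : Fin (m + n), (Matrix.single y x 1 : Mat m n GroundField) *
        Matrix.of (fun c d => if c = d.rev then S.crossEntry d else 0) =
        S.crossEntry x.rev • Matrix.single y x.rev 1 := by
      intro x y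
      ext c d
      rw [Matrix.mul_apply, Finset.sum_eq_single x]
      · have h1 : x = d.rev ↔ x.rev = d := by
          constructor <;> intro h
          · rw [h, Fin.rev_rev]
          · rw [← h, Fin.rev_rev]
        by_cases h : x.rev = d
        · simp [Matrix.single_apply, h1, h, mul_comm]
        · simp [Matrix.single_apply, h1, h]
      · intro e _ he
        simp [he.symm]
      · simp
    have hG' : ∀ x y : Fin (m + n),
        (Matrix.of (fun c d => if c = d.rev then S.crossEntry d else 0) : Mat m n GroundField) *
        Matrix.single x y 1 = S.crossEntry x • Matrix.single x.rev y 1 := by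
      intro x y
      ext c d
      rw [Matrix.mul_apply, Finset.sum_eq_single x]
      · simp only [Matrix.of_apply, Matrix.single_apply, Matrix.smul_apply, smul_eq_mul, true_and]
        by_cases h : c = x.rev
        · simp [h]
        · simp [h, Ne.symm h]
      · intro e _ he
        simp [he.symm]
      · simp
    have hD : ∀ (g : Fin (m + n) → GroundField) (x y : Fin (m + n)),
        Matrix.diagonal g * Matrix.single x y 1 = g x • Matrix.single x y 1 := by
      intro g x y
      ext c d
      rw [Matrix.diagonal_mul, Matrix.smul_apply, Matrix.single_apply]
      by_cases h : x = c ∧ y = d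
      · simp [h.1]
      · simp [h]
    have hform : ∀ x, S.pairHom (S.alphaHat i).2 (S.wt x.rev) =
        -S.pairHom (S.alphaHat i).2 (S.wt x) := fun x => by rw [wt_rev, map_neg]
    set B := (S.naturalRep hu hab_odd hab_even).braidDiag i with hB
    have hBx : ∀ x, (B x)⁻¹ = qElt ^ (-S.pairHom (S.alphaHat i).2 (S.wt x)) *
        (paritySign ((S.vpar (S.src i) + S.vpar (S.tgt i)) * S.vpar x) : GroundField) := by
      intro x
      rw [hB, WeightRep.braidDiag, WeightRep.toral, affDatum_parity, mul_inv, zpow_neg]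
      congr 1
      exact inv_eq_of_mul_eq_one_left (by exact_mod_cast paritySign_self _)
    -- With $x$ the source and $y$ the target, `E1` compares the coefficients of $E_{x'y}$ on the
    -- two sides of the crossing equation, and `E2` those of $E_{yx'}$.
    have E1 : (S.xsign (S.src i) (S.tgt i) : GroundField) *
        ((B (S.tgt i).rev)⁻¹ * S.crossEntry (S.tgt i)) =
        qElt ^ S.crossShift i * S.crossEntry (S.src i) := by
      rw [hBx, hform, neg_neg, vpar_rev, crossEntry, crossEntry]
      have h1 := congrArg (fun z => qElt ^ z) (S.crossExp_src i)
      simp only [zpow_add₀ qElt_ne_zero] at h1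
      have h2 := congrArg (Int.cast : ℤ → GroundField) (S.xsign_sign_src (S.src i) (S.tgt i))
      push_cast at h2 ⊢
      linear_combination (qElt ^ S.crossShift i * qElt ^ S.crossExp (S.src i)) * h2 +
        ((S.xsign (S.src i) (S.tgt i) : GroundField) *
          ((paritySign ((S.vpar (S.src i) + S.vpar (S.tgt i)) * S.vpar (S.tgt i)) : GroundField) *
          (paritySign (S.vpar (S.tgt i)) * S.vsgn (S.tgt i)))) * h1
    have E2 : (B (S.src i))⁻¹ * S.crossEntry (S.src i).rev =
        qElt ^ S.crossShift i *
          ((S.xsign (S.src i) (S.tgt i) : GroundField) * S.crossEntry (S.tgt i).rev) := by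
      rw [hBx, crossEntry, crossEntry]
      have h1 := congrArg (fun z => qElt ^ z) (S.crossExp_tgt i)
      simp only [zpow_add₀ qElt_ne_zero] at h1
      have h2 := congrArg (Int.cast : ℤ → GroundField) (S.xsign_sign_tgt (S.src i) (S.tgt i))
      push_cast at h2 ⊢
      linear_combination (qElt ^ S.crossShift i * qElt ^ S.crossExp (S.tgt i).rev) * h2 +
        ((paritySign ((S.vpar (S.src i) + S.vpar (S.tgt i)) * S.vpar (S.src i)) : GroundField) *
          (paritySign (S.vpar (S.src i).rev) * S.vsgn (S.src i).rev)) * h1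
    change (-(Matrix.diagonal (fun x => (B x)⁻¹) * S.opE a u i)).transpose * _ =
      _ • (_ * S.opE a u i)
    rw [opE, Y]
    simp only [mul_smul_comm, smul_mul_assoc, mul_sub, sub_mul, hD, hG, hG',
      Matrix.transpose_neg, Matrix.transpose_smul, Matrix.transpose_sub, Matrix.transpose_single,
      neg_mul, smul_smul, Fin.rev_rev]
    rw [E2, mul_assoc (S.xsign (S.src i) (S.tgt i) : GroundField), E1, ← smul_neg, neg_sub,
      mul_comm (qElt ^ S.crossShift i) (S.eCoef a u i), smul_sub, smul_sub]
    simp only [smul_smul, mul_assoc]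
  one_add_ne_zero w := by
    rw [zpow_list_sum _ qElt_ne_zero]
    exact one_add_qElt_zpow_ne_zero _

end Setup
end

noncomputable section
set_option linter.unusedSectionVars false

namespace Setup

variable {m n : ℕ} {S : Setup m n} {u a b : GroundField}

/-! ### Connectivity of the natural module -/

/-- The hypothesis excludes $X_{yy'}$ with $y$ even, where the two matrix units cancel. -/
theorem Y_entry_ne_zero {x y : Fin (m + n)} (h : x = y.rev → S.vpar x = 1) :
    S.Y GroundField y x y x ≠ 0 := by
  by_cases hl : x = y.rev
  · have hy : S.vpar y = 1 := by rw [← vpar_rev, ← hl, h hl]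
    have := S.Y_long GroundField hy
    rw [← hl] at this
    rw [this]
    simp
  · rw [Y_apply, if_pos ⟨rfl, rfl⟩, if_neg fun h' => hl h'.2.symm]
    simp

theorem Y_entry_rev_ne_zero {x y : Fin (m + n)} (h : x = y.rev → S.vpar x = 1) :
    S.Y GroundField y x x.rev y.rev ≠ 0 := by
  by_cases hl : x = y.rev
  · have := Y_entry_ne_zero h
    rwa [← hl, show x.rev = y by rw [hl, Fin.rev_rev]]
  · have h1 : S.xsign y x ≠ 0 := fun h' => by
      have := S.xsign_mul_self y x
      simp [h'] at this
    rw [Y_apply, if_neg fun h' => hl h'.2]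
    simp [h1]

/-- Some `f_i` moves `v_c` to a multiple of `v_d`. -/
def Step (S : Setup m n) (c d : Fin (m + n)) : Prop :=
  ∃ i, S.src i = c ∧ S.tgt i = d ∨ (S.tgt i).rev = c ∧ (S.src i).rev = d

theorem Step.rev {c d : Fin (m + n)} (h : S.Step c d) : S.Step d.rev c.rev := by
  obtain ⟨i, ⟨rfl, rfl⟩ | ⟨rfl, rfl⟩⟩ := h
  · exact ⟨i, Or.inr ⟨rfl, rfl⟩⟩
  · exact ⟨i, Or.inl ⟨(Fin.rev_rev _).symm, (Fin.rev_rev _).symm⟩⟩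

/-- Node `d` reaches the first half of the basis, and mirrored arrows reach the second half. A fork
at node $s$ skips a vector, so the bound `1 ≤ c` fails only when $s=2$ with such a fork. -/
theorem exists_step_pred {d : Fin (m + n)} (hd : (d : ℕ) ≠ 0) :
    ∃ c : Fin (m + n), (c : ℕ) < d ∧ S.Step c d ∧
      (2 ≤ (d : ℕ) → ¬ (m + n = 4 ∧ S.par 2 = 0) → 1 ≤ (c : ℕ)) := by
  have hN := S.two_lt
  by_cases h1 : (d : ℕ) ≤ rk m n
  · have ht : S.tgt ⟨d, by lia⟩ = d := Fin.ext rfl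
    refine ⟨S.src ⟨d, by lia⟩, ?_, ⟨_, Or.inl ⟨rfl, ht⟩⟩, ?_⟩ <;>
    rcases S.node_cases ⟨d, by lia⟩ with h | h | h | h | h <;>
    simp only at h <;> try (unfold rk at *; lia)
    intro h2 h3
    by_contra h4
    have h5 : rk m n = 2 := by lia
    have h6 := h.2.2.1
    rw [h5] at h6
    exact h3 ⟨by unfold rk at *; lia, h6⟩
  · have hi : ((d.rev : ℕ) + 1) < rk m n + 1 := by rw [Fin.val_rev]; unfold rk at *; lia
    have hc := S.node_cases ⟨(d.rev : ℕ) + 1, hi⟩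
    have hs : S.src ⟨(d.rev : ℕ) + 1, hi⟩ = d.rev := by
      apply Fin.ext
      have hv := Fin.val_rev d
      have hd := d.2
      rcases hc with h | h | h | h | h <;> simp only at h <;> unfold rk at * <;> lia
    refine ⟨(S.tgt ⟨(d.rev : ℕ) + 1, hi⟩).rev, ?_, ⟨_, Or.inr ⟨rfl, ?_⟩⟩, ?_⟩
    · rw [Fin.val_rev, tgt]
      simp only [Fin.val_rev]
      lia
    · rw [hs, Fin.rev_rev]
    · rw [Fin.val_rev, tgt]
      simp only [Fin.val_rev]
      unfold rk at *
      lia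

theorem reach_of_zero {c : Fin (m + n)} (hc : (c : ℕ) = 0) (d : Fin (m + n)) :
    Relation.ReflTransGen S.Step c d := by
  induction hk : (d : ℕ) using Nat.strong_induction_on generalizing d with
  | _ k ih =>
    by_cases h0 : (d : ℕ) = 0
    · rw [show d = c from Fin.ext (h0.trans hc.symm)]
    · obtain ⟨e, he, hs, -⟩ := S.exists_step_pred h0
      exact (ih e (by lia) e rfl).tail hs

theorem reach_of_one (h4 : ¬ (m + n = 4 ∧ S.par 2 = 0)) {c : Fin (m + n)} (hc : (c : ℕ) = 1)
    (d : Fin (m + n)) (hd : 1 ≤ (d : ℕ)) : Relation.ReflTransGen S.Step c d := by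
  induction hk : (d : ℕ) using Nat.strong_induction_on generalizing d with
  | _ k ih =>
    by_cases h0 : (d : ℕ) = 1
    · rw [show d = c from Fin.ext (h0.trans hc.symm)]
    · obtain ⟨e, he, hs, h1⟩ := S.exists_step_pred (d := d) (by lia)
      exact (ih e (by lia) e (h1 (by lia) h4) rfl).tail hs

theorem reach_rev {c d : Fin (m + n)} (h : Relation.ReflTransGen S.Step c d) :
    Relation.ReflTransGen S.Step d.rev c.rev := by
  induction h with
  | refl => exact .refl
  | tail _ h ih => exact .head h.rev ih

/-- Mirrored paths lead from every vector to $v_{1'}$, and $f_0$ leads back. For odd $v_1$ it does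
so directly. For even $v_1$ it sends $v_{1'}$ to $v_2$ and $v_{2'}$ to $v_1$, so a path from $v_2$
to $v_{2'}$ is needed in between. -/
theorem reach_zero (h4 : ¬ (m + n = 4 ∧ S.par 1 = 0 ∧ S.par 2 = 0)) {c : Fin (m + n)}
    (hc : (c : ℕ) = 0) (d : Fin (m + n)) : Relation.ReflTransGen S.Step d c := by
  have hN := S.two_lt
  have h1 : Relation.ReflTransGen S.Step d c.rev := by
    have := reach_rev (reach_of_zero (S := S) hc d.rev)
    rwa [Fin.rev_rev] at this
  refine h1.trans ?_
  have ht : S.tgt 0 = c := Fin.ext hc.symm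
  have hs : S.Step (S.src 0) c := ⟨0, Or.inl ⟨rfl, ht⟩⟩
  rcases zmod2_cases (S.par 1) with hp | hp
  · have h2 : (S.src 0 : ℕ) + 2 = m + n := by
      rcases S.node_cases 0 with h | h | h | h | h <;> simp [hp] at h <;> unfold rk at * <;> lia
    have h3 : ((S.src 0).rev : ℕ) = 1 := by rw [Fin.val_rev]; lia
    have hs' := hs.rev
    exact .head hs' ((reach_of_one (fun h => h4 ⟨h.1, hp, h.2⟩) h3 _ (by lia)).tail hs)
  · have h2 : S.src 0 = c.rev := by
      apply Fin.ext
      rw [Fin.val_rev]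
      rcases S.node_cases 0 with h | h | h | h | h <;> simp [hp] at h <;> unfold rk at * <;> lia
    rw [← h2]
    exact .single hs

theorem Step.arrow (hu : u ≠ 0) (hb : b ≠ 0) (hab_odd : S.par 1 = 1 → a * b = -(qElt + qElt⁻¹))
    (hab_even : S.par 1 = 0 → a * b = (S.psign 2 : GroundField)) (c d : Fin (m + n))
    (h : S.Step c d) : (S.naturalRep hu hab_odd hab_even).Arrow c d := by
  obtain ⟨i, ⟨rfl, rfl⟩ | ⟨rfl, rfl⟩⟩ := h
  · exact ⟨i, mul_ne_zero (fCoef_ne_zero hu hb i) (Y_entry_ne_zero S.vpar_of_long)⟩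
  · exact ⟨i, mul_ne_zero (fCoef_ne_zero hu hb i) (Y_entry_rev_ne_zero S.vpar_of_long)⟩

theorem rootSum_eq_zero_of_natural (hu : u ≠ 0) (hb : b ≠ 0)
    (hab_odd : S.par 1 = 1 → a * b = -(qElt + qElt⁻¹))
    (hab_even : S.par 1 = 0 → a * b = (S.psign 2 : GroundField))
    {w : List (Fin (rk m n + 1))} {M : Mat m n GroundField}
    (hMwt : ∀ c d, M c d ≠ 0 →
      S.wt c - S.wt d = (S.naturalRep hu hab_odd hab_even).rootSum w)
    (hM : ∀ j, M * S.opF b u j = wordSign S.affDatum j w • (S.opF b u j * M)) (hM0 : M ≠ 0) :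
    (S.naturalRep hu hab_odd hab_even).rootSum w = 0 := by
  have hN := S.two_lt
  set D := S.naturalRep hu hab_odd hab_even with hD
  have harrow : ∀ {c d}, Relation.ReflTransGen S.Step c d → Relation.ReflTransGen D.Arrow c d :=
    fun h => Relation.ReflTransGen.mono (fun c d h => h.arrow hu hb hab_odd hab_even) _ _ h
  have hreach := fun d => harrow (reach_of_zero (S := S) (c := ⟨0, by lia⟩) rfl d)
  -- In the $\mathfrak{so}_4$ case the arrows are not strongly connected, and a separate weight
  -- argument replaces the permutation argument.
  by_cases h4 : m + n = 4 ∧ S.par 1 = 0 ∧ S.par 2 = 0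
  · obtain ⟨h4, hp1, hp2⟩ := h4
    have hrk : rk m n = 2 := by unfold rk; lia
    -- This functional is nonnegative on the simple roots and equals $1$ on the weights of $v_1$,
    -- $v_3$ and $-1$ on those of $v_2$, $v_4$. Hence $M$ preserves the span of $v_1$ and $v_3$.
    -- Both columns are nonzero, and a common nonzero weight would have to interchange the two
    -- vectors, which is impossible.
    let φ : (Fin (rk m n) → ℤ) → ℤ := fun x => x ⟨0, by lia⟩ - x ⟨1, by lia⟩
    have hφ : ∀ i : Fin (rk m n + 1), 0 ≤ φ (S.alphaHat i).2 := by
      intro i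
      have ht : (S.tgt i : ℕ) = i := rfl
      have := i.2
      rw [alphaHat_eq]
      simp only [φ, Pi.sub_apply, wt_apply, Fin.val_rev]
      rcases S.node_cases i with h | h | h | h | h
      · rw [if_neg (by lia), if_neg (by lia), if_pos (by lia), if_neg (by lia), if_neg (by lia),
          if_pos (by lia), if_neg (by lia), if_neg (by lia)]
        lia
      · rw [hp1] at h; simp at h
      · rw [if_pos (by lia), if_neg (by lia), if_neg (by lia), if_neg (by lia), if_neg (by lia),
          if_neg (by lia), if_pos (by lia), if_neg (by lia)]
        lia
      · rw [if_pos (by lia), if_neg (by lia), if_neg (by lia), if_neg (by lia), if_neg (by lia),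
          if_neg (by lia), if_neg (by lia), if_pos (by lia)]
        lia
      · have h5 := h.2.2.1
        rw [hrk, hp2] at h5
        simp at h5
    have hφw : 0 ≤ φ (D.rootSum w) := by
      clear hMwt hM
      induction w with
      | nil => exact le_of_eq (by simp [φ, WeightRep.rootSum])
      | cons i w ih =>
        have : φ (D.rootSum (i :: w)) = φ (S.alphaHat i).2 + φ (D.rootSum w) := by
          simp only [φ, WeightRep.rootSum, List.map_cons, List.sum_cons, Pi.add_apply]
          change (S.alphaHat i).2 _ + _ - ((S.alphaHat i).2 _ + _) = _
          ring
        rw [this]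
        exact add_nonneg (hφ i) ih
    have hval : ∀ c d : Fin (m + n), ((d : ℕ) = 0 ∨ (d : ℕ) = 2) → M c d ≠ 0 →
        (c : ℕ) = 0 ∨ (c : ℕ) = 2 := by
      intro c d hd hcd
      rw [← hMwt c d hcd] at hφw
      simp only [φ, Pi.sub_apply, wt_apply, Fin.val_rev] at hφw
      have hc := c.2
      have : (c : ℕ) = 0 ∨ (c : ℕ) = 1 ∨ (c : ℕ) = 2 ∨ (c : ℕ) = 3 := by lia
      rcases this with h | h | h | h <;> rcases hd with h' | h' <;> simp [h, h', h4] at hφw ⊢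
    have hback : Relation.ReflTransGen D.Arrow (⟨2, by lia⟩ : Fin (m + n)) ⟨0, by lia⟩ := by
      refine harrow (.single ⟨0, Or.inl ⟨?_, rfl⟩⟩)
      apply Fin.ext
      rcases S.node_cases 0 with h | h | h | h | h <;> simp [hp1] at h <;> unfold rk at * <;>
        simp <;> lia
    obtain ⟨c, hc⟩ := WeightRep.exists_column S.wt_injective hM hreach hM0 (.refl)
    obtain ⟨d, hd⟩ := WeightRep.exists_column S.wt_injective hM hreach hM0 hback
    have hc' := hMwt _ _ hc
    have hd' := hMwt _ _ hd
    rcases hval _ _ (Or.inl rfl) hc with h | h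
    · rw [← hc', show c = ⟨0, by lia⟩ from Fin.ext h, sub_self]
    · rcases hval _ _ (Or.inr rfl) hd with h' | h'
      · have h5 := congrFun (hc'.trans hd'.symm) ⟨0, by lia⟩
        simp [wt_apply, Fin.val_rev, h, h', h4] at h5
      · rw [← hd', show d = ⟨2, by lia⟩ from Fin.ext h', sub_self]
  · exact WeightRep.rootSum_eq_zero_of_connected S.wt_injective hMwt hM hreach
      (fun d => harrow (reach_zero h4 rfl d)) hM0

/-- The `q`-Serre relations hold for the operators of the `e_i`. -/
theorem evalWords_opE_eq_zero (hu : u ≠ 0) (hb : b ≠ 0)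
    (hab_odd : S.par 1 = 1 → a * b = -(qElt + qElt⁻¹))
    (hab_even : S.par 1 = 0 → a * b = (S.psign 2 : GroundField))
    {c : List (Fin (rk m n + 1)) →₀ GroundField} (hc : InSerreRadical S.affDatum c) :
    evalWords (S.opE a u) c = 0 := by
  refine WeightRep.evalWords_eq_zero (S.naturalCrossing hu hab_odd hab_even) ?_ hc
  intro w M hMwt hM
  by_cases hM0 : M = 0
  · exact Or.inl hM0
  · right
    have h0 := rootSum_eq_zero_of_natural hu hb hab_odd hab_even hMwt hM hM0
    refine ⟨h0, ?_⟩
    have hN := S.two_lt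
    exact WeightRep.scalar_of_rootSum_eq_zero S.wt_injective hMwt hM
      (fun d => Relation.ReflTransGen.mono (Step.arrow hu hb hab_odd hab_even) _ _
        (reach_of_zero (S := S) (c := ⟨0, by lia⟩) rfl d)) h0

end Setup
end

noncomputable section
set_option linter.unusedSectionVars false

/-! ### Rescaling of generators -/

section rescale

variable {I A B : Type} [DecidableEq I] [Ring A] [Algebra GroundField A] [Ring B]
    [Algebra GroundField B]

theorem prod_map_rescale (φ : A →ₐ[GroundField] B) (x : I → A) (d : I → GroundField)
    (w : List I) : (w.map fun i => d i • φ (x i)).prod = (w.map d).prod • φ (w.map x).prod := by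
  induction w with
  | nil => simp
  | cons i w ih => simp [ih, smul_smul, mul_comm]

/-- On a homogeneous element a rescaling of the generators is one overall scalar, and the radical is
spanned by homogeneous elements. -/
theorem evalWords_rescale_eq_zero (C : CartanDatum I) (φ : A →ₐ[GroundField] B) (x : I → A)
    (d : I → GroundField) (hx : ∀ c, InSerreRadical C c → evalWords x c = 0)
    {c : List I →₀ GroundField} (hc : InSerreRadical C c) :
    evalWords (fun i => d i • φ (x i)) c = 0 := by
  refine wordLift_eq_zero_of_homogeneous _ hc fun w _ c hc hcw => ?_
  have h : wordLift (fun w => (w.map fun i => d i • φ (x i)).prod) c =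
      wordLift (fun u => (w.map d).prod • φ (u.map x).prod) c := by
    refine wordLift_congr fun u hu => ?_
    rw [prod_map_rescale, ((Multiset.coe_eq_coe.1 (hcw u hu)).map d).prod_eq]
  rw [h, wordLift_smul]
  have h2 := map_wordLift φ.toLinearMap (fun u : List I => (u.map x).prod) c
  rw [show wordLift (fun u : List I => (u.map x).prod) c = 0 from hx c hc, map_zero] at h2
  exact smul_eq_zero_of_right _ h2.symm

theorem eval_rescale (C : CartanDatum I) (φ : A →ₐ[GroundField] B) (x : I → A)
    (d : I → GroundField) (t : BracketTree I) :
    t.eval C (fun i => d i • φ (x i)) = (t.leaves.map d).prod • φ (t.eval C x) := by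
  induction t with
  | gen i => simp [BracketTree.eval, BracketTree.leaves]
  | br l r ihl ihr =>
    simp only [BracketTree.eval, BracketTree.leaves, ihl, ihr, smul_mul_assoc, mul_smul_comm,
      map_sub, map_mul, map_smul, smul_sub, smul_smul, List.map_append, List.prod_append]
    congr 2 <;> ring

end rescale

/-! ### From the $e_i$ to the $f_i$ -/

namespace Setup

variable {m n : ℕ} {S : Setup m n} {u a b : GroundField}

/-- Conjugation by the operator `v_a ↦ ϑ_a v_{a'}`. -/
def flip (S : Setup m n) : Mat m n GroundField →ₐ[GroundField] Mat m n GroundField :=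
  AlgHom.ofLinearMap
    { toFun := fun M => Matrix.of fun c d => (S.vsgn c.rev * S.vsgn d.rev : GroundField) *
        M c.rev d.rev
      map_add' := fun M N => by ext; simp [mul_add]
      map_smul' := fun r M => by ext; simp [mul_left_comm] }
    (by
      ext c d
      have := S.vsgn_mul_self c.rev
      have : (S.vsgn c.rev * S.vsgn c.rev : GroundField) = 1 := by exact_mod_cast this
      by_cases h : c = d
      · subst h; simp [this]
      · simp [h])
    (by
      intro M N
      ext c d
      simp only [LinearMap.coe_mk, AddHom.coe_mk, Matrix.of_apply, Matrix.mul_apply,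
        Finset.mul_sum]
      rw [← Equiv.sum_comp Fin.revPerm]
      refine Finset.sum_congr rfl fun e _ => ?_
      have : (S.vsgn e.rev * S.vsgn e.rev : GroundField) = 1 := by
        exact_mod_cast S.vsgn_mul_self e.rev
      simp only [Fin.revPerm_apply]
      linear_combination (-(S.vsgn c.rev * S.vsgn d.rev * M c.rev e.rev * N e.rev d.rev :
        GroundField)) * this)

theorem flip_apply (M : Mat m n GroundField) (c d : Fin (m + n)) :
    S.flip M c d = (S.vsgn c.rev * S.vsgn d.rev : GroundField) * M c.rev d.rev := rfl

theorem flip_single (x y : Fin (m + n)) : S.flip (Matrix.single x y 1) =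
    (S.vsgn x * S.vsgn y : GroundField) • Matrix.single x.rev y.rev 1 := by
  ext c d
  have h : ∀ x c : Fin (m + n), x = c.rev ↔ x.rev = c := by
    intro x c
    constructor
    · rintro rfl; simp
    · rintro rfl; simp
  rw [flip_apply, Matrix.smul_apply, smul_eq_mul]
  simp only [Matrix.single_apply, h]
  by_cases h1 : x.rev = c ∧ y.rev = d
  · rw [← h1.1, ← h1.2]; simp
  · simp [h1]

/-- The conjugation sends $E_{xy}$ to a multiple of $E_{x'y'}$, which is the second matrix unit of
$X_{yx}$. -/
theorem flip_Y (x y : Fin (m + n)) : S.Y GroundField y x =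
    (-(S.vsgn x * S.vsgn y * S.xsign y x : ℤ) : GroundField) • S.flip (S.Y GroundField x y) := by
  have hx := S.vsgn_mul_self x
  have hy := S.vsgn_mul_self y
  have hp := paritySign_self (S.vpar x + S.vpar y)
  have hs := S.xsign_mul_self x y
  rw [Y, Y, map_sub, map_smul, flip_single, flip_single, xsign_swap, vsgn_rev, vsgn_rev,
    Fin.rev_rev, Fin.rev_rev, smul_sub, smul_smul, smul_smul, smul_smul]
  have h1 : (-(S.vsgn x * S.vsgn y * (paritySign (S.vpar x + S.vpar y) * S.xsign x y) : ℤ) *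
      (S.vsgn x * S.vsgn y) : GroundField) =
      -((paritySign (S.vpar x + S.vpar y) * S.xsign x y : ℤ) : GroundField) := by
    norm_cast
    linear_combination (-paritySign (S.vpar x + S.vpar y) * S.xsign x y) *
      (S.vsgn y * S.vsgn y * hx + hy)
  have h2 : (-(S.vsgn x * S.vsgn y * (paritySign (S.vpar x + S.vpar y) * S.xsign x y) : ℤ) *
      ((S.xsign x y : GroundField) * (((paritySign (S.vpar y) * S.vsgn y : ℤ) : GroundField) *
      ((paritySign (S.vpar x) * S.vsgn x : ℤ) : GroundField))) : GroundField) = -1 := by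
    rw [paritySign_add_int] at *
    generalize paritySign (S.vpar x) = p at *
    generalize paritySign (S.vpar y) = r at *
    rw [← Int.cast_one]
    norm_cast
    rw [Int.negSucc_eq]
    push_cast
    linear_combination (-(S.vsgn x * S.vsgn x) * (S.vsgn y * S.vsgn y) *
      (S.xsign x y * S.xsign x y)) * hp - (S.vsgn x * S.vsgn x) * (S.vsgn y * S.vsgn y) * hs
      - (S.vsgn y * S.vsgn y) * hx - hy
  rw [h1, mul_assoc (-((_ : ℤ) : GroundField)), h2]
  rw [neg_smul, neg_smul, one_smul]
  abel

/-- The operators of the `f_i` are rescaled conjugates of the operators of the `e_i`. -/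
theorem exists_opF_eq (hu : u ≠ 0) (ha : a ≠ 0) (S : Setup m n) :
    ∃ d : Fin (rk m n + 1) → GroundField,
      S.opF b u = fun i => d i • S.flip (S.opE a u i) := by
  refine ⟨fun i => S.fCoef b u i *
    (-(S.vsgn (S.src i) * S.vsgn (S.tgt i) * S.xsign (S.tgt i) (S.src i) : ℤ) : GroundField) *
    (S.eCoef a u i)⁻¹, ?_⟩
  funext i
  rw [opF, flip_Y, opE, map_smul, smul_smul, smul_smul, inv_mul_cancel_right₀]
  exact eCoef_ne_zero hu ha i

/-- An isotropic or even root, or an odd root with even Cartan integers. -/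
theorem parity_zero_or_even {i j : Fin (rk m n + 1)} {r : ℕ} (h0 : S.affDatum.pairing i i ≠ 0)
    (h : (r : ℤ) * S.affDatum.pairing i i = -2 * S.affDatum.pairing i j) :
    S.affDatum.parity i = 0 ∨ Even r := by
  by_cases hp : S.affDatum.parity i = 0
  · exact Or.inl hp
  right
  have hne := S.src_ne_tgt i
  rw [affDatum_parity] at hp
  have hl : S.src i ≠ (S.tgt i).rev := fun h => hp (by
    rw [h, vpar_rev]
    exact CharTwo.add_self_eq_zero _)
  have hl' : S.tgt i ≠ (S.src i).rev := (rev_ne hl).symm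
  have key : S.affDatum.pairing i i =
      paritySign (S.vpar (S.src i)) * (1 - if S.src i = (S.src i).rev then 1 else 0) +
      paritySign (S.vpar (S.tgt i)) * (1 - if S.tgt i = (S.tgt i).rev then 1 else 0) := by
    rw [affDatum_pairing]
    simp only [map_sub, AddMonoidHom.sub_apply, pairHom_apply, pairP_wt, if_neg hne,
      if_neg hne.symm, if_neg hl, if_neg hl', if_true]
    ring
  -- An odd root whose two end weights are both nonzero is isotropic. Otherwise one end has weight
  -- zero and the norm is $\pm1$, so `h` makes `r` even.
  have h1 : S.affDatum.pairing i i = 1 ∨ S.affDatum.pairing i i = -1 := by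
    have hps : ∀ p : ZMod 2, paritySign p = 1 ∨ paritySign p = -1 := by decide
    rw [key] at h0 ⊢
    have hpar : paritySign (S.vpar (S.src i)) = -paritySign (S.vpar (S.tgt i)) := by
      revert hp
      generalize S.vpar (S.src i) = p
      generalize S.vpar (S.tgt i) = r
      revert p r
      decide
    rw [hpar] at h0 ⊢
    have h2 : ¬ (S.src i = (S.src i).rev ∧ S.tgt i = (S.tgt i).rev) := by
      rintro ⟨h1, h2⟩
      apply hne
      simp only [Fin.ext_iff, Fin.val_rev] at *
      lia
    have h3 := hps (S.vpar (S.tgt i))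
    generalize paritySign (S.vpar (S.tgt i)) = p at h0 h3 ⊢
    by_cases h4 : S.src i = (S.src i).rev
    · rw [if_pos h4, if_neg fun h5 => h2 ⟨h4, h5⟩]
      simpa using h3
    · by_cases h5 : S.tgt i = (S.tgt i).rev
      · rw [if_neg h4, if_pos h5]
        rcases h3 with rfl | rfl <;> simp
      · rw [if_neg h4, if_neg h5] at h0
        exact absurd (by ring) h0
  have : Even (r : ℤ) := by
    rcases h1 with h1 | h1 <;> rw [h1] at h
    · exact ⟨-S.affDatum.pairing i j, by linarith⟩
    · exact ⟨S.affDatum.pairing i j, by linarith⟩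
  exact_mod_cast this

end Setup
end

noncomputable section
set_option linter.unusedSectionVars false
set_option linter.unusedSimpArgs false

/-! ### The exceptional relations -/

section matrices

variable {K : Type} [Field K] {q t θ : K}

/-- The bracket `x y - c y x`. -/
def brk {F A : Type} [Field F] [Ring A] [Algebra F A] (c : F) (x y : A) : A :=
  x * y - c • (y * x)

/-- The inner brackets have two matrix units each, and the indices $2$ and $3$ enter symmetrically.
Both sides come out as the same combination of $E_{45}$ and $E_{01}$. -/
theorem brk_osp42_odd (hq : q ≠ 0) {e₀ e₁ e₂ e₃ : Matrix (Fin 6) (Fin 6) K}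
    (h₀ : e₀ = t • Matrix.single 5 0 1)
    (h₁ : e₁ = Matrix.single 0 1 1 + θ • Matrix.single 4 5 1)
    (h₂ : e₂ = Matrix.single 1 2 1 - Matrix.single 3 4 1)
    (h₃ : e₃ = Matrix.single 1 3 1 - Matrix.single 2 4 1) :
    brk q⁻¹ (brk (-q) (brk (q ^ 2) e₁ e₀) (brk q⁻¹ e₁ e₂)) (brk q⁻¹ e₁ e₃) =
      brk q⁻¹ (brk (-q) (brk (q ^ 2) e₁ e₀) (brk q⁻¹ e₁ e₃)) (brk q⁻¹ e₁ e₂) := by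
  have b₀ : brk (q ^ 2) e₁ e₀ =
      (θ * t) • Matrix.single 4 0 1 - (q ^ 2 * t) • Matrix.single 5 1 1 := by
    rw [h₀, h₁]
    simp only [brk, mul_add, add_mul, mul_sub, sub_mul, smul_mul_assoc, mul_smul_comm,
      Setup.single_mul_single', Fin.reduceEq, Fin.isValue, reduceIte, smul_zero, add_zero, zero_add, sub_zero,
      zero_sub, smul_smul, smul_add, smul_sub, smul_neg, neg_smul, neg_zero,
      neg_mul, mul_neg]
    match_scalars <;> ring
  have b₂ : brk q⁻¹ e₁ e₂ =
      Matrix.single 0 2 1 + (q⁻¹ * θ) • Matrix.single 3 5 1 := by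
    rw [h₂, h₁]
    simp only [brk, mul_add, add_mul, mul_sub, sub_mul, smul_mul_assoc, mul_smul_comm,
      Setup.single_mul_single', Fin.reduceEq, Fin.isValue, reduceIte, smul_zero, add_zero, zero_add, sub_zero,
      zero_sub, smul_smul, smul_add, smul_sub, smul_neg, neg_smul, neg_zero,
      neg_mul, mul_neg]
    match_scalars <;> ring
  have b₃ : brk q⁻¹ e₁ e₃ =
      Matrix.single 0 3 1 + (q⁻¹ * θ) • Matrix.single 2 5 1 := by
    rw [h₃, h₁]
    simp only [brk, mul_add, add_mul, mul_sub, sub_mul, smul_mul_assoc, mul_smul_comm,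
      Setup.single_mul_single', Fin.reduceEq, Fin.isValue, reduceIte, smul_zero, add_zero, zero_add, sub_zero,
      zero_sub, smul_smul, smul_add, smul_sub, smul_neg, neg_smul, neg_zero,
      neg_mul, mul_neg]
    match_scalars <;> ring
  have c₂ : brk (-q) (brk (q ^ 2) e₁ e₀) (brk q⁻¹ e₁ e₂) =
      (θ * t) • Matrix.single 4 2 1 - (q ^ 2 * θ * t) • Matrix.single 3 1 1 := by
    rw [b₀, b₂]
    simp only [brk, mul_add, add_mul, mul_sub, sub_mul, smul_mul_assoc, mul_smul_comm,
      Setup.single_mul_single', Fin.reduceEq, Fin.isValue, reduceIte, smul_zero, add_zero, zero_add, sub_zero,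
      zero_sub, smul_smul, smul_add, smul_sub, smul_neg, neg_smul, neg_zero,
      neg_mul, mul_neg]
    match_scalars <;> field_simp
  have c₃ : brk (-q) (brk (q ^ 2) e₁ e₀) (brk q⁻¹ e₁ e₃) =
      (θ * t) • Matrix.single 4 3 1 - (q ^ 2 * θ * t) • Matrix.single 2 1 1 := by
    rw [b₀, b₃]
    simp only [brk, mul_add, add_mul, mul_sub, sub_mul, smul_mul_assoc, mul_smul_comm,
      Setup.single_mul_single', Fin.reduceEq, Fin.isValue, reduceIte, smul_zero, add_zero, zero_add, sub_zero,
      zero_sub, smul_smul, smul_add, smul_sub, smul_neg, neg_smul, neg_zero,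
      neg_mul, mul_neg]
    match_scalars <;> field_simp
  rw [c₂, c₃, b₂, b₃]
  simp only [brk, mul_add, add_mul, mul_sub, sub_mul, smul_mul_assoc, mul_smul_comm,
      Setup.single_mul_single', Fin.reduceEq, Fin.isValue, reduceIte, smul_zero, add_zero, zero_add, sub_zero,
      zero_sub, smul_smul, smul_add, smul_sub, smul_neg, neg_smul, neg_zero,
      neg_mul, mul_neg]

theorem brk_osp42_even (hq : q ≠ 0) {e₀ e₁ e₂ e₃ : Matrix (Fin 6) (Fin 6) K}
    (h₀ : e₀ = t • (Matrix.single 4 0 1 - Matrix.single 5 1 1))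
    (h₁ : e₁ = Matrix.single 0 1 1 - Matrix.single 4 5 1)
    (h₂ : e₂ = Matrix.single 1 2 1 - θ • Matrix.single 3 4 1)
    (h₃ : e₃ = Matrix.single 2 3 1) :
    brk q⁻¹ (brk (-q) (brk (q ^ 2) e₂ e₃) (brk q⁻¹ e₂ e₀)) (brk q⁻¹ e₂ e₁) =
      brk q⁻¹ (brk (-q) (brk (q ^ 2) e₂ e₃) (brk q⁻¹ e₂ e₁)) (brk q⁻¹ e₂ e₀) := by
  have b₃ : brk (q ^ 2) e₂ e₃ =
      Matrix.single 1 3 1 + (q ^ 2 * θ) • Matrix.single 2 4 1 := by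
    rw [h₃, h₂]
    simp only [brk, mul_add, add_mul, mul_sub, sub_mul, smul_mul_assoc, mul_smul_comm,
      Setup.single_mul_single', Fin.reduceEq, Fin.isValue, reduceIte, smul_zero, add_zero, zero_add, sub_zero,
      zero_sub, smul_smul, smul_add, smul_sub, smul_neg, neg_smul, neg_zero,
      neg_mul, mul_neg]
    match_scalars <;> ring
  have b₀ : brk q⁻¹ e₂ e₀ =
      (q⁻¹ * t) • Matrix.single 5 2 1 - (θ * t) • Matrix.single 3 0 1 := by
    rw [h₀, h₂]
    simp only [brk, mul_add, add_mul, mul_sub, sub_mul, smul_mul_assoc, mul_smul_comm,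
      Setup.single_mul_single', Fin.reduceEq, Fin.isValue, reduceIte, smul_zero, add_zero, zero_add, sub_zero,
      zero_sub, smul_smul, smul_add, smul_sub, smul_neg, neg_smul, neg_zero,
      neg_mul, mul_neg]
    match_scalars <;> ring
  have b₁ : brk q⁻¹ e₂ e₁ =
      (θ) • Matrix.single 3 5 1 - (q⁻¹) • Matrix.single 0 2 1 := by
    rw [h₁, h₂]
    simp only [brk, mul_add, add_mul, mul_sub, sub_mul, smul_mul_assoc, mul_smul_comm,
      Setup.single_mul_single', Fin.reduceEq, Fin.isValue, reduceIte, smul_zero, add_zero, zero_add, sub_zero,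
      zero_sub, smul_smul, smul_add, smul_sub, smul_neg, neg_smul, neg_zero,
      neg_mul, mul_neg]
    match_scalars <;> ring
  have c₀ : brk (-q) (brk (q ^ 2) e₂ e₃) (brk q⁻¹ e₂ e₀) =
      (q ^ 2 * θ * t) • Matrix.single 5 4 1 - (θ * t) • Matrix.single 1 0 1 := by
    rw [b₃, b₀]
    simp only [brk, mul_add, add_mul, mul_sub, sub_mul, smul_mul_assoc, mul_smul_comm,
      Setup.single_mul_single', Fin.reduceEq, Fin.isValue, reduceIte, smul_zero, add_zero, zero_add, sub_zero,
      zero_sub, smul_smul, smul_add, smul_sub, smul_neg, neg_smul, neg_zero,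
      neg_mul, mul_neg]
    match_scalars <;> field_simp
  have c₁ : brk (-q) (brk (q ^ 2) e₂ e₃) (brk q⁻¹ e₂ e₁) =
      (θ) • Matrix.single 1 5 1 - (q ^ 2 * θ) • Matrix.single 0 4 1 := by
    rw [b₃, b₁]
    simp only [brk, mul_add, add_mul, mul_sub, sub_mul, smul_mul_assoc, mul_smul_comm,
      Setup.single_mul_single', Fin.reduceEq, Fin.isValue, reduceIte, smul_zero, add_zero, zero_add, sub_zero,
      zero_sub, smul_smul, smul_add, smul_sub, smul_neg, neg_smul, neg_zero,
      neg_mul, mul_neg]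
    match_scalars <;> field_simp
  rw [c₀, c₁, b₀, b₁]
  simp only [brk, mul_add, add_mul, mul_sub, sub_mul, smul_mul_assoc, mul_smul_comm,
      Setup.single_mul_single', Fin.reduceEq, Fin.isValue, reduceIte, smul_zero, add_zero, zero_add, sub_zero,
      zero_sub, smul_smul, smul_add, smul_sub, smul_neg, neg_smul, neg_zero,
      neg_mul, mul_neg]
  match_scalars <;> field_simp

/-- The double bracket on the left is diagonal, so both sides are combinations of $E_{24}$ and
$E_{02}$. The scalar $1-q-q^{-1}$ matches both coefficients. -/
theorem brk_osp32 (hq : q ≠ 0) {e₀ e₁ e₂ : Matrix (Fin 5) (Fin 5) K}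
    (h₀ : e₀ = t • Matrix.single 4 0 1)
    (h₁ : e₁ = Matrix.single 0 1 1 + θ • Matrix.single 3 4 1)
    (h₂ : e₂ = Matrix.single 1 2 1 - Matrix.single 2 3 1) :
    brk (1 : K) (brk q⁻¹ e₂ e₁) (brk (-q) (brk q⁻¹ e₂ e₁) (brk (q ^ 2) (brk q⁻¹ e₂ e₁) e₀)) =
      (1 - (q + q⁻¹)) • brk q⁻¹ (brk (-q) (brk q⁻¹ e₂ e₁)
        (brk (1 : K) e₂ (brk q⁻¹ e₂ (brk (q ^ 2) e₁ e₀)))) e₁ := by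
  have bA : brk q⁻¹ e₂ e₁ =
      -(θ • Matrix.single 2 4 1) - (q⁻¹) • Matrix.single 0 2 1 := by
    rw [h₂, h₁]
    simp only [brk, mul_add, add_mul, mul_sub, sub_mul, smul_mul_assoc, mul_smul_comm,
      Setup.single_mul_single', Fin.reduceEq, Fin.isValue, reduceIte, smul_zero, add_zero, zero_add, sub_zero,
      zero_sub, smul_smul, smul_add, smul_sub, smul_neg, neg_smul, neg_zero,
      neg_mul, mul_neg]
  have bB : brk (q ^ 2) (brk q⁻¹ e₂ e₁) e₀ =
      (q * t) • Matrix.single 4 2 1 - (θ * t) • Matrix.single 2 0 1 := by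
    rw [bA, h₀]
    simp only [brk, mul_add, add_mul, mul_sub, sub_mul, smul_mul_assoc, mul_smul_comm,
      Setup.single_mul_single', Fin.reduceEq, Fin.isValue, reduceIte, smul_zero, add_zero, zero_add, sub_zero,
      zero_sub, smul_smul, smul_add, smul_sub, smul_neg, neg_smul, neg_zero,
      neg_mul, mul_neg]
    match_scalars <;> field_simp
  have bC : brk (-q) (brk q⁻¹ e₂ e₁) (brk (q ^ 2) (brk q⁻¹ e₂ e₁) e₀) =
      (q⁻¹ * θ * t) • Matrix.single 0 0 1 + (θ * t * (1 - q)) • Matrix.single 2 2 1 - (q ^ 2 * θ * t) • Matrix.single 4 4 1 := by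
    rw [bB, bA]
    simp only [brk, mul_add, add_mul, mul_sub, sub_mul, smul_mul_assoc, mul_smul_comm,
      Setup.single_mul_single', Fin.reduceEq, Fin.isValue, reduceIte, smul_zero, add_zero, zero_add, sub_zero,
      zero_sub, smul_smul, smul_add, smul_sub, smul_neg, neg_smul, neg_zero,
      neg_mul, mul_neg]
    match_scalars <;> field_simp <;> ring
  have bD : brk (q ^ 2) e₁ e₀ =
      (θ * t) • Matrix.single 3 0 1 - (q ^ 2 * t) • Matrix.single 4 1 1 := by
    rw [h₁, h₀]
    simp only [brk, mul_add, add_mul, mul_sub, sub_mul, smul_mul_assoc, mul_smul_comm,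
      Setup.single_mul_single', Fin.reduceEq, Fin.isValue, reduceIte, smul_zero, add_zero, zero_add, sub_zero,
      zero_sub, smul_smul, smul_add, smul_sub, smul_neg, neg_smul, neg_zero,
      neg_mul, mul_neg]
    match_scalars <;> field_simp
  have bE : brk q⁻¹ e₂ (brk (q ^ 2) e₁ e₀) =
      (q * t) • Matrix.single 4 2 1 - (θ * t) • Matrix.single 2 0 1 := by
    rw [bD, h₂]
    simp only [brk, mul_add, add_mul, mul_sub, sub_mul, smul_mul_assoc, mul_smul_comm,
      Setup.single_mul_single', Fin.reduceEq, Fin.isValue, reduceIte, smul_zero, add_zero, zero_add, sub_zero,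
      zero_sub, smul_smul, smul_add, smul_sub, smul_neg, neg_smul, neg_zero,
      neg_mul, mul_neg]
    match_scalars <;> field_simp
  have bF : brk (1 : K) e₂ (brk q⁻¹ e₂ (brk (q ^ 2) e₁ e₀)) =
      (q * t) • Matrix.single 4 3 1 - (θ * t) • Matrix.single 1 0 1 := by
    rw [bE, h₂]
    simp only [brk, mul_add, add_mul, mul_sub, sub_mul, smul_mul_assoc, mul_smul_comm,
      Setup.single_mul_single', Fin.reduceEq, Fin.isValue, reduceIte, smul_zero, add_zero, zero_add, sub_zero,
      zero_sub, smul_smul, smul_add, smul_sub, smul_neg, neg_smul, neg_zero,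
      neg_mul, mul_neg]
    match_scalars <;> field_simp
  have bG : brk (-q) (brk q⁻¹ e₂ e₁) (brk (1 : K) e₂ (brk q⁻¹ e₂ (brk (q ^ 2) e₁ e₀))) =
      (θ * t) • Matrix.single 1 2 1 - (q * θ * t) • Matrix.single 2 3 1 := by
    rw [bF, bA]
    simp only [brk, mul_add, add_mul, mul_sub, sub_mul, smul_mul_assoc, mul_smul_comm,
      Setup.single_mul_single', Fin.reduceEq, Fin.isValue, reduceIte, smul_zero, add_zero, zero_add, sub_zero,
      zero_sub, smul_smul, smul_add, smul_sub, smul_neg, neg_smul, neg_zero,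
      neg_mul, mul_neg]
    match_scalars <;> field_simp
  rw [bG, bC, bA, h₁]
  simp only [brk, mul_add, add_mul, mul_sub, sub_mul, smul_mul_assoc, mul_smul_comm,
      Setup.single_mul_single', Fin.reduceEq, Fin.isValue, reduceIte, smul_zero, add_zero, zero_add, sub_zero,
      zero_sub, smul_smul, smul_add, smul_sub, smul_neg, neg_smul, neg_zero,
      neg_mul, mul_neg]
  match_scalars <;> field_simp <;> ring
end matrices

/-! ### Braiding factors in the exceptional brackets -/

section trees

open BracketTree

variable {I A : Type} [Ring A] [Algebra GroundField A] {C : CartanDatum I}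

theorem eval_br (x : I → A) (l r : BracketTree I) : (br l r).eval C x =
    brk ((paritySign (l.parity C * r.parity C) : GroundField) * qElt ^ l.degPairing C r)
      (l.eval C x) (r.eval C x) := rfl

theorem parity_gen (i : I) : (gen i).parity C = C.parity i := by
  simp [BracketTree.parity, leaves]

theorem parity_br (l r : BracketTree I) : (br l r).parity C = l.parity C + r.parity C := by
  simp [BracketTree.parity, leaves]

theorem degPairing_gen (i j : I) : (gen i).degPairing C (gen j) = C.pairing i j := by
  simp [degPairing, leaves]

theorem degPairing_br_left (l l' r : BracketTree I) :
    (br l l').degPairing C r = l.degPairing C r + l'.degPairing C r := by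
  simp [degPairing, leaves]

theorem degPairing_br_right (l r r' : BracketTree I) :
    l.degPairing C (br r r') = l.degPairing C r + l.degPairing C r' := by
  simp [degPairing, leaves, List.sum_map_add]

theorem eval_osp42 (hC : ∀ i j, C.pairing i j = C.pairing j i) (x : I → A) {i j k l : I}
    (hi : C.parity i = 0) (hj : C.parity j = 1) (hk : C.parity k = 0) (hl : C.parity l = 0)
    (hjj : C.pairing j j = 0) (hji : C.pairing j i = 2) (hjk : C.pairing j k = -1)
    (hjl : C.pairing j l = -1) (hik : C.pairing i k = 0) (hil : C.pairing i l = 0)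
    (hkl : C.pairing k l = 0) :
    (br (br (br (gen j) (gen i)) (br (gen j) (gen k))) (br (gen j) (gen l))).eval C x =
      brk qElt⁻¹ (brk (-qElt) (brk (qElt ^ 2) (x j) (x i)) (brk qElt⁻¹ (x j) (x k)))
        (brk qElt⁻¹ (x j) (x l)) := by
  have h0 : paritySign 0 = 1 := rfl
  have h1 : paritySign 1 = -1 := rfl
  have h2 : (1 + 1 : ZMod 2) = 0 := rfl
  have hij := (hC i j).trans hji
  have hkj := (hC k j).trans hjk
  have hlj := (hC l j).trans hjl
  simp only [eval_br, parity_gen, parity_br, degPairing_gen, degPairing_br_left,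
    degPairing_br_right, hi, hj, hk, hl, hjj, hji, hjk, hjl, hik, hil, hkl, hij, hkj, hlj, mul_zero,
    mul_one, zero_mul, add_zero, zero_add, h0, h1, h2, BracketTree.eval]
  norm_num [brk, zpow_neg, zpow_ofNat]

theorem eval_osp32 (hC : ∀ i j, C.pairing i j = C.pairing j i) (x : I → A) {i j k : I}
    (hi : C.parity i = 0) (hj : C.parity j = 1) (hk : C.parity k = 0)
    (hjj : C.pairing j j = 0) (hji : C.pairing j i = 2) (hjk : C.pairing j k = -1)
    (hkk : C.pairing k k = 1) (hik : C.pairing i k = 0) :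
    (br (br (gen k) (gen j))
        (br (br (gen k) (gen j)) (br (br (gen k) (gen j)) (gen i)))).eval C x =
      brk (1 : GroundField) (brk qElt⁻¹ (x k) (x j)) (brk (-qElt) (brk qElt⁻¹ (x k) (x j))
        (brk (qElt ^ 2) (brk qElt⁻¹ (x k) (x j)) (x i))) ∧
    (br (br (br (gen k) (gen j)) (br (gen k) (br (gen k) (br (gen j) (gen i)))))
          (gen j)).eval C x =
      brk qElt⁻¹ (brk (-qElt) (brk qElt⁻¹ (x k) (x j))
        (brk (1 : GroundField) (x k) (brk qElt⁻¹ (x k) (brk (qElt ^ 2) (x j) (x i))))) (x j) := by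
  have h0 : paritySign 0 = 1 := rfl
  have h1 : paritySign 1 = -1 := rfl
  have h2 : (1 + 1 : ZMod 2) = 0 := rfl
  have hij := (hC i j).trans hji
  have hkj := (hC k j).trans hjk
  have hki := (hC k i).trans hik
  constructor
  all_goals
    simp only [eval_br, parity_gen, parity_br, degPairing_gen, degPairing_br_left,
      degPairing_br_right, hi, hj, hk, hjj, hji, hjk, hik, hij, hkj, hki, hkk, mul_zero,
      mul_one, zero_mul, add_zero, zero_add, h0, h1, h2, BracketTree.eval]
    norm_num [brk, zpow_neg, zpow_ofNat]

end trees

end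

noncomputable section
set_option linter.unusedSectionVars false

namespace Setup

open BracketTree

variable {a u : GroundField}

theorem affDatum_pairing_eq {m n : ℕ} (S : Setup m n) (i j : Fin (rk m n + 1)) :
    S.affDatum.pairing i j =
      paritySign (S.vpar (S.src i)) *
        ((if S.src i = S.src j then 1 else 0) - (if S.src i = (S.src j).rev then 1 else 0) -
          ((if S.src i = S.tgt j then 1 else 0) - (if S.src i = (S.tgt j).rev then 1 else 0))) -
      paritySign (S.vpar (S.tgt i)) *
        ((if S.tgt i = S.src j then 1 else 0) - (if S.tgt i = (S.src j).rev then 1 else 0) -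
          ((if S.tgt i = S.tgt j then 1 else 0) - (if S.tgt i = (S.tgt j).rev then 1 else 0))) := by
  rw [affDatum_pairing]
  simp only [map_sub, AddMonoidHom.sub_apply, pairHom_apply, pairP_wt]
  ring

theorem opE_osp42_odd (S : Setup 4 2) (h1 : S.par 1 = 1) (h2 : S.par 2 = 0) (h3 : S.par 3 = 0)
    {i j k l : Fin (rk 4 2 + 1)} (hi : (i : ℕ) = 0) (hj : (j : ℕ) = 1) (hk : (k : ℕ) = 2)
    (hl : (l : ℕ) = 3) :
    (br (br (br (gen j) (gen i)) (br (gen j) (gen k))) (br (gen j) (gen l))).eval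
        S.affDatum (S.opE a u) =
      (br (br (br (gen j) (gen i)) (br (gen j) (gen l))) (br (gen j) (gen k))).eval
        S.affDatum (S.opE a u) := by
  have si : S.src i = (5 : Fin (4 + 2)) := by simp [src, hi, h1]
  have sj : S.src j = (0 : Fin (4 + 2)) := by simp [src, hj]
  have sk : S.src k = (1 : Fin (4 + 2)) := by simp [src, hk]
  have sl : S.src l = (1 : Fin (4 + 2)) := by
    have : ¬ Odd 4 := by decide
    simp [src, this, hl, h3]
  have ti : S.tgt i = (0 : Fin (4 + 2)) := Fin.ext hi
  have tj : S.tgt j = (1 : Fin (4 + 2)) := Fin.ext hj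
  have tk : S.tgt k = (2 : Fin (4 + 2)) := Fin.ext hk
  have tl : S.tgt l = (3 : Fin (4 + 2)) := Fin.ext hl
  have p0 : S.vpar (0 : Fin (4 + 2)) = 1 := h1
  have p1 : S.vpar (1 : Fin (4 + 2)) = 0 := h2
  have p2 : S.vpar (2 : Fin (4 + 2)) = 0 := h3
  have p3 : S.vpar (3 : Fin (4 + 2)) = 0 := by rw [← vpar_rev]; exact h3
  have p5 : S.vpar (5 : Fin (4 + 2)) = 1 := by rw [← vpar_rev]; exact h1
  have r0 : Fin.rev (0 : Fin (4 + 2)) = 5 := rfl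
  have r1 : Fin.rev (1 : Fin (4 + 2)) = 4 := rfl
  have r2 : Fin.rev (2 : Fin (4 + 2)) = 3 := rfl
  have r3 : Fin.rev (3 : Fin (4 + 2)) = 2 := rfl
  have r5 : Fin.rev (5 : Fin (4 + 2)) = 0 := rfl
  have g0 : paritySign 0 = 1 := rfl
  have g1 : paritySign 1 = -1 := rfl
  have z : (1 + 1 : ZMod 2) = 0 := rfl
  have v1 : S.vsgn (1 : Fin (4 + 2)) = 1 := S.sgn_even _ (mem_Icc _) p1
  have v2 : S.vsgn (2 : Fin (4 + 2)) = 1 := S.sgn_even _ (mem_Icc _) p2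
  have v3 : S.vsgn (3 : Fin (4 + 2)) = 1 := S.sgn_even _ (mem_Icc _) p3
  have ei : S.opE a u i = (a * u) • Matrix.single (5 : Fin (4 + 2)) 0 1 := by
    have := S.Y_long GroundField p5
    rw [r5] at this
    simp [opE, eCoef, si, ti, hi, r0, this]
  have ej : S.opE a u j = Matrix.single (0 : Fin (4 + 2)) 1 1 +
      (S.vsgn (0 : Fin (4 + 2)) : GroundField) • Matrix.single (4 : Fin (4 + 2)) 5 1 := by
    simp [opE, eCoef, sj, tj, hj, r1, r0, Y, xsign, p0, p1, v1, g1, sub_eq_add_neg]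
  have ek : S.opE a u k = Matrix.single (1 : Fin (4 + 2)) 2 1 -
      Matrix.single (3 : Fin (4 + 2)) 4 1 := by
    simp [opE, eCoef, sk, tk, hk, r1, r2, Y, xsign, p1, p2, v1, v2, g0]
  have el : S.opE a u l = Matrix.single (1 : Fin (4 + 2)) 3 1 -
      Matrix.single (2 : Fin (4 + 2)) 4 1 := by
    simp [opE, eCoef, sl, tl, hl, r1, r3, Y, xsign, p1, p3, v1, v3, g0]
  have ci : S.affDatum.parity i = 0 := by rw [affDatum_parity, si, ti, p0, p5, z]
  have cj : S.affDatum.parity j = 1 := by rw [affDatum_parity, sj, tj, p0, p1]; rfl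
  have ck : S.affDatum.parity k = 0 := by rw [affDatum_parity, sk, tk, p1, p2]; rfl
  have cl : S.affDatum.parity l = 0 := by rw [affDatum_parity, sl, tl, p1, p3]; rfl
  have ajj : S.affDatum.pairing j j = 0 := by
    simp [affDatum_pairing_eq, sj, tj, p0, p1, r0, r1, g0, g1]
  have aji : S.affDatum.pairing j i = 2 := by
    simp [affDatum_pairing_eq, si, ti, sj, tj, p0, p1, r0, r5, g0, g1]
  have ajk : S.affDatum.pairing j k = -1 := by
    simp [affDatum_pairing_eq, sj, tj, sk, tk, p0, p1, r1, r2, g0, g1]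
  have ajl : S.affDatum.pairing j l = -1 := by
    simp [affDatum_pairing_eq, sj, tj, sl, tl, p0, p1, r1, r3, g0, g1]
  have aik : S.affDatum.pairing i k = 0 := by
    simp [affDatum_pairing_eq, si, ti, sk, tk, p0, p5, r1, r2, g1]
  have ail : S.affDatum.pairing i l = 0 := by
    simp [affDatum_pairing_eq, si, ti, sl, tl, p0, p5, r1, r3, g1]
  have akl : S.affDatum.pairing k l = 0 := by
    simp [affDatum_pairing_eq, sk, tk, sl, tl, p1, p2, r1, r3, g0]
  have alk := (S.affDatum_pairing_comm _ _).trans akl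
  rw [eval_osp42 S.affDatum_pairing_comm _ ci cj ck cl ajj aji ajk ajl aik ail akl,
    eval_osp42 S.affDatum_pairing_comm _ ci cj cl ck ajj aji ajl ajk ail aik alk]
  exact brk_osp42_odd qElt_ne_zero ei ej ek el

theorem opE_osp42_even (S : Setup 4 2) (h1 : S.par 1 = 0) (h2 : S.par 2 = 0) (h3 : S.par 3 = 1)
    {i j k l : Fin (rk 4 2 + 1)} (hi : (i : ℕ) = 3) (hj : (j : ℕ) = 2) (hk : (k : ℕ) = 0)
    (hl : (l : ℕ) = 1) :
    (br (br (br (gen j) (gen i)) (br (gen j) (gen k))) (br (gen j) (gen l))).eval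
        S.affDatum (S.opE a u) =
      (br (br (br (gen j) (gen i)) (br (gen j) (gen l))) (br (gen j) (gen k))).eval
        S.affDatum (S.opE a u) := by
  have si : S.src i = (2 : Fin (4 + 2)) := by
    have : ¬ Odd 4 := by decide
    simp [src, this, hi, h3]
  have sj : S.src j = (1 : Fin (4 + 2)) := by simp [src, hj]
  have sk : S.src k = (4 : Fin (4 + 2)) := by simp [src, hk, h1]
  have sl : S.src l = (0 : Fin (4 + 2)) := by simp [src, hl]
  have ti : S.tgt i = (3 : Fin (4 + 2)) := Fin.ext hi
  have tj : S.tgt j = (2 : Fin (4 + 2)) := Fin.ext hj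
  have tk : S.tgt k = (0 : Fin (4 + 2)) := Fin.ext hk
  have tl : S.tgt l = (1 : Fin (4 + 2)) := Fin.ext hl
  have p0 : S.vpar (0 : Fin (4 + 2)) = 0 := h1
  have p1 : S.vpar (1 : Fin (4 + 2)) = 0 := h2
  have p2 : S.vpar (2 : Fin (4 + 2)) = 1 := h3
  have p3 : S.vpar (3 : Fin (4 + 2)) = 1 := by rw [← vpar_rev]; exact h3
  have p4 : S.vpar (4 : Fin (4 + 2)) = 0 := by rw [← vpar_rev]; exact h2
  have r0 : Fin.rev (0 : Fin (4 + 2)) = 5 := rfl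
  have r1 : Fin.rev (1 : Fin (4 + 2)) = 4 := rfl
  have r2 : Fin.rev (2 : Fin (4 + 2)) = 3 := rfl
  have r3 : Fin.rev (3 : Fin (4 + 2)) = 2 := rfl
  have r4 : Fin.rev (4 : Fin (4 + 2)) = 1 := rfl
  have g0 : paritySign 0 = 1 := rfl
  have g1 : paritySign 1 = -1 := rfl
  have z : (1 + 1 : ZMod 2) = 0 := rfl
  have v0 : S.vsgn (0 : Fin (4 + 2)) = 1 := S.sgn_even _ (mem_Icc _) p0
  have v1 : S.vsgn (1 : Fin (4 + 2)) = 1 := S.sgn_even _ (mem_Icc _) p1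
  have v4 : S.vsgn (4 : Fin (4 + 2)) = 1 := S.sgn_even _ (mem_Icc _) p4
  have ei : S.opE a u i = Matrix.single (2 : Fin (4 + 2)) 3 1 := by
    have := S.Y_long GroundField p2
    rw [r2] at this
    simp [opE, eCoef, si, ti, hi, r3, this]
  have ej : S.opE a u j = Matrix.single (1 : Fin (4 + 2)) 2 1 -
      (S.vsgn (2 : Fin (4 + 2)) : GroundField) • Matrix.single (3 : Fin (4 + 2)) 4 1 := by
    simp [opE, eCoef, sj, tj, hj, r1, r2, Y, xsign, p1, p2, v1, g0]
  have ek : S.opE a u k = (a * u) • (Matrix.single (4 : Fin (4 + 2)) 0 1 -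
      Matrix.single (5 : Fin (4 + 2)) 1 1) := by
    simp [opE, eCoef, sk, tk, hk, r0, r4, Y, xsign, p0, p4, v0, v4, g0]
  have el : S.opE a u l = Matrix.single (0 : Fin (4 + 2)) 1 1 -
      Matrix.single (4 : Fin (4 + 2)) 5 1 := by
    simp [opE, eCoef, sl, tl, hl, r0, r1, Y, xsign, p0, p1, v0, v1, g0]
  have ci : S.affDatum.parity i = 0 := by rw [affDatum_parity, si, ti, p2, p3, z]
  have cj : S.affDatum.parity j = 1 := by rw [affDatum_parity, sj, tj, p1, p2]; rfl
  have ck : S.affDatum.parity k = 0 := by rw [affDatum_parity, sk, tk, p0, p4]; rfl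
  have cl : S.affDatum.parity l = 0 := by rw [affDatum_parity, sl, tl, p0, p1]; rfl
  have ajj : S.affDatum.pairing j j = 0 := by
    simp [affDatum_pairing_eq, sj, tj, p1, p2, r1, r2, g0, g1]
  have aji : S.affDatum.pairing j i = 2 := by
    simp [affDatum_pairing_eq, si, ti, sj, tj, p1, p2, r2, r3, g0, g1]
  have ajk : S.affDatum.pairing j k = -1 := by
    simp [affDatum_pairing_eq, sj, tj, sk, tk, p1, p2, r0, r4, g0, g1]
  have ajl : S.affDatum.pairing j l = -1 := by
    simp [affDatum_pairing_eq, sj, tj, sl, tl, p1, p2, r0, r1, g0, g1]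
  have aik : S.affDatum.pairing i k = 0 := by
    simp [affDatum_pairing_eq, si, ti, sk, tk, p2, p3, r0, r4, g1]
  have ail : S.affDatum.pairing i l = 0 := by
    simp [affDatum_pairing_eq, si, ti, sl, tl, p2, p3, r0, r1, g1]
  have akl : S.affDatum.pairing k l = 0 := by
    simp [affDatum_pairing_eq, sk, tk, sl, tl, p0, p4, r0, r1, g0]
  have alk := (S.affDatum_pairing_comm _ _).trans akl
  rw [eval_osp42 S.affDatum_pairing_comm _ ci cj ck cl ajj aji ajk ajl aik ail akl,
    eval_osp42 S.affDatum_pairing_comm _ ci cj cl ck ajj aji ajl ajk ail aik alk]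
  exact brk_osp42_even qElt_ne_zero ek el ej ei

theorem qInt_two : qInt 2 = qElt + qElt⁻¹ := by
  rw [qInt, div_eq_inv_mul]
  exact qnum_two

theorem opE_osp32 (S : Setup 3 2) (h1 : S.par 1 = 1) (h2 : S.par 2 = 0)
    {i j k : Fin (rk 3 2 + 1)} (hi : (i : ℕ) = 0) (hj : (j : ℕ) = 1) (hk : (k : ℕ) = 2) :
    (br (br (gen k) (gen j))
        (br (br (gen k) (gen j)) (br (br (gen k) (gen j)) (gen i)))).eval S.affDatum
          (S.opE a u) =
      (1 - qInt 2) •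
        (br (br (br (gen k) (gen j)) (br (gen k) (br (gen k) (br (gen j) (gen i)))))
          (gen j)).eval S.affDatum (S.opE a u) := by
  have ho : Odd 3 := by decide
  have si : S.src i = (4 : Fin (3 + 2)) := by simp [src, hi, h1]
  have sj : S.src j = (0 : Fin (3 + 2)) := by simp [src, hj]
  have sk : S.src k = (1 : Fin (3 + 2)) := by simp [src, hk, ho]
  have ti : S.tgt i = (0 : Fin (3 + 2)) := Fin.ext hi
  have tj : S.tgt j = (1 : Fin (3 + 2)) := Fin.ext hj
  have tk : S.tgt k = (2 : Fin (3 + 2)) := Fin.ext hk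
  have p0 : S.vpar (0 : Fin (3 + 2)) = 1 := h1
  have p1 : S.vpar (1 : Fin (3 + 2)) = 0 := h2
  have p2 : S.vpar (2 : Fin (3 + 2)) = 0 := S.vpar_of_rev_eq rfl
  have p4 : S.vpar (4 : Fin (3 + 2)) = 1 := by rw [← vpar_rev]; exact h1
  have r0 : Fin.rev (0 : Fin (3 + 2)) = 4 := rfl
  have r1 : Fin.rev (1 : Fin (3 + 2)) = 3 := rfl
  have r2 : Fin.rev (2 : Fin (3 + 2)) = 2 := rfl
  have r4 : Fin.rev (4 : Fin (3 + 2)) = 0 := rfl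
  have g0 : paritySign 0 = 1 := rfl
  have g1 : paritySign 1 = -1 := rfl
  have z : (1 + 1 : ZMod 2) = 0 := rfl
  have v1 : S.vsgn (1 : Fin (3 + 2)) = 1 := S.sgn_even _ (mem_Icc _) p1
  have v2 : S.vsgn (2 : Fin (3 + 2)) = 1 := S.sgn_even _ (mem_Icc _) p2
  have ei : S.opE a u i = (a * u) • Matrix.single (4 : Fin (3 + 2)) 0 1 := by
    have := S.Y_long GroundField p4
    rw [r4] at this
    simp [opE, eCoef, si, ti, hi, r0, this]
  have ej : S.opE a u j = Matrix.single (0 : Fin (3 + 2)) 1 1 +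
      (S.vsgn (0 : Fin (3 + 2)) : GroundField) • Matrix.single (3 : Fin (3 + 2)) 4 1 := by
    simp [opE, eCoef, sj, tj, hj, r1, r0, Y, xsign, p0, p1, v1, g1, sub_eq_add_neg]
  have ek : S.opE a u k = Matrix.single (1 : Fin (3 + 2)) 2 1 -
      Matrix.single (2 : Fin (3 + 2)) 3 1 := by
    simp [opE, eCoef, sk, tk, hk, r1, r2, Y, xsign, p1, p2, v1, v2, g0]
  have ci : S.affDatum.parity i = 0 := by rw [affDatum_parity, si, ti, p0, p4, z]
  have cj : S.affDatum.parity j = 1 := by rw [affDatum_parity, sj, tj, p0, p1]; rfl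
  have ck : S.affDatum.parity k = 0 := by rw [affDatum_parity, sk, tk, p1, p2]; rfl
  have ajj : S.affDatum.pairing j j = 0 := by
    simp [affDatum_pairing_eq, sj, tj, p0, p1, r0, r1, g0, g1]
  have aji : S.affDatum.pairing j i = 2 := by
    simp [affDatum_pairing_eq, si, ti, sj, tj, p0, p1, r0, r4, g0, g1]
  have ajk : S.affDatum.pairing j k = -1 := by
    simp [affDatum_pairing_eq, sj, tj, sk, tk, p0, p1, r1, r2, g0, g1]
  have akk : S.affDatum.pairing k k = 1 := by
    simp [affDatum_pairing_eq, sk, tk, p1, p2, r1, r2, g0]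
  have aik : S.affDatum.pairing i k = 0 := by
    simp [affDatum_pairing_eq, si, ti, sk, tk, p0, p4, r1, r2, g1]
  have key := eval_osp32 S.affDatum_pairing_comm (S.opE a u) ci cj ck ajj aji ajk akk aik
  rw [key.1, key.2, qInt_two]
  exact brk_osp32 qElt_ne_zero ei ej ek

end Setup
end

noncomputable section
set_option linter.unusedSectionVars false

/-! ### Sub-data -/

section comap

variable {I J : Type} [DecidableEq I] [DecidableEq J]

/-- The restriction of a Cartan datum. -/
def CartanDatum.comap (C : CartanDatum I) (σ : J → I) : CartanDatum J where
  pairing i j := C.pairing (σ i) (σ j)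
  parity i := C.parity (σ i)

variable {C : CartanDatum I} {σ : J → I}

theorem skewDeriv_map (hσ : Function.Injective σ) (i : J) (w : List J) :
    skewDeriv C (σ i) (w.map σ) = (skewDeriv (C.comap σ) i w).mapDomain (List.map σ) := by
  induction w with
  | nil => simp [skewDeriv]
  | cons j w ih =>
    simp only [List.map_cons, skewDeriv, ih, hσ.eq_iff]
    rw [Finsupp.mapDomain_add, Finsupp.mapDomain_smul, ← Finsupp.mapDomain_comp,
      ← Finsupp.mapDomain_comp]
    congr 1
    split_ifs
    · rw [Finsupp.mapDomain_single]
    · rw [Finsupp.mapDomain_zero]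

theorem wordForm_map (hσ : Function.Injective σ) (x w : List J) :
    wordForm C (x.map σ) (w.map σ) = wordForm (C.comap σ) x w := by
  induction x generalizing w with
  | nil => simp [wordForm]
  | cons i x ih =>
    simp only [List.map_cons, wordForm, skewDeriv_map hσ]
    rw [Finsupp.sum_mapDomain_index (by simp) (by simp [add_mul])]
    simp only [ih]

/-- Words with letters outside the sub-datum have a different content and pair to zero, so testing
against words of the sub-datum is enough. -/
theorem InSerreRadical.map (hσ : Function.Injective σ) {c : List J →₀ GroundField}
    (hc : InSerreRadical (C.comap σ) c) : InSerreRadical C (c.mapDomain (List.map σ)) := by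
  intro x
  rw [Finsupp.sum_mapDomain_index (by simp) (by simp [add_mul])]
  by_cases hx : ∃ y : List J, y.map σ = x
  · obtain ⟨y, rfl⟩ := hx
    simp only [wordForm_map hσ]
    exact hc y
  · refine Finset.sum_eq_zero fun w _ => mul_eq_zero_of_right _ ?_
    by_contra h
    have hp := perm_of_wordForm_ne_zero h
    apply hx
    have : ∀ i ∈ x, i ∈ Set.range σ := by
      intro i hi
      have := hp.subset hi
      rw [List.mem_map] at this
      exact this.imp fun _ h => h.2
    rw [← Set.mem_range, Set.range_list_map]
    exact this

variable {A B : Type} [Ring A] [Algebra GroundField A] [Ring B] [Algebra GroundField B]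

theorem evalWords_mapDomain (x : I → A) (c : List J →₀ GroundField) :
    evalWords x (c.mapDomain (List.map σ)) = evalWords (fun j => x (σ j)) c := by
  rw [evalWords, Finsupp.sum_mapDomain_index (by simp) (by simp [add_smul])]
  simp [evalWords, Function.comp_def]

theorem ChevalleySerreRel.of_comap (hσ : Function.Injective σ) {e f t t' : I → A} {x y : A}
    (h : ChevalleySerreRel (C.comap σ) (fun j => e (σ j)) (fun j => f (σ j)) (fun j => t (σ j))
      (fun j => t' (σ j)) x y) : ChevalleySerreRel C e f t t' x y := by
  cases h with
  | t_comm i j => exact .t_comm _ _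
  | t_mul_inv i => exact .t_mul_inv _
  | inv_mul_t i => exact .inv_mul_t _
  | t_e i j => exact .t_e _ _
  | t_f i j => exact .t_f _ _
  | e_f i j =>
    have := ChevalleySerreRel.e_f (C := C) (e := e) (f := f) (t := t) (t' := t') (σ i) (σ j)
    simp only [hσ.eq_iff] at this
    exact this
  | serre_e c hc =>
    rw [← evalWords_mapDomain]
    exact .serre_e _ (hc.map hσ)
  | serre_f c hc =>
    rw [← evalWords_mapDomain]
    exact .serre_f _ (hc.map hσ)

theorem map_evalWords (φ : A →ₐ[GroundField] B) (x : I → A) (c : List I →₀ GroundField) :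
    φ (evalWords x c) = evalWords (fun i => φ (x i)) c := by
  simp [evalWords, Finsupp.sum, map_list_prod, Function.comp_def]

theorem ChevalleySerreRel.map (φ : A →ₐ[GroundField] B) {e f t t' : I → A} {x y : A}
    (h : ChevalleySerreRel C e f t t' x y) :
    ChevalleySerreRel C (fun i => φ (e i)) (fun i => φ (f i)) (fun i => φ (t i))
      (fun i => φ (t' i)) (φ x) (φ y) := by
  cases h with
  | t_comm i j => simp only [map_mul]; exact .t_comm _ _
  | t_mul_inv i => simp only [map_mul, map_one]; exact .t_mul_inv _
  | inv_mul_t i => simp only [map_mul, map_one]; exact .inv_mul_t _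
  | t_e i j => simp only [map_mul, map_smul]; exact .t_e _ _
  | t_f i j => simp only [map_mul, map_smul]; exact .t_f _ _
  | e_f i j =>
    have := ChevalleySerreRel.e_f (C := C) (e := fun i => φ (e i)) (f := fun i => φ (f i))
      (t := fun i => φ (t i)) (t' := fun i => φ (t' i)) i j
    simp only [apply_ite φ, map_sub, map_mul, map_smul, map_zsmul, map_pow, map_zero]
    exact this
  | serre_e c hc => rw [map_evalWords, map_zero]; exact .serre_e _ hc
  | serre_f c hc => rw [map_evalWords, map_zero]; exact .serre_f _ hc

end comap

/-! ### Parity of operators -/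

namespace Setup

variable {m n : ℕ} (S : Setup m n)

theorem hasParity_one : S.HasParity 0 1 := by
  intro c d h
  have : c = d := by
    by_contra h'
    exact h (Matrix.one_apply_ne h')
  rw [this]
  exact CharTwo.add_self_eq_zero _

variable {S}

theorem HasParity.mul {r s : ZMod 2} {M N : Mat m n GroundField} (hM : S.HasParity r M)
    (hN : S.HasParity s N) : S.HasParity (r + s) (M * N) := by
  intro c d h
  rw [Matrix.mul_apply] at h
  obtain ⟨e, -, he⟩ := Finset.exists_ne_zero_of_sum_ne_zero h
  rw [← hM c e (left_ne_zero_of_mul he), ← hN e d (right_ne_zero_of_mul he)]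
  have : ∀ p q r : ZMod 2, p + r = p + q + (q + r) := by decide
  exact this _ _ _

theorem hasParity_of_mem_gradedPart {G A : Type} [Ring A] [Algebra GroundField A]
    {p : G → ZMod 2} {x : G → A} (φ : A →ₐ[GroundField] Mat m n GroundField)
    (h : ∀ g, S.HasParity (p g) (φ (x g))) (r : ZMod 2) (y : A) (hy : y ∈ gradedPart p x r) :
    S.HasParity r (φ y) := by
  induction hy using Submodule.span_induction with
  | mem y hy =>
    obtain ⟨l, rfl, rfl⟩ := hy
    induction l with
    | nil => simpa using S.hasParity_one
    | cons g l ih =>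
      rw [List.map_cons, List.map_cons, List.sum_cons, List.prod_cons, map_mul]
      exact (h g).mul ih
  | zero => intro c d h; simp at h
  | add y z _ _ hy hz =>
    intro c d h
    rw [map_add, Matrix.add_apply] at h
    by_cases h' : φ y c d = 0
    · rw [h', zero_add] at h
      exact hz c d h
    · exact hy c d h'
  | smul k y _ hy =>
    intro c d h
    rw [map_smul, Matrix.smul_apply] at h
    exact hy c d (right_ne_zero_of_mul h)

end Setup
end

noncomputable section
set_option linter.unusedSectionVars false

namespace Setup

variable {m n : ℕ} (S : Setup m n) {u a b : GroundField}

/-! ### The toral generators -/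

/-- The exponents of `q^{h_i / 2}`. -/
def torExp (i : Fin (rk m n + 1)) (c : Fin (m + n)) : ℤ := S.pairHom (S.alphaHat i).2 (S.wt c)

/-- The operator of `q^{h_i / 2}`. -/
def opT (i : Fin (rk m n + 1)) : Mat m n GroundField :=
  Matrix.diagonal fun c => qHalf ^ S.torExp i c

/-- The operator of `q^{-h_i / 2}`. -/
def opTInv (i : Fin (rk m n + 1)) : Mat m n GroundField :=
  Matrix.diagonal fun c => qHalf ^ (-S.torExp i c)

theorem qHalf_ne_zero : qHalf ≠ 0 := RatFunc.X_ne_zero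

theorem conj_diagonal {ι : Type} [Fintype ι] [DecidableEq ι] {M : Matrix ι ι GroundField}
    (g : ι → ℤ) (k : ℤ) (h : ∀ c d, M c d ≠ 0 → g c - g d = k) :
    Matrix.diagonal (fun c => qHalf ^ g c) * M * Matrix.diagonal (fun c => qHalf ^ (-g c)) =
      qHalf ^ k • M := by
  ext c d
  rw [Matrix.mul_diagonal, Matrix.diagonal_mul, Matrix.smul_apply, smul_eq_mul]
  by_cases h0 : M c d = 0
  · simp [h0]
  · rw [← h c d h0, sub_eq_add_neg, zpow_add₀ qHalf_ne_zero]
    ring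

theorem opT_mul_inv (i : Fin (rk m n + 1)) : S.opT i * S.opTInv i = 1 := by
  rw [opT, opTInv, Matrix.diagonal_mul_diagonal, ← Matrix.diagonal_one]
  congr 1
  funext c
  rw [← zpow_add₀ qHalf_ne_zero, add_neg_cancel, zpow_zero]

theorem opTInv_mul (i : Fin (rk m n + 1)) : S.opTInv i * S.opT i = 1 := by
  rw [opT, opTInv, Matrix.diagonal_mul_diagonal, ← Matrix.diagonal_one]
  congr 1
  funext c
  rw [← zpow_add₀ qHalf_ne_zero, neg_add_cancel, zpow_zero]

variable {S}

/-- All relations among the Chevalley generators hold on the natural module. -/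
theorem chevalleySerre_natural (hu : u ≠ 0) (ha : a ≠ 0) (hb : b ≠ 0)
    (hab_odd : S.par 1 = 1 → a * b = -(qElt + qElt⁻¹))
    (hab_even : S.par 1 = 0 → a * b = (S.psign 2 : GroundField)) {x y : Mat m n GroundField}
    (h : ChevalleySerreRel S.affDatum (S.opE a u) (S.opF b u) S.opT S.opTInv x y) : x = y := by
  have hq : ∀ k : ℤ, (qHalf ^ k) ^ 2 = qElt ^ k := fun k => by
    rw [qElt, ← zpow_natCast, ← zpow_mul, ← zpow_natCast qHalf 2, ← zpow_mul, mul_comm]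
  cases h with
  | t_comm i j =>
    rw [opT, opT, Matrix.diagonal_mul_diagonal, Matrix.diagonal_mul_diagonal]
    simp only [mul_comm]
  | t_mul_inv i => exact S.opT_mul_inv i
  | inv_mul_t i => exact S.opTInv_mul i
  | t_e i j =>
    refine conj_diagonal _ _ fun c d h => ?_
    rw [torExp, torExp, ← map_sub, (opE_wt j c d h).1, ← alphaHat_eq]
    rfl
  | t_f i j =>
    refine conj_diagonal _ _ fun c d h => ?_
    rw [torExp, torExp, ← map_sub, (opF_wt j c d h).1, ← neg_sub, map_neg, ← alphaHat_eq]
    rfl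
  | e_f i j =>
    have := (S.naturalRep hu hab_odd hab_even).e_f i j
    rw [Int.cast_smul_eq_zsmul] at this
    refine this.trans ?_
    split_ifs
    · rw [opT, opTInv, Matrix.diagonal_pow, Matrix.diagonal_pow]
      congr 3
      · funext c
        exact (hq _).symm
      · funext c
        exact (hq _).symm
    · rfl
  | serre_e c hc => exact evalWords_opE_eq_zero hu hb hab_odd hab_even hc
  | serre_f c hc =>
    -- The $f_i$ are rescaled images of the $e_i$ under an algebra automorphism, so the same radical
    -- kills them.
    obtain ⟨d, hd⟩ := exists_opF_eq (b := b) hu ha S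
    rw [hd]
    exact evalWords_rescale_eq_zero _ _ _ _
      (fun c hc => evalWords_opE_eq_zero hu hb hab_odd hab_even hc) hc

/-- The exponents are the pairings of weights with $\alpha_0+\sum_ik_i\alpha_i=\delta$, and $\delta$
is orthogonal to everything. -/
theorem gamma_natural (k : Fin (rk m n) → ℕ) (hk : S.theta = ∑ i, k i • S.alpha (i + 1)) :
    S.opT 0 * (List.ofFn fun i : Fin (rk m n) => S.opT i.succ ^ k i).prod = 1 := by
  have h1 : (List.ofFn fun i : Fin (rk m n) => S.opT i.succ ^ k i).prod =
      Matrix.diagonal (∏ i : Fin (rk m n), (fun c => qHalf ^ S.torExp i.succ c) ^ k i) := by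
    have := map_list_prod (Matrix.diagonalRingHom (Fin (m + n)) GroundField)
      (List.ofFn fun i : Fin (rk m n) => (fun c => qHalf ^ S.torExp i.succ c) ^ k i)
    rw [List.prod_ofFn, List.map_ofFn] at this
    refine Eq.trans ?_ this.symm
    congr 2
    funext i
    rw [Function.comp_apply, map_pow]
    rfl
  rw [h1, opT, Matrix.diagonal_mul_diagonal, ← Matrix.diagonal_one]
  congr 1
  funext c
  have h2 : S.torExp 0 c + ∑ i : Fin (rk m n), (k i : ℤ) * S.torExp i.succ c = 0 := by
    have h3 : (S.alphaHat 0).2 = -S.theta := rfl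
    have h4 : ∀ i : Fin (rk m n), (S.alphaHat i.succ).2 = S.alpha (i + 1) := fun i => by
      simp [alphaHat]
    simp only [torExp, h3, h4, hk, map_neg, map_sum, map_nsmul, AddMonoidHom.neg_apply,
      AddMonoidHom.finsetSum_apply, AddMonoidHom.nsmul_apply]
    simp only [nsmul_eq_mul, neg_add_cancel]
  rw [Finset.prod_apply]
  simp only [Pi.pow_apply, ← zpow_natCast, ← zpow_mul]
  have h5 : ∀ (s : Finset (Fin (rk m n))) (g : Fin (rk m n) → ℤ),
      ∏ i ∈ s, qHalf ^ g i = qHalf ^ ∑ i ∈ s, g i := by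
    intro s g
    induction s using Finset.induction_on with
    | empty => simp
    | insert i s hi ih =>
      rw [Finset.prod_insert hi, Finset.sum_insert hi, ih, zpow_add₀ qHalf_ne_zero]
  rw [h5, ← zpow_add₀ qHalf_ne_zero]
  simp only [mul_comm _ (k _ : ℤ)]
  rw [h2, zpow_zero]

/-! ### Comparison with the Chevalley generators of `osp(V)` -/

/-- The pairs `(a, b)` with `α_i = ε_a - ε_b`, for the nodes of `osp(V)`. -/
theorem succ_cases (i : Fin (rk m n)) :
    ((Odd m ∨ (i : ℕ) + 1 < rk m n) ∧ (S.src i.succ : ℕ) = i ∧ (S.tgt i.succ : ℕ) = i + 1 ∧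
      S.src i.succ ≠ (S.tgt i.succ).rev ∧ ¬ (Even m ∧ S.par (rk m n) = 1 ∧ (i : ℕ) + 1 = rk m n)) ∨
    (¬ (Odd m ∨ (i : ℕ) + 1 < rk m n) ∧ S.par (rk m n) = 0 ∧ (i : ℕ) + 1 = rk m n ∧
      (S.src i.succ : ℕ) + 1 = rk m n - 1 ∧ (S.tgt i.succ : ℕ) = rk m n ∧
      S.src i.succ ≠ (S.tgt i.succ).rev) ∨
    (¬ (Odd m ∨ (i : ℕ) + 1 < rk m n) ∧ S.par (rk m n) = 1 ∧ (i : ℕ) + 1 = rk m n ∧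
      (S.src i.succ : ℕ) + 1 = rk m n ∧ (S.tgt i.succ : ℕ) = rk m n ∧
      S.src i.succ = (S.tgt i.succ).rev ∧ Even m) := by
  have hN := S.two_lt
  have ho := S.odd_iff
  have hi := i.2
  have ht : (S.tgt i.succ : ℕ) = i + 1 := rfl
  have hc := S.node_cases i.succ
  rw [← Nat.not_odd_iff_even, ho]
  simp only [ne_eq, Fin.ext_iff, Fin.val_rev, Fin.val_succ] at hc ⊢
  rcases hc with h | h | h | h | h
  · lia
  · lia
  · left
    refine ⟨h.1, by lia, ht, by unfold rk at *; lia, by lia⟩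
  · right; left
    exact ⟨by lia, h.2.2.1, by lia, by lia, by lia, by unfold rk at *; lia⟩
  · right; right
    exact ⟨by lia, h.2.2.1, by lia, by lia, by lia, by unfold rk at *; lia, by lia⟩

theorem opE_succ (i : Fin (rk m n)) : S.opE a u i.succ = S.matE (i + 1) := by
  have h0 : ¬ (i.succ : ℕ) = 0 := by simp
  rw [opE, eCoef, if_neg h0, one_mul, matE]
  rcases S.succ_cases i with ⟨h1, h2, h3, h4, -⟩ | ⟨h1, h2, h3, h4, h5, h6⟩ |
    ⟨h1, h2, h3, h4, h5, h6, -⟩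
  · rw [if_neg h4, one_smul, if_pos h1, S.X_eq GroundField (S.src i.succ) (S.tgt i.succ)] <;> lia
  · rw [if_neg h6, one_smul, if_neg h1, if_pos h2,
      S.X_eq GroundField (S.src i.succ) (S.tgt i.succ)] <;> lia
  · have h7 := S.Y_long GroundField (S.vpar_of_long h6)
    rw [show (S.src i.succ).rev = S.tgt i.succ by rw [h6, Fin.rev_rev]] at h7
    rw [if_pos h6, if_neg h1, if_neg (by rw [h2]; decide), h7, smul_smul,
      inv_mul_cancel₀ two_ne_zero, one_smul,
      E_eq_single GroundField (S.src i.succ) (S.tgt i.succ) _ _ h4.symm (by lia)]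

/-- The coefficient for the long root is where $\kappa_s$ comes from: $\kappa_s\cdot(-2)$ must equal
$-(q+q^{-1})$. -/
theorem opF_succ (i : Fin (rk m n)) :
    S.opF b u i.succ = S.kappa (i + 1) • S.matF (i + 1) := by
  have h0 : ¬ (i.succ : ℕ) = 0 := by simp
  rw [opF, fCoef, if_neg h0, matF, kappa]
  rcases S.succ_cases i with ⟨h1, h2, h3, h4, h5⟩ | ⟨h1, h2, h3, h4, h5, h6⟩ |
    ⟨h1, h2, h3, h4, h5, h6, h7⟩
  · rw [if_neg h4, if_neg h5, one_smul, if_pos h1,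
      S.X_eq GroundField (S.tgt i.succ) (S.src i.succ) _ _ (by lia) (by lia),
      ← Int.cast_smul_eq_zsmul GroundField, psign, vpar, h2]
  · rw [if_neg h6, if_neg fun h => by simp [h2] at h, one_smul, if_neg h1, if_pos h2,
      S.X_eq GroundField (S.tgt i.succ) (S.src i.succ) _ _ (by lia) (by lia),
      ← Int.cast_smul_eq_zsmul GroundField, psign, vpar, h4]
  · have h8 : S.vpar (S.tgt i.succ) = 1 := by rw [← vpar_rev, ← h6, S.vpar_of_long h6]
    have h9 := S.Y_long GroundField h8
    rw [← h6] at h9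
    rw [if_pos h6, if_pos ⟨h7, h2, h3⟩, if_neg h1, if_neg (by rw [h2]; decide), h9,
      E_eq_single GroundField (S.tgt i.succ) (S.src i.succ) _ _ (by lia) h4.symm,
      ← Int.cast_smul_eq_zsmul GroundField, smul_smul, smul_smul]
    congr 1
    push_cast
    ring

theorem psign_X_apply {k : ℕ} (h1 : 1 ≤ k) (h2 : k ≤ m + n) (c : Fin (m + n)) :
    S.psign k * S.X ℤ k k c c = S.pairHom (S.eps k) (S.wt c) := by
  obtain ⟨x, rfl⟩ : ∃ x : Fin (m + n), k = x + 1 := ⟨⟨k - 1, by lia⟩, by simp; lia⟩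
  rw [S.X_eq ℤ x x _ _ rfl rfl, Y_apply, xsign_self, pairHom_apply]
  change _ = S.pairP (S.wt x) (S.wt c)
  rw [pairP_wt]
  have h3 : x.rev = c ∧ x.rev = c ↔ x = c.rev := by
    rw [and_self]
    constructor
    · rintro rfl; simp
    · rintro rfl; simp
  simp only [h3, and_self, Int.cast_one, one_mul]
  rfl

theorem matH_apply (i : Fin (rk m n)) (c : Fin (m + n)) :
    S.matH (i + 1) c c = S.torExp i.succ c := by
  have hi := i.2
  have hN := S.two_lt
  have hk : rk m n ≤ m + n := by unfold rk; lia
  have h3 : (S.alphaHat i.succ).2 = S.alpha (i + 1) := by simp [alphaHat]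
  rw [torExp, h3, alpha, matH]
  have ho := S.odd_iff
  split_ifs with h1 h2
  · rw [map_sub, AddMonoidHom.sub_apply, ← S.psign_X_apply, ← S.psign_X_apply]
    · rfl
    all_goals unfold rk at *; lia
  · rw [map_sub, AddMonoidHom.sub_apply, ← S.psign_X_apply, ← S.psign_X_apply]
    · rfl
    all_goals unfold rk at *; lia
  · have h4 : S.psign (rk m n) = -1 := by
      rw [psign, (zmod2_cases _).resolve_left h2]; rfl
    rw [map_nsmul, AddMonoidHom.nsmul_apply, ← S.psign_X_apply (by lia) hk, h4,
      Matrix.smul_apply]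
    simp

theorem opT_succ (i : Fin (rk m n)) : S.opT i.succ = qHalfPow (S.matH (i + 1)) := by
  rw [opT, qHalfPow]
  simp only [matH_apply]

theorem opTInv_succ (i : Fin (rk m n)) : S.opTInv i.succ = qHalfPow (-S.matH (i + 1)) := by
  rw [opTInv, qHalfPow]
  simp only [Matrix.neg_apply, matH_apply]

theorem src_zero_odd (h : S.par 1 = 1) : (S.src 0 : ℕ) + 1 = m + n ∧
    S.src 0 = (S.tgt 0).rev := by
  have hN := S.two_lt
  have ht : (S.tgt 0 : ℕ) = 0 := rfl
  have hc := S.node_cases 0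
  simp only [h, one_ne_zero, Fin.val_zero] at hc
  rw [Fin.ext_iff, Fin.val_rev]
  unfold rk at hc
  lia

theorem src_zero_even (h : S.par 1 = 0) : (S.src 0 : ℕ) + 2 = m + n ∧
    S.src 0 ≠ (S.tgt 0).rev := by
  have hN := S.two_lt
  have ht : (S.tgt 0 : ℕ) = 0 := rfl
  have hc := S.node_cases 0
  simp only [h, zero_ne_one, Fin.val_zero] at hc
  rw [Ne, Fin.ext_iff, Fin.val_rev]
  unfold rk at hc
  lia

theorem opE_zero_odd (h : S.par 1 = 1) :
    S.opE a u 0 = (a * u) • E m n GroundField (S.prime 1) 1 := by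
  obtain ⟨h1, h2⟩ := src_zero_odd h
  have h7 := S.Y_long GroundField (S.vpar_of_long h2)
  rw [show (S.src 0).rev = S.tgt 0 by rw [h2, Fin.rev_rev]] at h7
  rw [opE, eCoef, if_pos h2, if_pos (Fin.val_zero _), h7, smul_smul, mul_assoc, inv_mul_cancel₀ two_ne_zero,
    mul_one, E_eq_single GroundField (S.src 0) (S.tgt 0) _ 1 (by unfold prime; lia) rfl]

theorem opF_zero_odd (h : S.par 1 = 1) :
    S.opF b u 0 = (b * u⁻¹) • E m n GroundField 1 (S.prime 1) := by
  obtain ⟨h1, h2⟩ := src_zero_odd h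
  have h8 : S.vpar (S.tgt 0) = 1 := by rw [← vpar_rev, ← h2, S.vpar_of_long h2]
  have h7 := S.Y_long GroundField h8
  rw [← h2] at h7
  rw [opF, fCoef, if_pos h2, if_pos (Fin.val_zero _), h7, smul_smul, mul_assoc, inv_mul_cancel₀ two_ne_zero,
    mul_one, E_eq_single GroundField (S.tgt 0) (S.src 0) 1 _ rfl (by unfold prime; lia)]

theorem opE_zero_even (h : S.par 1 = 0) :
    S.opE a u 0 = (a * u) • S.X GroundField (S.prime 2) 1 := by
  obtain ⟨h1, h2⟩ := src_zero_even h
  rw [opE, eCoef, if_neg h2, if_pos (Fin.val_zero _), mul_one,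
    S.X_eq GroundField (S.src 0) (S.tgt 0) _ 1 (by unfold prime; lia) rfl]

theorem opF_zero_even (h : S.par 1 = 0) :
    S.opF b u 0 = (b * u⁻¹) • S.X GroundField 1 (S.prime 2) := by
  obtain ⟨h1, h2⟩ := src_zero_even h
  rw [opF, fCoef, if_neg h2, if_pos (Fin.val_zero _), mul_one,
    S.X_eq GroundField (S.tgt 0) (S.src 0) 1 _ rfl (by unfold prime; lia)]

theorem torExp_zero_odd (h : S.par 1 = 1) (c : Fin (m + n)) :
    S.torExp 0 c = ((2 : ℤ) • S.X ℤ 1 1) c c := by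
  have hN := S.two_lt
  have h3 : (S.alphaHat 0).2 = -S.theta := rfl
  have h4 : S.psign 1 = -1 := by rw [psign, h]; rfl
  rw [torExp, h3, theta, if_neg (by rw [h]; decide), map_neg, map_nsmul, AddMonoidHom.neg_apply,
    AddMonoidHom.nsmul_apply, ← S.psign_X_apply le_rfl (by lia), h4, Matrix.smul_apply]
  simp

theorem torExp_zero_even (h : S.par 1 = 0) (c : Fin (m + n)) :
    S.torExp 0 c = -(S.psign 1 • S.X ℤ 1 1 + S.psign 2 • S.X ℤ 2 2) c c := by
  have hN := S.two_lt
  have h3 : (S.alphaHat 0).2 = -S.theta := rfl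
  rw [torExp, h3, theta, if_pos h, map_neg, map_add, AddMonoidHom.neg_apply,
    AddMonoidHom.add_apply, ← S.psign_X_apply le_rfl (by lia), ← S.psign_X_apply (by lia) (by lia)]
  rfl

/-! ### The explicit relations -/

theorem explicitSerre_opE (hu : u ≠ 0) (hb : b ≠ 0)
    (hab_odd : S.par 1 = 1 → a * b = -(qElt + qElt⁻¹))
    (hab_even : S.par 1 = 0 → a * b = (S.psign 2 : GroundField)) :
    S.ExplicitSerre (S.opE a u) := by
  have hx : ∀ c, InSerreRadical S.affDatum c → evalWords (S.opE a u) c = 0 :=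
    fun c hc => evalWords_opE_eq_zero hu hb hab_odd hab_even hc
  refine ⟨fun i j h => eval_gen_gen_eq_zero S.affDatum_pairing_comm _ hx h,
    fun i j r hij h0 h => eval_iterate_eq_zero S.affDatum_pairing_comm _ hx hij r h
      (parity_zero_or_even h0 h),
    fun i j k hij hik hjk _ _ _ h hp => eval_triangle S.affDatum_pairing_comm _ hx hij hik hjk h hp,
    ?_, ?_⟩
  · rintro rfl rfl i j k l (h | h)
    · exact opE_osp42_odd S h.1 h.2.1 h.2.2.1 h.2.2.2.1 h.2.2.2.2.1 h.2.2.2.2.2.1 h.2.2.2.2.2.2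
    · exact opE_osp42_even S h.1 h.2.1 h.2.2.1 h.2.2.2.1 h.2.2.2.2.1 h.2.2.2.2.2.1 h.2.2.2.2.2.2
  · rintro rfl rfl h1 h2 i j k hi hj hk
    exact opE_osp32 S h1 h2 hi hj hk

theorem explicitSerre_opF (hu : u ≠ 0) (ha : a ≠ 0) (hb : b ≠ 0)
    (hab_odd : S.par 1 = 1 → a * b = -(qElt + qElt⁻¹))
    (hab_even : S.par 1 = 0 → a * b = (S.psign 2 : GroundField)) :
    S.ExplicitSerre (S.opF b u) := by
  obtain ⟨d, hd⟩ := exists_opF_eq (b := b) hu ha S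
  have hE := explicitSerre_opE hu hb hab_odd hab_even
  have hx : ∀ c, InSerreRadical S.affDatum c → evalWords (S.opF b u) c = 0 := by
    rw [hd]
    exact fun c hc => evalWords_rescale_eq_zero _ _ _ _
      (fun c hc => evalWords_opE_eq_zero hu hb hab_odd hab_even hc) hc
  refine ⟨fun i j h => eval_gen_gen_eq_zero S.affDatum_pairing_comm _ hx h,
    fun i j r hij h0 h => eval_iterate_eq_zero S.affDatum_pairing_comm _ hx hij r h
      (parity_zero_or_even h0 h),
    fun i j k hij hik hjk _ _ _ h hp => eval_triangle S.affDatum_pairing_comm _ hx hij hik hjk h hp,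
    ?_, ?_⟩
  · intro h1 h2 i j k l h
    -- Rescaling multiplies each side by the product over its leaves. Both sides use the same
    -- generators with the same multiplicities, so these products agree.
    rw [hd, eval_rescale, eval_rescale, hE.osp42 h1 h2 i j k l h]
    congr 1
    simp only [BracketTree.leaves, List.map_append, List.prod_append, List.map_cons, List.map_nil,
      List.prod_cons, List.prod_nil]
    ring
  · intro h1 h2 h3 h4 i j k hi hj hk
    rw [hd, eval_rescale, eval_rescale, hE.osp32 h1 h2 h3 h4 i j k hi hj hk, map_smul, smul_comm]
    congr 2
    simp only [BracketTree.leaves, List.map_append, List.prod_append, List.map_cons, List.map_nil,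
      List.prod_cons, List.prod_nil]
    ring

end Setup
end

noncomputable section
set_option linter.unusedSectionVars false

namespace Setup

variable {m n : ℕ} (S : Setup m n)

/-! ### The representations -/

/-- The operators of the Chevalley generators. -/
def chevOp (a b u : GroundField) : ChevGen (Fin (rk m n + 1)) → Mat m n GroundField
  | .e i => S.opE a u i
  | .f i => S.opF b u i
  | .t i => S.opT i
  | .tInv i => S.opTInv i

/-- The operators of the generators of the affine algebra. -/
def affOp (a b u : GroundField) : AffGen (Fin (rk m n + 1)) → Mat m n GroundField
  | .chev g => S.chevOp a b u g
  | .gam => 1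
  | .gamInv => 1

/-- The node of the affine diagram for a node of the finite diagram. -/
def succGen : ChevGen (Fin (rk m n)) → ChevGen (Fin (rk m n + 1))
  | .e i => .e i.succ
  | .f i => .f i.succ
  | .t i => .t i.succ
  | .tInv i => .tInv i.succ

theorem finDatum_eq : S.finDatum = S.affDatum.comap Fin.succ := by
  have h : ∀ i : Fin (rk m n), (S.alphaHat i.succ).2 = S.alpha (i + 1) := fun i => by
    simp [alphaHat]
  simp only [finDatum, CartanDatum.comap, affDatum, h]

theorem parity_succGen (g : ChevGen (Fin (rk m n))) :
    g.parity S.finDatum = (succGen g).parity S.affDatum := by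
  rw [finDatum_eq]
  cases g <;> rfl

variable {S} {a b u : GroundField}

theorem chevOp_hasParity (g : ChevGen (Fin (rk m n + 1))) :
    S.HasParity (g.parity S.affDatum) (S.chevOp a b u g) := by
  have hdiag : ∀ g : Fin (m + n) → GroundField, S.HasParity 0 (Matrix.diagonal g) := by
    intro g c d h
    have : c = d := by
      by_contra h'
      exact h (Matrix.diagonal_apply_ne _ h')
    rw [this]
    exact CharTwo.add_self_eq_zero _
  cases g with
  | e i =>
    intro c d h
    change _ = S.affDatum.parity i
    rw [affDatum_parity]
    exact (opE_wt i c d h).2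
  | f i =>
    intro c d h
    change _ = S.affDatum.parity i
    rw [affDatum_parity, add_comm (S.vpar (S.src i))]
    exact (opF_wt i c d h).2
  | t i => exact hdiag _
  | tInv i => exact hdiag _

theorem affOp_hasParity (g : AffGen (Fin (rk m n + 1))) :
    S.HasParity (g.parity S.affDatum) (S.affOp a b u g) := by
  cases g with
  | chev g => exact chevOp_hasParity g
  | gam => exact S.hasParity_one
  | gamInv => exact S.hasParity_one

/-- The representation of `U_q(osp(V))` on `V`. -/
theorem exists_finRep (hu : u ≠ 0) (ha : a ≠ 0) (hb : b ≠ 0)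
    (hab_odd : S.par 1 = 1 → a * b = -(qElt + qElt⁻¹))
    (hab_even : S.par 1 = 0 → a * b = (S.psign 2 : GroundField)) :
    ∃ ρ : S.Uq →ₐ[GroundField] Mat m n GroundField,
      ∀ g, ρ (S.finGen g) = S.chevOp a b u (succGen g) := by
  let φ := FreeAlgebra.lift GroundField fun g : ChevGen (Fin (rk m n)) =>
    S.chevOp a b u (succGen g)
  have hφ : ∀ ⦃x y⦄, S.FinRel x y → φ x = φ y := by
    intro x y h
    have h1 := ChevalleySerreRel.map φ h
    simp only [φ, FreeAlgebra.lift_ι_apply] at h1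
    rw [finDatum_eq] at h1
    exact chevalleySerre_natural hu ha hb hab_odd hab_even
      (ChevalleySerreRel.of_comap (Fin.succ_injective _) h1)
  refine ⟨RingQuot.liftAlgHom GroundField ⟨φ, hφ⟩, fun g => ?_⟩
  rw [finGen, RingQuot.liftAlgHom_mkAlgHom_apply]
  exact FreeAlgebra.lift_ι_apply _ _

/-- The representation of the affine algebra on `V`. -/
theorem exists_affRep (hu : u ≠ 0) (ha : a ≠ 0) (hb : b ≠ 0)
    (hab_odd : S.par 1 = 1 → a * b = -(qElt + qElt⁻¹))
    (hab_even : S.par 1 = 0 → a * b = (S.psign 2 : GroundField)) :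
    ∃ ρ : S.UqAff →ₐ[GroundField] Mat m n GroundField,
      ∀ g, ρ (S.affGen g) = S.affOp a b u g := by
  let φ := FreeAlgebra.lift GroundField (S.affOp a b u)
  have hι : ∀ g, φ (FreeAlgebra.ι GroundField g) = S.affOp a b u g :=
    FreeAlgebra.lift_ι_apply _
  have hφ : ∀ ⦃x y⦄, S.AffRel x y → φ x = φ y := by
    intro x y h
    cases h with
    | chev_serre x y h =>
      have h1 := ChevalleySerreRel.map φ h
      simp only [hι] at h1
      exact chevalleySerre_natural hu ha hb hab_odd hab_even h1
    | gam_mul_inv => simp [hι, affOp]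
    | inv_mul_gam => simp [hι, affOp]
    | gam_eq k hk =>
      rw [map_mul, map_list_prod, List.map_ofFn, hι, hι]
      have : (⇑φ ∘ fun i : Fin (rk m n) =>
          FreeAlgebra.ι GroundField (AffGen.chev (ChevGen.t i.succ)) ^ k i) =
          fun i => S.opT i.succ ^ k i := by
        funext i
        rw [Function.comp_apply, map_pow, hι]
        rfl
      rw [this]
      exact (gamma_natural k hk).symm
    | gam_central x => simp [hι, affOp]
  refine ⟨RingQuot.liftAlgHom GroundField ⟨φ, hφ⟩, fun g => ?_⟩
  rw [affGen, RingQuot.liftAlgHom_mkAlgHom_apply]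
  exact hι g

end Setup
end

end QOsp

/-! ### The natural module of the affine algebra -/

theorem proposition6p1 {m n : ℕ} (S : QOsp.Setup m n) (u a b : QOsp.GroundField)
    (hu : u ≠ 0) (ha : a ≠ 0) (hb : b ≠ 0)
    (hab_odd : S.par 1 = 1 → a * b = -(QOsp.qElt + QOsp.qElt⁻¹))
    (hab_even : S.par 1 = 0 → a * b = (S.psign 2 : QOsp.GroundField)) :
    ∃ ρ : S.Uq →ₐ[QOsp.GroundField] QOsp.Mat m n QOsp.GroundField,
      -- the action of the finite quantum supergroup on V
      (∀ i : Fin (QOsp.rk m n),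
        ρ (S.finGen (.e i)) = S.matE (i + 1) ∧
        ρ (S.finGen (.f i)) = S.kappa (i + 1) • S.matF (i + 1) ∧
        ρ (S.finGen (.t i)) = QOsp.qHalfPow (S.matH (i + 1)) ∧
        ρ (S.finGen (.tInv i)) = QOsp.qHalfPow (-S.matH (i + 1))) ∧
      (∀ r, ∀ x ∈ QOsp.gradedPart (QOsp.ChevGen.parity S.finDatum) S.finGen r,
        S.HasParity r (ρ x)) ∧
      -- its extension to the affine algebra
      ∃ ρ' : S.UqAff →ₐ[QOsp.GroundField] QOsp.Mat m n QOsp.GroundField,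
        (∀ i : Fin (QOsp.rk m n),
          ρ' (S.chevGen (.e i.succ)) = ρ (S.finGen (.e i)) ∧
          ρ' (S.chevGen (.f i.succ)) = ρ (S.finGen (.f i)) ∧
          ρ' (S.chevGen (.t i.succ)) = ρ (S.finGen (.t i)) ∧
          ρ' (S.chevGen (.tInv i.succ)) = ρ (S.finGen (.tInv i))) ∧
        (S.par 1 = 1 →
          ρ' (S.chevGen (.e 0)) = (a * u) • QOsp.E m n QOsp.GroundField (S.prime 1) 1 ∧
          ρ' (S.chevGen (.f 0)) = (b * u⁻¹) • QOsp.E m n QOsp.GroundField 1 (S.prime 1) ∧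
          ρ' (S.chevGen (.t 0)) = QOsp.qHalfPow ((2 : ℤ) • S.X ℤ 1 1) ∧
          ρ' (S.chevGen (.tInv 0)) = QOsp.qHalfPow (-((2 : ℤ) • S.X ℤ 1 1))) ∧
        (S.par 1 = 0 →
          ρ' (S.chevGen (.e 0)) = (a * u) • S.X QOsp.GroundField (S.prime 2) 1 ∧
          ρ' (S.chevGen (.f 0)) = (b * u⁻¹) • S.X QOsp.GroundField 1 (S.prime 2) ∧
          ρ' (S.chevGen (.t 0)) =
            QOsp.qHalfPow (-(S.psign 1 • S.X ℤ 1 1 + S.psign 2 • S.X ℤ 2 2)) ∧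
          ρ' (S.chevGen (.tInv 0)) =
            QOsp.qHalfPow (S.psign 1 • S.X ℤ 1 1 + S.psign 2 • S.X ℤ 2 2)) ∧
        ρ' (S.affGen .gam) = 1 ∧ ρ' (S.affGen .gamInv) = 1 ∧
        (∀ r, ∀ x ∈ QOsp.gradedPart (QOsp.AffGen.parity S.affDatum) S.affGen r,
          S.HasParity r (ρ' x)) ∧
        -- the explicit q-Serre relations for the operators of the e_i and of the f_i
        S.ExplicitSerre (fun i => ρ' (S.chevGen (.e i))) ∧
        S.ExplicitSerre (fun i => ρ' (S.chevGen (.f i))) := by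
  obtain ⟨ρ, hρ⟩ := QOsp.Setup.exists_finRep hu ha hb hab_odd hab_even
  obtain ⟨ρ', hρ'⟩ := QOsp.Setup.exists_affRep hu ha hb hab_odd hab_even
  have hc : ∀ g, ρ' (S.chevGen g) = S.chevOp a b u g := fun g => hρ' (.chev g)
  refine ⟨ρ, fun i => ?_, ?_, ρ', fun i => ?_, fun h => ?_, fun h => ?_, hρ' _, hρ' _, ?_, ?_, ?_⟩
  · simp only [hρ]
    exact ⟨QOsp.Setup.opE_succ i, QOsp.Setup.opF_succ i, QOsp.Setup.opT_succ i,
      QOsp.Setup.opTInv_succ i⟩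
  · refine QOsp.Setup.hasParity_of_mem_gradedPart ρ fun g => ?_
    rw [hρ, S.parity_succGen]
    exact QOsp.Setup.chevOp_hasParity _
  · simp only [hρ, hc]
    exact ⟨rfl, rfl, rfl, rfl⟩
  · simp only [hc]
    refine ⟨QOsp.Setup.opE_zero_odd h, QOsp.Setup.opF_zero_odd h, ?_, ?_⟩
    · simp only [QOsp.Setup.chevOp, QOsp.Setup.opT, QOsp.Setup.torExp_zero_odd h]
      rfl
    · simp only [QOsp.Setup.chevOp, QOsp.Setup.opTInv, QOsp.Setup.torExp_zero_odd h]
      rfl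
  · simp only [hc]
    refine ⟨QOsp.Setup.opE_zero_even h, QOsp.Setup.opF_zero_even h, ?_, ?_⟩
    · simp only [QOsp.Setup.chevOp, QOsp.Setup.opT, QOsp.Setup.torExp_zero_even h]
      rfl
    · simp only [QOsp.Setup.chevOp, QOsp.Setup.opTInv, QOsp.Setup.torExp_zero_even h, neg_neg]
      rfl
  · refine QOsp.Setup.hasParity_of_mem_gradedPart ρ' fun g => ?_
    rw [hρ']
    exact QOsp.Setup.affOp_hasParity _
  · simp only [hc]
    exact QOsp.Setup.explicitSerre_opE hu hb hab_odd hab_even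
  · simp only [hc]
    exact QOsp.Setup.explicitSerre_opF hu ha hb hab_odd hab_even
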